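/- Let $R$ be a discrete valuation ring with fraction field $K$ of characteristic $0$ and residue field $k$ of characteristic $p>0$; all schemes are assumed noetherian. Write $X_K$, $X_k$ for the generic and special fibres of an $R$-scheme $X$, and ${}_m\mathrm{Pic}(Z)$ for the kernel of multiplication by $m$ on the Picard group $\mathrm{Pic}(Z)$ of a scheme $Z$. Let $G$ be a finite abelian group of order $m$ and suppose that $R$ contains a primitive $m$-th root of unity. Let $X$ be a normal, faithfully flat $R$-scheme such that $X_K$ and $X_k$ are integral and such that restriction induces a bijection ${}_m\mathrm{Pic}(X)\to{}_m\mathrm{Pic}(X_K)$. Let $G_K$ denote the constant group scheme over $K$ with value $G$, let $f_K\colon Y_K\to X_K$ be a $G_K$-torsor with $Y_K$ connected, and let $Y$ be the normalization of $X$ in $Y_K$. Assume that the special fibre $Y_k$ is reduced. Then there exist a commutative finite flat $R$-group scheme $G'$ and a $G'$-torsor $f'\colon Y'\to X$ that extends $f_K$, i.e. there are an isomorphism of $K$-group schemes $G_K\cong G'_K$ and an isomorphism of $X_K$-schemes $Y_K\cong Y'_K$ compatible with the actions of $G_K$ and $G'_K$. Here, for a group scheme $H$ over a base $S$, an $H$-torsor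 $f\colon Y\to X$ is a faithfully flat $S$-morphism, locally of finite presentation, together with an action of $H$ on $Y$ over $X$ such that $H\times_S Y\to Y\times_X Y$, $(h,y)\mapsto(hy,y)$, is an isomorphism. -/

import Mathlib

open CategoryTheory Limits AlgebraicGeometry MonoidalCategory CartesianMonoidalCategory Opposite
open scoped TensorProduct

universe u

namespace WeakExtension

noncomputable section

section FunctionAlgebra

/-- The algebra of functions `G → K`. -/
def FunAlg (G : Type u) (K : Type u) : Type u := G → K

variable (G K : Type u) [CommRing K]

instance : CommRing (FunAlg G K) := inferInstanceAs (CommRing (G → K))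
instance : Algebra K (FunAlg G K) := inferInstanceAs (Algebra K (G → K))

variable {G K}

open Classical in
/-- The indicator function of the point `g`. -/
def FunAlg.delta (g : G) : FunAlg G K := fun x => if x = g then 1 else 0

variable (G K) in
/-- Evaluation at a point. -/
def FunAlg.eval (x : G) : FunAlg G K →ₐ[K] K := Pi.evalAlgHom K (fun _ : G => K) x

lemma FunAlg.ext_eval {f f' : FunAlg G K} (h : ∀ x, FunAlg.eval G K x f = FunAlg.eval G K x f') :
    f = f' := funext h

open Classical in
lemma FunAlg.eval_delta (x g : G) :
    FunAlg.eval G K x (FunAlg.delta g) = if x = g then 1 else 0 := rfl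

open Classical in
lemma FunAlg.delta_mul (g h : G) :
    (FunAlg.delta g * FunAlg.delta h : FunAlg G K) = if g = h then FunAlg.delta g else 0 := by
  refine FunAlg.ext_eval fun x => ?_
  rw [map_mul, apply_ite (FunAlg.eval G K x), map_zero, FunAlg.eval_delta, FunAlg.eval_delta]
  grind

variable [Fintype G]

lemma FunAlg.sum_smul_delta (f : FunAlg G K) :
    f = ∑ g : G, FunAlg.eval G K g f • (FunAlg.delta g : FunAlg G K) := by
  classical
  refine FunAlg.ext_eval fun x => ?_
  simp [FunAlg.eval_delta]

lemma FunAlg.sum_delta : ∑ g : G, (FunAlg.delta g : FunAlg G K) = 1 := by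
  classical
  refine FunAlg.ext_eval fun x => ?_
  simp [FunAlg.eval_delta]

lemma FunAlg.linearMap_ext {M : Type*} [AddCommGroup M] [Module K M]
    {φ ψ : FunAlg G K →ₗ[K] M} (h : ∀ g, φ (FunAlg.delta g) = ψ (FunAlg.delta g)) : φ = ψ := by
  ext f
  rw [FunAlg.sum_smul_delta f]
  simp [h]

variable [Group G]

variable (G K) in
/-- The linear map underlying the comultiplication: a function `f` is sent to the function
`(g, h) ↦ f (g * h)`, i.e. to `∑ f (g * h) δ_g ⊗ δ_h`. -/
def FunAlg.comulLin : FunAlg G K →ₗ[K] FunAlg G K ⊗[K] FunAlg G K :=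
  ∑ g : G, ∑ h : G, (FunAlg.eval G K (g * h)).toLinearMap.smulRight
    (FunAlg.delta g ⊗ₜ[K] FunAlg.delta h)

lemma FunAlg.comulLin_apply (f : FunAlg G K) :
    FunAlg.comulLin G K f = ∑ g : G, ∑ h : G, FunAlg.eval G K (g * h) f •
      ((FunAlg.delta g : FunAlg G K) ⊗ₜ[K] (FunAlg.delta h : FunAlg G K)) := by
  simp [FunAlg.comulLin, LinearMap.sum_apply]

lemma FunAlg.comulLin_delta (x : G) :
    FunAlg.comulLin G K (FunAlg.delta x) = ∑ g : G,
      ((FunAlg.delta g : FunAlg G K) ⊗ₜ[K] (FunAlg.delta (g⁻¹ * x) : FunAlg G K)) := by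
  classical
  rw [FunAlg.comulLin_apply]
  refine Finset.sum_congr rfl fun g _ => ?_
  rw [Finset.sum_eq_single (g⁻¹ * x)]
  · simp [FunAlg.eval_delta]
  · intro h _ hh
    rw [FunAlg.eval_delta, if_neg, zero_smul]
    rintro rfl; simp at hh
  · simp

variable (G K) in
/-- The comultiplication of the algebra of functions on `G`, dual to multiplication in `G`. -/
def FunAlg.comulAlg : FunAlg G K →ₐ[K] FunAlg G K ⊗[K] FunAlg G K :=
  AlgHom.ofLinearMap (FunAlg.comulLin G K)
    (by
      rw [FunAlg.comulLin_apply]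
      simp only [map_one, one_smul]
      simp only [← TensorProduct.tmul_sum, ← TensorProduct.sum_tmul, FunAlg.sum_delta]
      rfl)
    (by
      classical
      intro a b
      simp only [FunAlg.comulLin_apply, map_mul, Finset.sum_mul, Finset.mul_sum,
        smul_mul_smul_comm, Algebra.TensorProduct.tmul_mul_tmul, FunAlg.delta_mul]
      refine Finset.sum_congr rfl fun g _ => Finset.sum_congr rfl fun h _ => ?_
      rw [Finset.sum_eq_single g, Finset.sum_eq_single h]
      · simp
      · intro b _ hb; rw [if_neg hb]; simp
      · simp
      · intro b _ hb; simp [hb]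
      · simp)

instance : HopfAlgebra K (FunAlg G K) :=
  letI : Bialgebra K (FunAlg G K) := Bialgebra.ofAlgHom (FunAlg.comulAlg G K) (FunAlg.eval G K 1)
    (by
      apply AlgHom.toLinearMap_injective
      apply FunAlg.linearMap_ext
      intro x
      change (Algebra.TensorProduct.assoc K K K _ _ _) ((Algebra.TensorProduct.map
        (FunAlg.comulAlg G K) (.id K _)) (FunAlg.comulLin G K (FunAlg.delta x))) =
        (Algebra.TensorProduct.map (.id K _) (FunAlg.comulAlg G K))
          (FunAlg.comulLin G K (FunAlg.delta x))
      have hc : ∀ y : G, FunAlg.comulAlg G K (FunAlg.delta y) = ∑ g : G,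
        ((FunAlg.delta g : FunAlg G K) ⊗ₜ[K] (FunAlg.delta (g⁻¹ * y) : FunAlg G K)) :=
        FunAlg.comulLin_delta
      simp only [FunAlg.comulLin_delta, map_sum, Algebra.TensorProduct.map_tmul, hc,
        TensorProduct.sum_tmul, TensorProduct.tmul_sum, AlgHom.id_apply,
        Algebra.TensorProduct.assoc_tmul]
      rw [Finset.sum_comm]
      refine Finset.sum_congr rfl fun g _ => ?_
      refine Fintype.sum_equiv (Equiv.mulLeft g⁻¹) _ _ fun h => ?_
      simp)
    (by
      apply AlgHom.toLinearMap_injective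
      apply FunAlg.linearMap_ext
      intro x
      change (Algebra.TensorProduct.map (FunAlg.eval G K 1) (.id K _))
        (FunAlg.comulLin G K (FunAlg.delta x)) = (1 : K) ⊗ₜ[K] FunAlg.delta x
      classical
      simp only [FunAlg.comulLin_delta, map_sum, Algebra.TensorProduct.map_tmul,
        FunAlg.eval_delta, AlgHom.id_apply]
      rw [Finset.sum_eq_single 1]
      · simp
      · intro b _ hb; simp [hb.symm]
      · simp)
    (by
      apply AlgHom.toLinearMap_injective
      apply FunAlg.linearMap_ext
      intro x
      change (Algebra.TensorProduct.map (.id K _) (FunAlg.eval G K 1))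
        (FunAlg.comulLin G K (FunAlg.delta x)) = FunAlg.delta x ⊗ₜ[K] (1 : K)
      classical
      simp only [FunAlg.comulLin_delta, map_sum, Algebra.TensorProduct.map_tmul,
        FunAlg.eval_delta, AlgHom.id_apply]
      rw [Finset.sum_eq_single x]
      · simp
      · intro b _ hb
        rw [if_neg, TensorProduct.tmul_zero]
        intro h
        exact hb (by simpa using congrArg (b * ·) h)
      · simp)
  { antipode := (∑ g : G, (FunAlg.eval G K g⁻¹).toLinearMap.smulRight (FunAlg.delta g))
    mul_antipode_rTensor_comul := by
      apply FunAlg.linearMap_ext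
      intro x
      change LinearMap.mul' K _ (LinearMap.rTensor _ _ (FunAlg.comulLin G K (FunAlg.delta x))) =
        algebraMap K _ (FunAlg.eval G K 1 (FunAlg.delta x))
      classical
      have hS : ∀ y : G, (∑ g : G, (FunAlg.eval G K g⁻¹).toLinearMap.smulRight
          (FunAlg.delta g : FunAlg G K)) (FunAlg.delta y) = FunAlg.delta y⁻¹ := by
        intro y
        simp only [LinearMap.sum_apply, LinearMap.smulRight_apply, AlgHom.toLinearMap_apply,
          FunAlg.eval_delta]
        rw [Finset.sum_eq_single y⁻¹]
        · simp
        · intro b _ hb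
          rw [if_neg, zero_smul]
          rintro rfl; simp at hb
        · simp
      simp only [FunAlg.comulLin_delta, map_sum, LinearMap.rTensor_tmul, hS,
        LinearMap.mul'_apply, FunAlg.delta_mul, FunAlg.eval_delta]
      by_cases hx : x = 1
      · subst hx
        have : ∑ g : G, (FunAlg.delta g⁻¹ : FunAlg G K) = 1 := by
          rw [← FunAlg.sum_delta]
          exact Fintype.sum_equiv (Equiv.inv G) _ _ fun _ => rfl
        simpa using this
      · have : ∀ g : G, ¬ (g⁻¹ = g⁻¹ * x) := fun g h => hx (by simpa using h)
        simp [this, Ne.symm hx]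
    mul_antipode_lTensor_comul := by
      apply FunAlg.linearMap_ext
      intro x
      change LinearMap.mul' K _ (LinearMap.lTensor _ _ (FunAlg.comulLin G K (FunAlg.delta x))) =
        algebraMap K _ (FunAlg.eval G K 1 (FunAlg.delta x))
      classical
      have hS : ∀ y : G, (∑ g : G, (FunAlg.eval G K g⁻¹).toLinearMap.smulRight
          (FunAlg.delta g : FunAlg G K)) (FunAlg.delta y) = FunAlg.delta y⁻¹ := by
        intro y
        simp only [LinearMap.sum_apply, LinearMap.smulRight_apply, AlgHom.toLinearMap_apply,
          FunAlg.eval_delta]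
        rw [Finset.sum_eq_single y⁻¹]
        · simp
        · intro b _ hb
          rw [if_neg, zero_smul]
          rintro rfl; simp at hb
        · simp
      simp only [FunAlg.comulLin_delta, map_sum, LinearMap.lTensor_tmul, hS,
        LinearMap.mul'_apply, FunAlg.delta_mul, FunAlg.eval_delta]
      by_cases hx : x = 1
      · subst hx
        simpa using FunAlg.sum_delta
      · have : ∀ g : G, ¬ (g = (g⁻¹ * x)⁻¹) := fun g h => hx (by
          have := congrArg (x⁻¹ * ·) h
          simp at this; exact this)
        rw [Finset.sum_eq_zero fun g _ => if_neg (this g), if_neg (Ne.symm hx), map_zero] }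

variable (G K) in
/-- The constant group scheme over `Spec K` with value the finite group `G`. -/
abbrev constGrp : Over (Spec (.of K)) := (Spec (.of (FunAlg G K))).asOver (Spec (.of K))

end FunctionAlgebra

section Picard

/-- Pullback of units along `f : X ⟶ Y`, from an open `U` of `Y` to an open `V ⊆ f⁻¹ U` of `X`. -/
def pullUnit {X Y : Scheme.{u}} (f : X ⟶ Y) {U : Y.Opens} {V : X.Opens} (h : V ≤ f ⁻¹ᵁ U) :
    Γ(Y, U)ˣ →* Γ(X, V)ˣ :=
  Units.map (f.appLE U V h).hom.toMonoidHom

/-- Restriction of units to a smaller open. -/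
def resUnit {X : Scheme.{u}} {U V : X.Opens} (h : V ≤ U) : Γ(X, U)ˣ →* Γ(X, V)ˣ :=
  Units.map (X.presheaf.map (homOfLE h).op).hom.toMonoidHom

@[simp] lemma resUnit_resUnit {X : Scheme.{u}} {U V W : X.Opens} (h : V ≤ U) (h' : W ≤ V)
    (a : Γ(X, U)ˣ) : resUnit h' (resUnit h a) = resUnit (h'.trans h) a := by
  ext
  change (X.presheaf.map (homOfLE h).op ≫ X.presheaf.map (homOfLE h').op) _ = _
  rw [← Functor.map_comp]
  rfl

@[simp] lemma resUnit_pullUnit {X Y : Scheme.{u}} (f : X ⟶ Y) {U : Y.Opens} {V W : X.Opens}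
    (h : V ≤ f ⁻¹ᵁ U) (h' : W ≤ V) (a : Γ(Y, U)ˣ) :
    resUnit h' (pullUnit f h a) = pullUnit f (h'.trans h) a := by
  ext
  change (f.appLE U V h ≫ X.presheaf.map (homOfLE h').op) _ = _
  rw [Scheme.Hom.appLE_map]
  rfl

@[simp] lemma pullUnit_resUnit {X Y : Scheme.{u}} (f : X ⟶ Y) {U U' : Y.Opens} {V : X.Opens}
    (h : V ≤ f ⁻¹ᵁ U) (h' : U ≤ U') (a : Γ(Y, U')ˣ) :
    pullUnit f h (resUnit h' a) =
      pullUnit f (h.trans (f.preimage_mono h')) a := by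
  ext
  change (Y.presheaf.map (homOfLE h').op ≫ f.appLE U V h) _ = _
  rw [Scheme.Hom.map_appLE]
  rfl

lemma resUnit_pullUnit_comm {X Y : Scheme.{u}} (f : X ⟶ Y) {U U' : Y.Opens} {V V' : X.Opens}
    (h : V ≤ f ⁻¹ᵁ U) (h' : V' ≤ V) (k : U' ≤ U) (k' : V' ≤ f ⁻¹ᵁ U') (a : Γ(Y, U)ˣ) :
    resUnit h' (pullUnit f h a) = pullUnit f k' (resUnit k a) := by
  rw [resUnit_pullUnit, pullUnit_resUnit]

lemma resUnit_pullUnit_resUnit {X Y : Scheme.{u}} (f : X ⟶ Y) {U U' : Y.Opens}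
    {V V' V'' W : X.Opens} (h : V ≤ f ⁻¹ᵁ U') (k : U' ≤ U) (l : W ≤ V)
    (h' : V' ≤ f ⁻¹ᵁ U) (k' : V'' ≤ V') (l' : W ≤ V'') (a : Γ(Y, U)ˣ) :
    resUnit l (pullUnit f h (resUnit k a)) = resUnit l' (resUnit k' (pullUnit f h' a)) := by
  simp only [resUnit_pullUnit, pullUnit_resUnit]

/-- A line bundle on `X` given by transition functions: every point `x` has a chosen open
neighbourhood `U x` on which the line bundle is trivialized, and `g x y` is the transition unit on
`U x ⊓ U y`; in other words a Čech `1`-cocycle of `𝒪_X^×`. -/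
structure LineCocycle (X : Scheme.{u}) where
  /-- the trivializing neighbourhoods -/
  U : X → X.Opens
  mem : ∀ x, x ∈ U x
  /-- the transition functions -/
  g : ∀ x y, Γ(X, U x ⊓ U y)ˣ
  cocycle : ∀ x y z (W : X.Opens) (hx : W ≤ U x) (hy : W ≤ U y) (hz : W ≤ U z),
    resUnit (le_inf hx hy) (g x y) * resUnit (le_inf hy hz) (g y z) = resUnit (le_inf hx hz) (g x z)

namespace LineCocycle

variable {X Y : Scheme.{u}}

/-- Two systems of transition functions define isomorphic line bundles: after shrinking the
neighbourhoods they differ by a change of trivializations. -/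
def Rel (c d : LineCocycle X) : Prop :=
  ∃ (W : X → X.Opens) (_ : ∀ x, x ∈ W x) (hc : ∀ x, W x ≤ c.U x) (hd : ∀ x, W x ≤ d.U x)
    (h : ∀ x, Γ(X, W x)ˣ), ∀ x y,
    resUnit inf_le_left (h x) * resUnit (inf_le_inf (hc x) (hc y)) (c.g x y) =
      resUnit (inf_le_inf (hd x) (hd y)) (d.g x y) * resUnit inf_le_right (h y)

lemma Rel.refl (c : LineCocycle X) : Rel c c :=
  ⟨c.U, c.mem, fun _ => le_rfl, fun _ => le_rfl, fun _ => 1, fun x y => by simp⟩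

lemma Rel.symm {c d : LineCocycle X} : Rel c d → Rel d c := by
  rintro ⟨W, hW, hc, hd, h, H⟩
  refine ⟨W, hW, hd, hc, fun x => (h x)⁻¹, fun x y => ?_⟩
  rw [map_inv, map_inv, inv_mul_eq_iff_eq_mul, ← mul_assoc, eq_mul_inv_iff_mul_eq]
  exact (H x y).symm

lemma Rel.trans {c d e : LineCocycle X} : Rel c d → Rel d e → Rel c e := by
  rintro ⟨W, hW, hc, hd, h, H⟩ ⟨W', hW', hd', he, h', H'⟩
  refine ⟨fun x => W x ⊓ W' x, fun x => ⟨hW x, hW' x⟩, fun x => inf_le_left.trans (hc x),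
    fun x => inf_le_right.trans (he x),
    fun x => resUnit inf_le_left (h x) * resUnit inf_le_right (h' x), fun x y => ?_⟩
  have l : (W x ⊓ W' x) ⊓ (W y ⊓ W' y) ≤ W x ⊓ W y := inf_le_inf inf_le_left inf_le_left
  have l' : (W x ⊓ W' x) ⊓ (W y ⊓ W' y) ≤ W' x ⊓ W' y := inf_le_inf inf_le_right inf_le_right
  have A := congrArg (resUnit l) (H x y)
  have B := congrArg (resUnit l') (H' x y)
  simp only [map_mul, resUnit_resUnit] at A B ⊢
  rw [mul_comm (resUnit _ (h x)), mul_assoc, A, ← mul_assoc, B, mul_assoc,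
    mul_comm (resUnit _ (h' y))]

instance setoid (X : Scheme.{u}) : Setoid (LineCocycle X) where
  r := Rel
  iseqv := ⟨Rel.refl, Rel.symm, Rel.trans⟩

instance : One (LineCocycle X) :=
  ⟨⟨fun _ => ⊤, fun _ => trivial, fun _ _ => 1, fun _ _ _ _ _ _ _ => by simp⟩⟩

instance : Mul (LineCocycle X) :=
  ⟨fun c d => ⟨fun x => c.U x ⊓ d.U x, fun x => ⟨c.mem x, d.mem x⟩,
    fun x y => resUnit (inf_le_inf inf_le_left inf_le_left) (c.g x y) *
      resUnit (inf_le_inf inf_le_right inf_le_right) (d.g x y),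
    fun x y z W hx hy hz => by
      have A := c.cocycle x y z W (hx.trans inf_le_left) (hy.trans inf_le_left)
        (hz.trans inf_le_left)
      have B := d.cocycle x y z W (hx.trans inf_le_right) (hy.trans inf_le_right)
        (hz.trans inf_le_right)
      simp only [map_mul, resUnit_resUnit]
      rw [← A, ← B, mul_mul_mul_comm]⟩⟩

instance : Inv (LineCocycle X) :=
  ⟨fun c => ⟨c.U, c.mem, fun x y => (c.g x y)⁻¹, fun x y z W hx hy hz => by
    simp only [map_inv]
    rw [← mul_inv, c.cocycle x y z W hx hy hz]⟩⟩

/-- Pullback of a line bundle along a morphism. -/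
def pullback (f : X ⟶ Y) (c : LineCocycle Y) : LineCocycle X where
  U x := f ⁻¹ᵁ c.U (f x)
  mem x := c.mem (f x)
  g x y := pullUnit f (V := f ⁻¹ᵁ c.U (f x) ⊓ f ⁻¹ᵁ c.U (f y)) le_rfl (c.g (f x) (f y))
  cocycle x y z W hx hy hz := by
    have l : W ≤ f ⁻¹ᵁ (c.U (f x) ⊓ c.U (f y) ⊓ c.U (f z)) := le_inf (le_inf hx hy) hz
    have A := congrArg (pullUnit f l) (c.cocycle (f x) (f y) (f z) _
      (inf_le_left.trans inf_le_left) (inf_le_left.trans inf_le_right) inf_le_right)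
    simp only [map_mul, pullUnit_resUnit] at A
    exact (congrArg₂ (· * ·) (resUnit_pullUnit f _ _ _) (resUnit_pullUnit f _ _ _)).trans
      (A.trans (resUnit_pullUnit f _ _ _).symm)

lemma rel_mul {c c' d d' : LineCocycle X} (h₁ : c ≈ c') (h₂ : d ≈ d') : c * d ≈ c' * d' := by
  obtain ⟨W, hW, hc, hc', h, H⟩ := h₁
  obtain ⟨W', hW', hd, hd', h', H'⟩ := h₂
  refine ⟨fun x => W x ⊓ W' x, fun x => ⟨hW x, hW' x⟩, fun x => inf_le_inf (hc x) (hd x),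
    fun x => inf_le_inf (hc' x) (hd' x),
    fun x => resUnit inf_le_left (h x) * resUnit inf_le_right (h' x), fun x y => ?_⟩
  have l : (W x ⊓ W' x) ⊓ (W y ⊓ W' y) ≤ W x ⊓ W y := inf_le_inf inf_le_left inf_le_left
  have l' : (W x ⊓ W' x) ⊓ (W y ⊓ W' y) ≤ W' x ⊓ W' y := inf_le_inf inf_le_right inf_le_right
  have A := congrArg (resUnit l) (H x y)
  have B := congrArg (resUnit l') (H' x y)
  change _ * resUnit _ (resUnit _ (c.g x y) * resUnit _ (d.g x y)) =
    resUnit _ (resUnit _ (c'.g x y) * resUnit _ (d'.g x y)) * _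
  simp only [map_mul, resUnit_resUnit] at A B ⊢
  rw [mul_mul_mul_comm, A, B, mul_mul_mul_comm]

lemma rel_inv {c c' : LineCocycle X} (h₁ : c ≈ c') : c⁻¹ ≈ c'⁻¹ := by
  obtain ⟨W, hW, hc, hc', h, H⟩ := h₁
  refine ⟨W, hW, hc, hc', fun x => (h x)⁻¹, fun x y => ?_⟩
  change _ * resUnit _ (c.g x y)⁻¹ = resUnit _ (c'.g x y)⁻¹ * _
  simp only [map_inv]
  rw [← mul_inv, H x y, mul_inv]

lemma rel_pullback (f : X ⟶ Y) {c c' : LineCocycle Y} (h₁ : c ≈ c') :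
    c.pullback f ≈ c'.pullback f := by
  obtain ⟨W, hW, hc, hc', h, H⟩ := h₁
  refine ⟨fun x => f ⁻¹ᵁ W (f x), fun x => hW (f x), fun x => f.preimage_mono (hc _),
    fun x => f.preimage_mono (hc' _), fun x => pullUnit f le_rfl (h (f x)), fun x y => ?_⟩
  have A := congrArg (pullUnit f (V := f ⁻¹ᵁ W (f x) ⊓ f ⁻¹ᵁ W (f y)) le_rfl) (H (f x) (f y))
  change _ * resUnit _ (pullUnit f _ (c.g _ _)) = resUnit _ (pullUnit f _ (c'.g _ _)) * _
  simp only [map_mul] at A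
  exact (congrArg₂ (· * ·) (resUnit_pullUnit_comm f _ _ _ _ _)
    (resUnit_pullUnit_comm f _ _ _ _ _)).trans (A.trans (congrArg₂ (· * ·)
      (resUnit_pullUnit_comm f _ _ _ _ _) (resUnit_pullUnit_comm f _ _ _ _ _)).symm)

/-- Cocycles with the same transition functions on common smaller neighbourhoods are equivalent. -/
lemma rel_of_eq {c d : LineCocycle X} (H : ∀ x y (W : X.Opens) (h₁ : W ≤ c.U x ⊓ c.U y)
    (h₂ : W ≤ d.U x ⊓ d.U y), resUnit h₁ (c.g x y) = resUnit h₂ (d.g x y)) : c ≈ d :=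
  ⟨fun x => c.U x ⊓ d.U x, fun x => ⟨c.mem x, d.mem x⟩, fun _ => inf_le_left,
    fun _ => inf_le_right, fun _ => 1, fun x y => by
      simp only [map_one, one_mul, mul_one]
      exact H x y _ _ _⟩

end LineCocycle

/-- The Picard group of a scheme: isomorphism classes of line bundles, that is `H¹(X, 𝒪_X^×)`. -/
def Pic (X : Scheme.{u}) : Type u := Quotient (LineCocycle.setoid X)

open LineCocycle in
instance (X : Scheme.{u}) : CommGroup (Pic X) where
  mul := Quotient.map₂ (· * ·) fun _ _ h _ _ h' => rel_mul h h'
  one := Quotient.mk _ 1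
  inv := Quotient.map (·⁻¹) fun _ _ h => rel_inv h
  mul_assoc := by
    rintro ⟨a⟩ ⟨b⟩ ⟨c⟩
    refine Quotient.sound (rel_of_eq fun x y W h₁ h₂ => ?_)
    change resUnit h₁ (resUnit _ (resUnit _ (a.g x y) * resUnit _ (b.g x y)) *
      resUnit _ (c.g x y)) = resUnit h₂ (resUnit _ (a.g x y) *
        resUnit _ (resUnit _ (b.g x y) * resUnit _ (c.g x y)))
    simp only [map_mul, resUnit_resUnit, mul_assoc]
  one_mul := by
    rintro ⟨a⟩
    refine Quotient.sound (rel_of_eq fun x y W h₁ h₂ => ?_)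
    change resUnit h₁ (resUnit _ 1 * resUnit _ (a.g x y)) = resUnit h₂ (a.g x y)
    simp only [map_one, one_mul, resUnit_resUnit]
  mul_one := by
    rintro ⟨a⟩
    refine Quotient.sound (rel_of_eq fun x y W h₁ h₂ => ?_)
    change resUnit h₁ (resUnit _ (a.g x y) * resUnit _ 1) = resUnit h₂ (a.g x y)
    simp only [map_one, mul_one, resUnit_resUnit]
  inv_mul_cancel := by
    rintro ⟨a⟩
    refine Quotient.sound (rel_of_eq fun x y W h₁ h₂ => ?_)
    change resUnit h₁ (resUnit _ (a.g x y)⁻¹ * resUnit _ (a.g x y)) = resUnit h₂ 1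
    simp only [map_inv, map_one, inv_mul_cancel]
  mul_comm := by
    rintro ⟨a⟩ ⟨b⟩
    refine Quotient.sound (rel_of_eq fun x y W h₁ h₂ => ?_)
    change resUnit h₁ (resUnit _ (a.g x y) * resUnit _ (b.g x y)) =
      resUnit h₂ (resUnit _ (b.g x y) * resUnit _ (a.g x y))
    simp only [map_mul, resUnit_resUnit]
    exact mul_comm _ _

/-- Pullback of line bundle classes along `f : X ⟶ Y`. -/
def Pic.map {X Y : Scheme.{u}} (f : X ⟶ Y) : Pic Y →* Pic X where
  toFun := Quotient.map (LineCocycle.pullback f) fun _ _ h => LineCocycle.rel_pullback f h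
  map_one' := by
    refine Quotient.sound (LineCocycle.rel_of_eq fun x y W h₁ h₂ => ?_)
    change resUnit h₁ (pullUnit f _ 1) = resUnit h₂ 1
    simp only [map_one]
  map_mul' := by
    rintro ⟨a⟩ ⟨b⟩
    refine Quotient.sound (LineCocycle.rel_of_eq fun x y W h₁ h₂ => ?_)
    change resUnit h₁ (pullUnit f _ (resUnit _ (a.g _ _) * resUnit _ (b.g _ _))) =
      resUnit h₂ (resUnit _ (pullUnit f _ (a.g _ _)) * resUnit _ (pullUnit f _ (b.g _ _)))
    simp only [map_mul]
    exact congrArg₂ (· * ·) (resUnit_pullUnit_resUnit f _ _ _ _ _ _ _)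
      (resUnit_pullUnit_resUnit f _ _ _ _ _ _ _)

/-- The `m`-torsion subgroup `ₘPic(X)`, the kernel of multiplication by `m` on `Pic(X)`. -/
def torsionPic (m : ℕ) (X : Scheme.{u}) : Subgroup (Pic X) := (powMonoidHom m : Pic X →* Pic X).ker

end Picard

section Schemes

/-- A scheme is normal if all its local rings are integrally closed domains. -/
class IsNormalScheme (X : Scheme.{u}) : Prop where
  isDomain : ∀ x : X, IsDomain (X.presheaf.stalk x)
  isIntegrallyClosed : ∀ x : X, IsIntegrallyClosed (X.presheaf.stalk x)

/-- The morphism `Spec B ⟶ Spec R` for an `R`-algebra `B`. -/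
abbrev specMap (R B : Type u) [CommRing R] [CommRing B] [Algebra R B] :
    Spec (.of B) ⟶ Spec (.of R) :=
  Spec.map (CommRingCat.ofHom (algebraMap R B))

/-- The base change functor from `R`-schemes to `B`-schemes, `X ↦ X_B`. -/
abbrev baseChange (R B : Type u) [CommRing R] [CommRing B] [Algebra R B] :
    Over (Spec (.of R)) ⥤ Over (Spec (.of B)) :=
  Over.pullback (specMap R B)

/-- The projection `X_B ⟶ X`. -/
abbrev baseChangeProj {R : Type u} (B : Type u) [CommRing R] [CommRing B] [Algebra R B]
    (X : Over (Spec (.of R))) : ((baseChange R B).obj X).left ⟶ X.left :=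
  pullback.fst X.hom (specMap R B)

/-- Let `G` be a group scheme over `S` acting on the `S`-scheme `Y`. The morphism `f : Y ⟶ X` is a
`G`-torsor (for the fppf topology) if it is faithfully flat and locally of finite presentation, it
is `G`-invariant, and `G ×_S Y ⟶ Y ×_X Y`, `(g, y) ↦ (g y, y)`, is an isomorphism. -/
structure IsTorsor {S : Scheme.{u}} (G : Over S) [GrpObj G] {Y X : Over S} [ModObj G Y]
    (f : Y ⟶ X) : Prop where
  flat : Flat f.left
  surjective : Surjective f.left
  locallyOfFinitePresentation : LocallyOfFinitePresentation f.left
  /-- the action map and the second projection exhibit `G ×_S Y` as `Y ×_X Y` -/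
  isPullback : IsPullback (ModObj.smul (M := G) (X := Y) : G ⊗ Y ⟶ Y) (snd G Y) f f

open scoped Obj in
/-- The `G'`-torsor `f' : Y' ⟶ X` over `R` extends the `H`-torsor `f : Y ⟶ X_K` over `K`: there are
an isomorphism `H ≅ G'_K` of `K`-group schemes and an isomorphism `Y ≅ Y'_K` of `X_K`-schemes
that is compatible with the actions of `H` and `G'_K`. Here the action of `G'_K` on `Y'_K` is the
base change of the action of `G'` on `Y'`. -/
def TorsorExtends {R K : Type u} [CommRing R] [CommRing K] [Algebra R K]
    {X : Over (Spec (.of R))}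
    (G' : Over (Spec (.of R))) [GrpObj G'] {Y' : Over (Spec (.of R))} [ModObj G' Y'] (f' : Y' ⟶ X)
    (H : Over (Spec (.of K))) [GrpObj H] {Y : Over (Spec (.of K))} [ModObj H Y]
    (f : Y ⟶ (baseChange R K).obj X) : Prop :=
  ∃ (e : H ≅ (baseChange R K).obj G') (i : Y ≅ (baseChange R K).obj Y'),
    IsMonHom e.hom ∧
    i.hom ≫ (baseChange R K).map f' = f ∧
    (ModObj.smul (M := H) (X := Y) : H ⊗ Y ⟶ Y) ≫ i.hom =
      (e.hom ⊗ₘ i.hom) ≫ Functor.LaxMonoidal.μ (baseChange R K) G' Y' ≫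
        (baseChange R K).map (ModObj.smul (M := G') (X := Y') : G' ⊗ Y' ⟶ Y')

section Normalization

variable {R K : Type u} [CommRing R] [CommRing K] [Algebra R K] {X : Over (Spec (.of R))}
  {Y : Over (Spec (.of K))} (f : Y ⟶ (baseChange R K).obj X) [IsNoetherian Y.left]

/-- The normalization of `X` in `Y`, for a noetherian scheme `Y` over `X_K`, as an `R`-scheme. -/
def normalizationIn : Over (Spec (.of R)) :=
  Over.mk ((f.left ≫ baseChangeProj K X).fromNormalization ≫ X.hom)

end Normalization

end Schemes

end

end WeakExtension

open WeakExtension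

/-! Since `|G|` is invertible in `K` and `K` contains the `m`-th roots of unity, the direct image of
`𝒪_Y` on `X_K` (with `Y = Y_K`) splits into weight pieces indexed by the characters `χ : G →* Kˣ`,
which form a finite group `D`. Each piece is a line bundle, and it is `m`-torsion because `χ ^ m =
1`. By the Picard hypothesis it extends to `X`. So every point of `X` has an affine neighbourhood
`U` over which `Y` carries an invertible function `e` of weight `χ`
(`IsTorsor.exists_unit_isWt_of_surjOn`).

The power `e ^ m` has trivial weight and descends to a unit on the generic fibre of `U`. As `X_k` is
integral, a uniformizer `π` is prime or invertible in `𝒪(U)`, so `e ^ m = π ^ d * u` with `u` a unit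
of `𝒪(U)`. Multiplying `e` by a power of `π` achieves `0 ≤ d < m`. If `d > 0`, then `e` is integral
over `𝒪(U)` and `e ^ m` vanishes on the special fibre of the normalization. That fibre is reduced,
so `e = π * c` with `c` integral. Then `π⁻¹ = c ^ m * π ^ (m - d - 1) * u⁻¹` is integral over the
normal ring `𝒪(U)`, so `π` is invertible there and can be absorbed into `u`. In every case `e ^ m`
becomes a unit of `𝒪(U)` (`exists_zpow_mul_pow_eq`, `IsTorsor.exists_root`).

The functions on `Y` all of whose weight components are integral over `X` form a quasi-coherent
`D`-graded algebra. By normality its trivial component is `𝒪_X`, and every component is locally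
generated by a unit `e` as above. Its relative spectrum `Y'` is therefore a torsor under the
diagonalizable group scheme `G' = Spec R[D]` (`IsTorsor.exists_model`, `Grading.isTorsor`). Over `K`
it gives back `Y` (`IsTorsor.isIso_toGenericFibre`). Fourier inversion identifies `K[D]` with the
functions on `G`, so `G_K ≅ G'_K`, compatibly with the actions (`isIso_of_chr_eq`,
`IsTorsor.smul_comp_eq`). -/

namespace WeakExtension

noncomputable section

/-! ### Weight decomposition for a finite abelian group -/

section Weights

/-- An action of a finite group `G` on a ring `C` by ring endomorphisms, together with a group `D`
of invariant `C`-valued characters of `G` satisfying the two orthogonality relations, where the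
order of `G` is invertible in `C`. -/
structure CharAction (G D C : Type*) [Group G] [Fintype G] [CommGroup D] [Fintype D]
    [CommRing C] where
  /-- the action -/
  act : G →* (C →+* C)
  /-- the characters -/
  ev : D →* G →* C
  act_ev : ∀ g χ h, act g (ev χ h) = ev χ h
  /-- the inverse of the order of `G` -/
  inv : C
  inv_mul_card : inv * (Fintype.card G : C) = 1
  sum_ev : ∀ g, g ≠ 1 → ∑ χ, ev χ g = 0
  sum_ev' : ∀ χ, χ ≠ 1 → ∑ g, ev χ g = 0
  card_eq : Fintype.card D = Fintype.card G

namespace CharAction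

variable {G D C : Type*} [CommGroup G] [Fintype G] [CommGroup D] [Fintype D] [CommRing C]
  (A : CharAction G D C)

/-- The elements of weight `χ`. -/
def IsWt (χ : D) (c : C) : Prop := ∀ g, A.act g c = A.ev χ g * c

lemma act_inv (g : G) : A.act g A.inv = A.inv := by
  have h := congrArg (A.act g) A.inv_mul_card
  simp only [map_mul, map_natCast, map_one] at h
  calc A.act g A.inv = A.act g A.inv * (A.inv * (Fintype.card G : C)) := by
        rw [A.inv_mul_card, mul_one]
    _ = A.inv * (A.act g A.inv * (Fintype.card G : C)) := by ring
    _ = A.inv := by rw [h, mul_one]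

lemma ev_mul_ev_inv (χ : D) (g : G) : A.ev χ g * A.ev χ g⁻¹ = 1 := by
  rw [← map_mul, mul_inv_cancel, map_one]

lemma ev_inv (χ : D) (g : G) : A.ev χ⁻¹ g = A.ev χ g⁻¹ := by
  have h : A.ev χ⁻¹ g * A.ev χ g = 1 := by
    rw [← MonoidHom.mul_apply, ← map_mul, inv_mul_cancel, map_one, MonoidHom.one_apply]
  calc A.ev χ⁻¹ g = A.ev χ⁻¹ g * (A.ev χ g * A.ev χ g⁻¹) := by rw [A.ev_mul_ev_inv, mul_one]
    _ = A.ev χ g⁻¹ := by rw [← mul_assoc, h, one_mul]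

variable {A}

lemma IsWt.mul {χ ψ : D} {a b : C} (ha : A.IsWt χ a) (hb : A.IsWt ψ b) :
    A.IsWt (χ * ψ) (a * b) := fun g => by
  rw [map_mul, ha g, hb g, map_mul, MonoidHom.mul_apply]; ring

lemma isWt_one_iff {a : C} : A.IsWt 1 a ↔ ∀ g, A.act g a = a := by simp [IsWt]

lemma IsWt.one : A.IsWt 1 (1 : C) := by simp [isWt_one_iff]

lemma IsWt.pow {χ : D} {a : C} (ha : A.IsWt χ a) (n : ℕ) : A.IsWt (χ ^ n) (a ^ n) := by
  induction n with
  | zero => simpa using IsWt.one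
  | succ n ih => rw [pow_succ, pow_succ]; exact ih.mul ha

lemma IsWt.inv_of_mul_eq_one {χ : D} {a b : C} (ha : A.IsWt χ a) (h : a * b = 1) :
    A.IsWt χ⁻¹ b := fun g => by
  have h2 : A.act g a * A.act g b = 1 := by rw [← map_mul, h, map_one]
  rw [ha g] at h2
  rw [A.ev_inv]
  calc A.act g b = (A.ev χ g * A.ev χ g⁻¹) * (a * b) * A.act g b := by
        rw [h, A.ev_mul_ev_inv]; ring
    _ = (A.ev χ g * a * A.act g b) * (A.ev χ g⁻¹ * b) := by ring
    _ = A.ev χ g⁻¹ * b := by rw [h2, one_mul]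

variable (A)

/-- The projection onto the elements of weight `χ`. -/
def proj (χ : D) : C →+ C where
  toFun c := A.inv * ∑ g, A.ev χ g⁻¹ * A.act g c
  map_zero' := by simp
  map_add' a b := by simp [mul_add, Finset.sum_add_distrib]

lemma proj_apply (χ : D) (c : C) : A.proj χ c = A.inv * ∑ g, A.ev χ g⁻¹ * A.act g c := rfl

/-- Replacing `g` by `h * g` in the average takes out the factor `χ(h)`. -/
lemma isWt_proj (χ : D) (c : C) : A.IsWt χ (A.proj χ c) := fun h => by
  rw [proj_apply, map_mul, A.act_inv, map_sum, mul_left_comm]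
  congr 1
  rw [Finset.mul_sum]
  refine Fintype.sum_equiv (Equiv.mulLeft h) _ _ fun g => ?_
  simp only [map_mul, A.act_ev, Equiv.coe_mulLeft, mul_inv]
  rw [← mul_assoc, ← mul_assoc, A.ev_mul_ev_inv, one_mul]
  rfl

/-- By orthogonality in `χ` only the term of `g = 1` survives; it occurs `|D| = |G|` times. -/
lemma sum_proj (c : C) : ∑ χ, A.proj χ c = c := by
  classical
  simp only [proj_apply]
  rw [← Finset.mul_sum, Finset.sum_comm]
  simp only [← Finset.sum_mul]
  rw [Finset.sum_eq_single 1]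
  · simp [← mul_assoc, A.card_eq, A.inv_mul_card]
  · intro g _ hg
    rw [A.sum_ev _ (by simpa using hg), zero_mul]
  · simp

lemma proj_mul_of_isWt {χ : D} {c : C} (hc : A.IsWt χ c) (ψ : D) (a : C) :
    A.proj ψ (c * a) = c * A.proj (χ⁻¹ * ψ) a := by
  simp only [proj_apply, map_mul, hc _, MonoidHom.mul_apply, A.ev_inv, inv_inv]
  rw [mul_left_comm]
  congr 1
  rw [Finset.mul_sum]
  exact Finset.sum_congr rfl fun g _ => by ring

variable {A}

lemma IsWt.proj_self {χ : D} {c : C} (hc : A.IsWt χ c) : A.proj χ c = c := by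
  rw [proj_apply]
  have : ∀ g, A.ev χ g⁻¹ * A.act g c = c := fun g => by
    rw [hc g, ← mul_assoc, mul_comm (A.ev χ g⁻¹), A.ev_mul_ev_inv, one_mul]
  simp [this, ← mul_assoc, A.inv_mul_card]

lemma IsWt.proj_ne {χ ψ : D} {c : C} (hc : A.IsWt χ c) (h : ψ ≠ χ) : A.proj ψ c = 0 := by
  rw [proj_apply]
  have : ∀ g, A.ev ψ g⁻¹ * A.act g c = A.ev (ψ⁻¹ * χ) g * c := fun g => by
    rw [hc g, ← mul_assoc, map_mul, MonoidHom.mul_apply, A.ev_inv]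
  simp only [this]
  rw [← Finset.sum_mul, A.sum_ev' _ (by rwa [ne_eq, inv_mul_eq_one]), zero_mul, mul_zero]

/-- Components of a product are convolutions; this is what makes the sections with integral
components a ring. -/
lemma proj_mul (χ : D) (a b : C) :
    A.proj χ (a * b) = ∑ ψ, A.proj ψ a * A.proj (ψ⁻¹ * χ) b := by
  conv_lhs => rw [← A.sum_proj a, Finset.sum_mul, map_sum]
  exact Finset.sum_congr rfl fun ψ _ => A.proj_mul_of_isWt (A.isWt_proj ψ a) χ b

/-- If `∑ x i * y i` separates the characters, there are elements of weight `χ` and `χ⁻¹` whose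
products generate the unit ideal. -/
lemma exists_sum_mul_eq_one {ι : Type*} (s : Finset ι) (x y : ι → C) (χ : D)
    (h : ∀ g, ∑ i ∈ s, A.act g (x i) * y i = A.ev χ g) :
    ∑ i ∈ s, A.proj χ (x i) * A.proj χ⁻¹ (y i) = 1 := by
  -- Multiplying `h` by `χ(g)⁻¹` makes every term of the average over `g` equal to 1.
  have h1 : ∑ i ∈ s, A.proj χ (x i) * y i = 1 := by
    simp only [proj_apply, Finset.mul_sum, Finset.sum_mul]
    rw [Finset.sum_comm]
    have : ∀ g, ∑ i ∈ s, A.inv * (A.ev χ g⁻¹ * A.act g (x i)) * y i = A.inv := fun g => by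
      have := congrArg (fun t => A.inv * (A.ev χ g⁻¹ * t)) (h g)
      simp only [mul_comm (A.ev χ g⁻¹) (A.ev χ g), A.ev_mul_ev_inv, mul_one] at this
      conv_rhs => rw [← this, Finset.mul_sum, Finset.mul_sum]
      exact Finset.sum_congr rfl fun i _ => by ring
    simp [this, mul_comm _ A.inv, A.inv_mul_card]
  -- Since `A.proj χ (x i)` has weight `χ`, projecting to trivial weight replaces `y i` by its
  -- component of weight `χ⁻¹`.
  have h2 := congrArg (A.proj 1) h1
  rw [map_sum, IsWt.one.proj_self] at h2
  rw [← h2]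
  exact Finset.sum_congr rfl fun i _ => by
    rw [A.proj_mul_of_isWt (A.isWt_proj χ _), mul_one]

end CharAction

end Weights

/-! ### Restriction, pullback and gluing of sections; morphisms to an affine scheme -/

section Sections

/-- Restriction of sections to a smaller open. -/
def secRes {X : Scheme.{u}} {U V : X.Opens} (h : V ≤ U) : Γ(X, U) →+* Γ(X, V) :=
  (X.presheaf.map (homOfLE h).op).hom

/-- Pullback of sections. -/
def secPull {X Y : Scheme.{u}} (f : X ⟶ Y) {U : Y.Opens} {V : X.Opens} (h : V ≤ f ⁻¹ᵁ U) :
    Γ(Y, U) →+* Γ(X, V) :=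
  (f.appLE U V h).hom

@[simp] lemma secRes_secRes {X : Scheme.{u}} {U V W : X.Opens} (h : V ≤ U) (h' : W ≤ V)
    (a : Γ(X, U)) : secRes h' (secRes h a) = secRes (h'.trans h) a := by
  change (X.presheaf.map (homOfLE h).op ≫ X.presheaf.map (homOfLE h').op) _ = _
  rw [← Functor.map_comp]
  rfl

@[simp] lemma secRes_self {X : Scheme.{u}} {U : X.Opens} (h : U ≤ U) (a : Γ(X, U)) :
    secRes h a = a := by
  change (X.presheaf.map (𝟙 (op U))) a = a
  rw [CategoryTheory.Functor.map_id]; rfl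

@[simp] lemma secRes_secPull {X Y : Scheme.{u}} (f : X ⟶ Y) {U : Y.Opens} {V W : X.Opens}
    (h : V ≤ f ⁻¹ᵁ U) (h' : W ≤ V) (a : Γ(Y, U)) :
    secRes h' (secPull f h a) = secPull f (h'.trans h) a := by
  change (f.appLE U V h ≫ X.presheaf.map (homOfLE h').op) _ = _
  rw [Scheme.Hom.appLE_map]
  rfl

@[simp] lemma secPull_secRes {X Y : Scheme.{u}} (f : X ⟶ Y) {U U' : Y.Opens} {V : X.Opens}
    (h : V ≤ f ⁻¹ᵁ U) (h' : U ≤ U') (a : Γ(Y, U')) :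
    secPull f h (secRes h' a) = secPull f (h.trans (f.preimage_mono h')) a := by
  change (Y.presheaf.map (homOfLE h').op ≫ f.appLE U V h) _ = _
  rw [Scheme.Hom.map_appLE]
  rfl

lemma secPull_secPull {X Y Z : Scheme.{u}} (f : X ⟶ Y) (g : Y ⟶ Z) {U : Z.Opens} {V : Y.Opens}
    {W : X.Opens} (h : V ≤ g ⁻¹ᵁ U) (h' : W ≤ f ⁻¹ᵁ V) (a : Γ(Z, U)) :
    secPull f h' (secPull g h a) =
      secPull (f ≫ g) (h'.trans (f.preimage_mono h)) a := by
  change (g.appLE U V h ≫ f.appLE V W h') _ = _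
  rw [Scheme.Hom.appLE_comp_appLE]
  rfl

lemma secPull_congr {X Y : Scheme.{u}} {f g : X ⟶ Y} (e : f = g) {U : Y.Opens} {V : X.Opens}
    (h : V ≤ f ⁻¹ᵁ U) (a : Γ(Y, U)) : secPull f h a = secPull g (e ▸ h) a := by
  subst e; rfl

lemma secPull_id {X : Scheme.{u}} {U V : X.Opens} (h : V ≤ (𝟙 X) ⁻¹ᵁ U) (a : Γ(X, U)) :
    secPull (𝟙 X) h a = secRes h a := by
  change (Scheme.Hom.appLE (𝟙 X) U V h) a = _
  simp only [Scheme.Hom.appLE, Scheme.Hom.id_app]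
  rfl

lemma sec_ext {X : Scheme.{u}} {V : X.Opens} {s t : Γ(X, V)}
    (H : ∀ x ∈ V, ∃ W : X.Opens, x ∈ W ∧ ∃ h : W ≤ V, secRes h s = secRes h t) : s = t := by
  choose W hxW hW H using H
  refine X.sheaf.eq_of_locally_eq' (fun x : V => W x.1 x.2) V (fun x => homOfLE (hW x.1 x.2))
    (fun x hx => ?_) _ _ fun x => H x.1 x.2
  exact TopologicalSpace.Opens.mem_iSup.mpr ⟨⟨x, hx⟩, hxW x hx⟩

/-- Agreement is only asked near each point of an overlap; `sec_ext` upgrades it to agreement on the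
whole intersection. -/
lemma sec_glue {X : Scheme.{u}} {V : X.Opens} {ι : Type u} (U : ι → X.Opens) (hU : ∀ i, U i ≤ V)
    (cov : ∀ x ∈ V, ∃ i, x ∈ U i) (s : ∀ i, Γ(X, U i))
    (H : ∀ i j, ∀ x ∈ U i, x ∈ U j → ∃ W : X.Opens, x ∈ W ∧ ∃ (hi : W ≤ U i) (hj : W ≤ U j),
      secRes hi (s i) = secRes hj (s j)) :
    ∃ t : Γ(X, V), ∀ i, secRes (hU i) t = s i := by
  obtain ⟨t, ht, -⟩ := X.sheaf.existsUnique_gluing' U V (fun i => homOfLE (hU i))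
    (fun x hx => by
      obtain ⟨i, hi⟩ := cov x hx
      exact TopologicalSpace.Opens.mem_iSup.mpr ⟨i, hi⟩) s (fun i j => by
      change secRes inf_le_left (s i) = secRes inf_le_right (s j)
      refine sec_ext fun x hx => ?_
      obtain ⟨W, hxW, hi, hj, h⟩ := H i j x hx.1 hx.2
      exact ⟨W, hxW, le_inf hi hj, by simpa using h⟩)
  exact ⟨t, ht⟩

lemma sec_isUnit {X : Scheme.{u}} {V : X.Opens} {s : Γ(X, V)}
    (H : ∀ x ∈ V, ∃ W : X.Opens, x ∈ W ∧ ∃ h : W ≤ V, IsUnit (secRes h s)) : IsUnit s := by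
  refine X.toRingedSpace.isUnit_of_isUnit_germ V s fun x hx => ?_
  obtain ⟨W, hxW, hW, h⟩ := H x hx
  have := h.map (X.presheaf.germ W x hxW).hom
  change IsUnit (X.presheaf.germ V x hx s)
  rwa [← X.presheaf.germ_res_apply (homOfLE hW) x hxW s]

lemma le_preimage_top {X Y : Scheme.{u}} (f : X ⟶ Y) (V : X.Opens) : V ≤ f ⁻¹ᵁ ⊤ :=
  fun _ _ => trivial

/-- The function on `T` attached to an element of `A` by a morphism to `Spec A`. -/
def evalSec {T : Scheme.{u}} {A : Type u} [CommRing A] (h : T ⟶ Spec (.of A)) (V : T.Opens) :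
    A →+* Γ(T, V) :=
  (secPull h (le_preimage_top h V)).comp (Scheme.ΓSpecIso (.of A)).inv.hom

@[simp] lemma secRes_evalSec {T : Scheme.{u}} {A : Type u} [CommRing A] (h : T ⟶ Spec (.of A))
    {V W : T.Opens} (hW : W ≤ V) (a : A) : secRes hW (evalSec h V a) = evalSec h W a := by
  rw [evalSec, RingHom.comp_apply, secRes_secPull]; rfl

lemma secPull_evalSec {T T' : Scheme.{u}} {A : Type u} [CommRing A] (f : T' ⟶ T)
    (h : T ⟶ Spec (.of A)) {V : T.Opens} {W : T'.Opens} (hW : W ≤ f ⁻¹ᵁ V) (a : A) :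
    secPull f hW (evalSec h V a) = evalSec (f ≫ h) W a := by
  rw [evalSec, RingHom.comp_apply, secPull_secPull]; rfl

lemma evalSec_comp_specMap {T : Scheme.{u}} {A B : Type u} [CommRing A] [CommRing B]
    (h : T ⟶ Spec (.of B)) (φ : A →+* B) (V : T.Opens) (a : A) :
    evalSec (h ≫ Spec.map (CommRingCat.ofHom φ)) V a = evalSec h V (φ a) := by
  rw [evalSec, RingHom.comp_apply, ← secPull_secPull h (Spec.map (CommRingCat.ofHom φ))
    (le_preimage_top _ ⊤) (le_preimage_top h V), evalSec, RingHom.comp_apply]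
  congr 1
  change ((Scheme.ΓSpecIso (.of A)).inv ≫ (Spec.map (CommRingCat.ofHom φ)).appLE ⊤ ⊤ le_top) a =
    (CommRingCat.ofHom φ ≫ (Scheme.ΓSpecIso (.of B)).inv) a
  rw [Scheme.ΓSpecIso_inv_naturality, Scheme.Hom.appTop, Scheme.Hom.app_eq_appLE]
  rfl

lemma evalSec_eq_top {T : Scheme.{u}} {A : Type u} [CommRing A] (h : T ⟶ Spec (.of A)) :
    evalSec h ⊤ = ((Scheme.ΓSpecIso (.of A)).inv ≫ h.appTop).hom := by
  rw [Scheme.Hom.appTop, Scheme.Hom.app_eq_appLE]; rfl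

lemma evalSec_surj {T : Scheme.{u}} {A : Type u} [CommRing A] (φ : A →+* Γ(T, ⊤)) :
    ∃ h : T ⟶ Spec (.of A), evalSec h ⊤ = φ := by
  refine ⟨T.toSpecΓ ≫ Spec.map (CommRingCat.ofHom φ), ?_⟩
  rw [evalSec_eq_top]
  simp

lemma evalSec_inj {T : Scheme.{u}} {A : Type u} [CommRing A] {h h' : T ⟶ Spec (.of A)}
    (H : ∀ a, evalSec h ⊤ a = evalSec h' ⊤ a) : h = h' := by
  refine ext_of_isAffine ?_
  have : evalSec h ⊤ = evalSec h' ⊤ := RingHom.ext H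
  rw [evalSec_eq_top, evalSec_eq_top] at this
  exact (cancel_epi _).mp (CommRingCat.hom_ext this)

end Sections

/-! ### Morphisms into a scheme that is affine over the base -/

section AffineMorphisms

lemma ι_comp_eq {X Y : Scheme.{u}} {U : Y.Opens} (hU : IsAffineOpen U) (f : X ⟶ Y) {V : X.Opens}
    (h : V ≤ f ⁻¹ᵁ U) :
    V.ι ≫ f = V.toSpecΓ ≫ Spec.map (f.appLE U V h) ≫ hU.fromSpec := by
  rw [Scheme.Opens.toSpecΓ_SpecMap_appLE_assoc, IsAffineOpen.toSpecΓ_fromSpec]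
  simp

lemma exists_affine_le {X : Scheme.{u}} {V : X.Opens} {x : X} (hx : x ∈ V) :
    ∃ U : X.Opens, IsAffineOpen U ∧ x ∈ U ∧ U ≤ V := by
  obtain ⟨_, ⟨U, hU, rfl⟩, hxU, hUV⟩ :=
    X.isBasis_affineOpens.exists_subset_of_mem_open (a := x) hx V.2
  exact ⟨U, hU, hxU, hUV⟩

lemma hom_ext_of_cover {T Y : Scheme.{u}} {a b : T ⟶ Y}
    (H : ∀ x : T, ∃ W : T.Opens, x ∈ W ∧ W.ι ≫ a = W.ι ≫ b) : a = b := by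
  choose W hxW H using H
  exact Scheme.Cover.hom_ext (T.openCoverOfIsOpenCover W
    (TopologicalSpace.IsOpenCover.mk (eq_top_iff.mpr fun x _ =>
      TopologicalSpace.Opens.mem_iSup.mpr ⟨x, hxW x⟩))) _ _ H

lemma hom_glue {T Y : Scheme.{u}} {ι : Type u} (U : ι → T.Opens) (cov : ∀ x : T, ∃ i, x ∈ U i)
    (g : ∀ i, (U i).toScheme ⟶ Y)
    (H : ∀ i j, ∀ x ∈ U i, x ∈ U j → ∃ W : T.Opens, x ∈ W ∧ ∃ (hi : W ≤ U i) (hj : W ≤ U j),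
      T.homOfLE hi ≫ g i = T.homOfLE hj ≫ g j) :
    ∃ h : T ⟶ Y, ∀ i, (U i).ι ≫ h = g i := by
  let 𝒰 := T.openCoverOfIsOpenCover U (TopologicalSpace.IsOpenCover.mk (eq_top_iff.mpr fun x _ =>
      TopologicalSpace.Opens.mem_iSup.mpr (cov x)))
  refine ⟨𝒰.glueMorphisms g fun i j => ?_, fun i => 𝒰.ι_glueMorphisms g _ i⟩
  change pullback.fst (U i).ι (U j).ι ≫ g i = pullback.snd (U i).ι (U j).ι ≫ g j
  refine hom_ext_of_cover fun z => ?_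
  -- The fibre product is the intersection of the two opens; the local agreement on `T` is
  -- transported along its map `p` to `T`.
  let p := pullback.fst (U i).ι (U j).ι ≫ (U i).ι
  have hz : p z ∈ U j := by
    have : p z = (pullback.snd (U i).ι (U j).ι ≫ (U j).ι) z :=
      congrArg (fun k => k z) (pullback.condition (f := (U i).ι) (g := (U j).ι))
    rw [this]
    exact (pullback.snd (U i).ι (U j).ι z).2
  obtain ⟨W, hxW, hi, hj, h⟩ := H i j (p z) (pullback.fst (U i).ι (U j).ι z).2 hz
  refine ⟨p ⁻¹ᵁ W, hxW, ?_⟩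
  let l : (p ⁻¹ᵁ W).toScheme ⟶ W := IsOpenImmersion.lift W.ι ((p ⁻¹ᵁ W).ι ≫ p) (by
    rintro _ ⟨y, rfl⟩
    simpa using! y.2)
  have hl : l ≫ W.ι = (p ⁻¹ᵁ W).ι ≫ p := IsOpenImmersion.lift_fac _ _ _
  have h1 : (p ⁻¹ᵁ W).ι ≫ pullback.fst (U i).ι (U j).ι = l ≫ T.homOfLE hi := by
    rw [← cancel_mono (U i).ι, Category.assoc, Category.assoc, Scheme.homOfLE_ι, hl]
  have h2 : (p ⁻¹ᵁ W).ι ≫ pullback.snd (U i).ι (U j).ι = l ≫ T.homOfLE hj := by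
    rw [← cancel_mono (U j).ι, Category.assoc, Category.assoc, Scheme.homOfLE_ι, hl,
      ← pullback.condition]
  rw [reassoc_of% h1, reassoc_of% h2, h]

lemma toSpecΓ_SpecMap_inj {X : Scheme.{u}} (V : X.Opens) {A : CommRingCat.{u}}
    {φ ψ : A ⟶ Γ(X, V)} (h : V.toSpecΓ ≫ Spec.map φ = V.toSpecΓ ≫ Spec.map ψ) : φ = ψ := by
  have := congrArg Scheme.Hom.appTop h
  simp only [Scheme.Hom.comp_appTop, Scheme.Opens.toSpecΓ_appTop,
    Scheme.ΓSpecIso_naturality_assoc] at this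
  exact (cancel_mono V.topIso.inv).mp ((cancel_epi (Scheme.ΓSpecIso A).hom).mp this)

lemma hom_ext_of_affine {X Y T : Scheme.{u}} (f : Y ⟶ X) [IsAffineHom f] {a b : T ⟶ Y}
    (H : ∀ x : T, ∃ U : X.Opens, IsAffineOpen U ∧ ∃ W : T.Opens, x ∈ W ∧
      ∃ (ha : W ≤ a ⁻¹ᵁ f ⁻¹ᵁ U) (hb : W ≤ b ⁻¹ᵁ f ⁻¹ᵁ U), ∀ s : Γ(Y, f ⁻¹ᵁ U),
        secPull a ha s = secPull b hb s) : a = b := by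
  refine hom_ext_of_cover fun x => ?_
  obtain ⟨U, hU, W, hxW, ha, hb, H⟩ := H x
  refine ⟨W, hxW, ?_⟩
  rw [ι_comp_eq (hU.preimage f) a ha, ι_comp_eq (hU.preimage f) b hb]
  congr 3
  ext s
  exact H s

/-- To give a morphism over `X` to a scheme affine over `X` is to give a compatible family of
homomorphisms on the sections over the affine opens of `X`. -/
theorem exists_hom_of_affine {X Y T : Scheme.{u}} (f : Y ⟶ X) [IsAffineHom f] (t : T ⟶ X)
    (φ : ∀ U : X.Opens, IsAffineOpen U → (Γ(Y, f ⁻¹ᵁ U) →+* Γ(T, t ⁻¹ᵁ U)))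
    (hφ : ∀ U hU a, φ U hU (secPull f le_rfl a) = secPull t le_rfl a)
    (nat : ∀ U V hU hV (h : V ≤ U) (r : Γ(X, U)), V = X.basicOpen r → ∀ a,
      secRes (t.preimage_mono h) (φ U hU a) = φ V hV (secRes (f.preimage_mono h) a)) :
    ∃ h : T ⟶ Y, ∃ e : h ≫ f = t, ∀ U (hU : IsAffineOpen U) a,
      secPull h (V := t ⁻¹ᵁ U) (by rw [← e]; rfl) a = φ U hU a := by
  have key (U V : X.Opens) (hU hV) (h : V ≤ U) (r : Γ(X, U)) (hr : V = X.basicOpen r) :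
      T.homOfLE (t.preimage_mono h) ≫ (t ⁻¹ᵁ U).toSpecΓ ≫ Spec.map (CommRingCat.ofHom (φ U hU)) ≫
        (hU.preimage f).fromSpec = (t ⁻¹ᵁ V).toSpecΓ ≫
        Spec.map (CommRingCat.ofHom (φ V hV)) ≫ (hV.preimage f).fromSpec := by
    rw [← (hU.preimage f).map_fromSpec (hV.preimage f) (homOfLE (f.preimage_mono h)).op,
      ← Spec.map_comp_assoc, ← Scheme.Opens.toSpecΓ_SpecMap_presheaf_map_assoc,
      ← Spec.map_comp_assoc]
    congr 3
    ext a
    exact nat U V hU hV h r hr a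
  have cov (x : X) : ∃ U : X.affineOpens, x ∈ U.1 := by
    obtain ⟨U, hU, hxU, -⟩ := exists_affine_le (V := ⊤) (x := x) trivial
    exact ⟨⟨U, hU⟩, hxU⟩
  obtain ⟨h, hh⟩ := hom_glue (fun U : X.affineOpens => t ⁻¹ᵁ U.1) (fun x => cov (t x))
    (fun U => (t ⁻¹ᵁ U.1).toSpecΓ ≫ Spec.map (CommRingCat.ofHom (φ U.1 U.2)) ≫
      (U.2.preimage f).fromSpec) (fun U V x hxU hxV => by
    -- Two affine opens are compared on an open that is basic in both, which is why `nat` is only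
    -- required for basic opens.
    obtain ⟨r, r', e, hr⟩ := exists_basicOpen_le_affine_inter U.2 V.2 (t x) ⟨hxU, hxV⟩
    refine ⟨t ⁻¹ᵁ X.basicOpen r, hr, t.preimage_mono (X.basicOpen_le r),
      t.preimage_mono (e.trans_le (X.basicOpen_le r')), ?_⟩
    rw [key U.1 _ U.2 (U.2.basicOpen r) (X.basicOpen_le r) r rfl,
      key V.1 _ V.2 (U.2.basicOpen r) (e.trans_le (X.basicOpen_le r')) r' e])
  have e : h ≫ f = t := by
    refine hom_ext_of_cover fun x => ?_
    obtain ⟨U, hxU⟩ := cov (t x)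
    refine ⟨t ⁻¹ᵁ U.1, hxU, ?_⟩
    rw [reassoc_of% hh U, ι_comp_eq U.2 t le_rfl,
      ← IsAffineOpen.SpecMap_appLE_fromSpec f U.2 (U.2.preimage f) le_rfl, ← Spec.map_comp_assoc]
    congr 3
    ext a
    exact hφ U.1 U.2 a
  refine ⟨h, e, fun U hU a => ?_⟩
  have h1 := hh ⟨U, hU⟩
  rw [ι_comp_eq (hU.preimage f) h (V := t ⁻¹ᵁ U) (by rw [← e]; rfl), ← Category.assoc,
    ← Category.assoc, cancel_mono] at h1
  exact congrArg (fun k => k.hom a) (toSpecΓ_SpecMap_inj _ h1)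

end AffineMorphisms

/-! ### Relative spectrum of a quasi-coherent subalgebra -/

section RelativeSpec

open Scheme.AffineZariskiSite

variable {X Y : Scheme.{u}} (q : Y ⟶ X) 

/-- The presheaf of rings on the affine opens of `X` given by subrings of `q_* 𝒪_Y`. -/
def subringDiagram (B : ∀ U : X.Opens, Subring Γ(Y, q ⁻¹ᵁ U))
    (hres : ∀ U V (h : V ≤ U), ∀ b ∈ B U, secRes (q.preimage_mono h) b ∈ B V) :
    X.AffineZariskiSiteᵒᵖ ⥤ CommRingCat.{u} where
  obj U := .of (B U.unop.1)
  map {U V} i := CommRingCat.ofHom ((secRes (q.preimage_mono (toOpens_mono i.unop.le))).restrict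
    (B U.unop.1) (B V.unop.1) (hres _ _ (toOpens_mono i.unop.le)))
  map_id U := by
    refine CommRingCat.hom_ext (RingHom.ext fun (b : B U.unop.1) => ?_)
    exact @Subtype.ext _ (· ∈ B U.unop.1) _ b (secRes_self le_rfl b.1)
  map_comp i j := by
    refine CommRingCat.hom_ext (RingHom.ext fun b => ?_)
    exact @Subtype.ext _ (· ∈ B _) _ _ (secRes_secRes (q.preimage_mono (toOpens_mono i.unop.le))
      (q.preimage_mono (toOpens_mono j.unop.le)) _).symm

/-- The structure map from `𝒪_X` to a presheaf of subrings of `q_* 𝒪_Y`. -/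
def subringDiagramMap (B : ∀ U : X.Opens, Subring Γ(Y, q ⁻¹ᵁ U))
    (h0 : ∀ U a, secPull q le_rfl a ∈ B U)
    (hres : ∀ U V (h : V ≤ U), ∀ b ∈ B U, secRes (q.preimage_mono h) b ∈ B V) :
    (toOpensFunctor X).op ⋙ X.presheaf ⟶ subringDiagram q B hres where
  app U := CommRingCat.ofHom ((secPull q le_rfl).codRestrict (B U.unop.1) (h0 _))
  naturality U V i := by
    ext a
    exact Subtype.ext (((secPull_secRes q le_rfl (toOpens_mono i.unop.le) a)).trans
      (secRes_secPull q le_rfl (q.preimage_mono (toOpens_mono i.unop.le)) a).symm)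

/-- This is quasi-coherence: over a basic open the subring is the localization at `r`. Fractions
come from `hloc`. Over a quasi-compact open, a section that vanishes where `r` is invertible is
killed by a power of `r`, which settles equality of fractions. -/
lemma coequifibered_subringDiagramMap [QuasiCompact q] [QuasiSeparated q]
    (B : ∀ U : X.Opens, Subring Γ(Y, q ⁻¹ᵁ U))
    (h0 : ∀ U a, secPull q le_rfl a ∈ B U)
    (hres : ∀ U V (h : V ≤ U), ∀ b ∈ B U, secRes (q.preimage_mono h) b ∈ B V)
    (hloc : ∀ U, IsAffineOpen U → ∀ r : Γ(X, U), ∀ b ∈ B (X.basicOpen r), ∃ n : ℕ, ∃ b' ∈ B U,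
      secRes (q.preimage_mono (X.basicOpen_le r)) b' =
        secPull q (q.preimage_mono (X.basicOpen_le r)) r ^ n * b) :
    (subringDiagramMap q B h0 hres).Coequifibered := by
  refine coequifibered_iff_forall_isLocalizationAway.mpr fun U r => ?_
  let := ((subringDiagram q B hres).map (homOfLE (U.basicOpen_le r)).op).hom.toAlgebra
  have hr : IsUnit (secRes (X.basicOpen_le r) r) := RingedSpace.isUnit_res_basicOpen _ r
  let α (V : X.AffineZariskiSite) : Γ(X, V.1) →+* B V.1 :=
    (secPull q le_rfl).codRestrict (B V.1) (h0 _)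
  let ρ : B U.1 →+* B (X.basicOpen r) := (secRes (q.preimage_mono (X.basicOpen_le r))).restrict
    (B U.1) (B (X.basicOpen r)) (hres _ _ (X.basicOpen_le r))
  have hα : ρ (α U r) = α (U.basicOpen r) (secRes (X.basicOpen_le r) r) :=
    Subtype.ext ((secRes_secPull q le_rfl (q.preimage_mono (X.basicOpen_le r)) r).trans
      (secPull_secRes q le_rfl (X.basicOpen_le r) r).symm)
  refine ⟨⟨?_, ?_, ?_⟩⟩
  · rintro ⟨_, n, rfl⟩
    change IsUnit (ρ (α U r ^ n))
    rw [map_pow, hα]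
    exact (hr.map _).pow n
  · rintro ⟨(b : Γ(Y, q ⁻¹ᵁ X.basicOpen r)), hb⟩
    obtain ⟨n, b', hb', e⟩ := hloc U.1 U.2 r b hb
    refine ⟨⟨⟨b', hb'⟩, ⟨_, n, rfl⟩⟩, Subtype.ext ?_⟩
    change b * (ρ (α U r ^ n)).1 = secRes _ b'
    rw [e, mul_comm, map_pow, SubmonoidClass.coe_pow]
    congr 2
    exact secRes_secPull q le_rfl (q.preimage_mono (X.basicOpen_le r)) r
  · rintro ⟨b, hb⟩ ⟨b', hb'⟩ h
    have h' : secRes (q.preimage_mono (X.basicOpen_le r)) b =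
      secRes (q.preimage_mono (X.basicOpen_le r)) b' := congrArg Subtype.val h
    obtain ⟨n, hn⟩ := exists_pow_mul_eq_zero_of_res_basicOpen_eq_zero_of_isCompact Y
      (q.isCompact_preimage U.2.isCompact) (b - b') (secPull q le_rfl r) (by
        have e : Y.basicOpen (secPull q le_rfl r) ≤ q ⁻¹ᵁ (X.basicOpen r) := by
          rw [Scheme.Hom.preimage_basicOpen, Scheme.Hom.app_eq_appLE]; rfl
        have := congrArg (secRes e) (sub_eq_zero.mpr h')
        rw [← map_sub, secRes_secRes, map_zero] at this
        exact this)
    refine ⟨⟨_, n, rfl⟩, Subtype.ext ?_⟩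
    rw [mul_sub] at hn
    exact sub_eq_zero.mp hn

lemma ΓSpecIso_hom_secPull {R S : CommRingCat.{u}} (φ : R ⟶ S) (h : ⊤ ≤ Spec.map φ ⁻¹ᵁ ⊤)
    (x : Γ(Spec R, ⊤)) : (Scheme.ΓSpecIso S).hom (secPull (Spec.map φ) h x) =
      φ ((Scheme.ΓSpecIso R).hom x) := by
  change ((Spec.map φ).appLE ⊤ ⊤ h ≫ (Scheme.ΓSpecIso S).hom) x = ((Scheme.ΓSpecIso R).hom ≫ φ) x
  rw [← Scheme.ΓSpecIso_naturality, Scheme.Hom.appTop, Scheme.Hom.app_eq_appLE]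
  rfl

lemma secPull_fromSpec {X : Scheme.{u}} {U : X.Opens} (hU : IsAffineOpen U)
    (h : ⊤ ≤ hU.fromSpec ⁻¹ᵁ U) (a : Γ(X, U)) :
    secPull hU.fromSpec h a = (Scheme.ΓSpecIso Γ(X, U)).inv a := by
  change hU.fromSpec.appLE U ⊤ h a = _
  rw [Scheme.Hom.appLE, hU.fromSpec_app_self, Category.assoc, ← Functor.map_comp,
    Subsingleton.elim (_ ≫ _) (𝟙 _), CategoryTheory.Functor.map_id, Category.comp_id]

lemma bijective_secPull_of_eq_opensRange {Z W : Scheme.{u}} (c : Z ⟶ W) [IsOpenImmersion c]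
    {U : W.Opens} (hU : U = c.opensRange) (h : ⊤ ≤ c ⁻¹ᵁ U) :
    Function.Bijective (secPull c h) := by
  obtain rfl : U = c ''ᵁ ⊤ := hU.trans c.image_top_eq_opensRange.symm
  have := ConcreteCategory.bijective_of_isIso (c.appIso ⊤).hom
  rw [Scheme.Hom.appIso_hom'] at this
  exact this

/-- The gluing datum for the relative spectrum of a quasi-coherent subalgebra of `q_* 𝒪_Y`. -/
lemma exists_glued_subringDiagram [QuasiCompact q] [QuasiSeparated q]
    (B : ∀ U : X.Opens, Subring Γ(Y, q ⁻¹ᵁ U))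
    (h0 : ∀ U a, secPull q le_rfl a ∈ B U)
    (hres : ∀ U V (h : V ≤ U), ∀ b ∈ B U, secRes (q.preimage_mono h) b ∈ B V)
    (hloc : ∀ U, IsAffineOpen U → ∀ r : Γ(X, U), ∀ b ∈ B (X.basicOpen r), ∃ n : ℕ, ∃ b' ∈ B U,
      secRes (q.preimage_mono (X.basicOpen_le r)) b' =
        secPull q (q.preimage_mono (X.basicOpen_le r)) r ^ n * b) :
    ∃ (Z : Scheme.{u}) (f : Z ⟶ X) (c : ∀ U, IsAffineOpen U → (Spec (.of (B U)) ⟶ Z)),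
      (∀ U hU, ∃ _ : IsOpenImmersion (c U hU), f ⁻¹ᵁ U = (c U hU).opensRange) ∧
      (∀ U hU, c U hU ≫ f =
        Spec.map (CommRingCat.ofHom ((secPull q le_rfl).codRestrict (B U) (h0 U))) ≫
          hU.fromSpec) ∧
      ∀ U (hU : IsAffineOpen U) (r : Γ(X, U)) (hV : IsAffineOpen (X.basicOpen r)),
        Spec.map (CommRingCat.ofHom ((secRes (q.preimage_mono (X.basicOpen_le r))).restrict
          (B U) (B (X.basicOpen r)) (hres _ _ (X.basicOpen_le r)))) ≫ c U hU =
        c (X.basicOpen r) hV := by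
  let H := coequifibered_subringDiagramMap q B h0 hres hloc
  let D := relativeGluingData H
  have : (D.functor ⋙ Scheme.forget).IsLocallyDirected :=
    Scheme.Cover.RelativeGluingData.instIsLocallyDirectedI₀CompFunctorForgetOfIsThin ..
  let c (U : X.AffineZariskiSite) : Spec (.of (B U.1)) ⟶ D.glued := D.cover.f U
  have hc (U : X.AffineZariskiSite) : ∃ _ : IsOpenImmersion (c U),
      D.toBase ⁻¹ᵁ U.1 = (c U).opensRange :=
    ⟨D.cover.map_prop U, by simpa using! D.toBase_preimage_eq_opensRange_ι U⟩
  have hcf (U) : c U ≫ D.toBase =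
      Spec.map ((subringDiagramMap q B h0 hres).app (op U)) ≫ U.2.fromSpec :=
    colimit.ι_desc _ _
  have hcw (U V : X.AffineZariskiSite) (h : V ⟶ U) :
      Spec.map ((subringDiagram q B hres).map h.op) ≫ c U = c V :=
    colimit.w D.functor h
  exact ⟨D.glued, D.toBase, fun U hU => c ⟨U, hU⟩, fun U hU => hc ⟨U, hU⟩,
    fun U hU => hcf ⟨U, hU⟩, fun U hU r hV => hcw ⟨U, hU⟩ ⟨X.basicOpen r, hV⟩
      (homOfLE (Scheme.AffineZariskiSite.basicOpen_le ⟨U, hU⟩ r))⟩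

/-- The relative spectrum of a quasi-coherent subalgebra of `q_* 𝒪_Y`. -/
theorem exists_relativeSpec [QuasiCompact q] [QuasiSeparated q]
    (B : ∀ U : X.Opens, Subring Γ(Y, q ⁻¹ᵁ U))
    (h0 : ∀ U a, secPull q le_rfl a ∈ B U)
    (hres : ∀ U V (h : V ≤ U), ∀ b ∈ B U, secRes (q.preimage_mono h) b ∈ B V)
    (hloc : ∀ U, IsAffineOpen U → ∀ r : Γ(X, U), ∀ b ∈ B (X.basicOpen r), ∃ n : ℕ, ∃ b' ∈ B U,
      secRes (q.preimage_mono (X.basicOpen_le r)) b' =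
        secPull q (q.preimage_mono (X.basicOpen_le r)) r ^ n * b) :
    ∃ (Z : Scheme.{u}) (f : Z ⟶ X) (i : Y ⟶ Z) (e : i ≫ f = q), IsAffineHom f ∧
      ∀ U, IsAffineOpen U →
        Function.Injective (secPull i (U := f ⁻¹ᵁ U) (V := q ⁻¹ᵁ U) (by rw [← e]; rfl)) ∧
        ∀ b, b ∈ B U ↔ ∃ a, secPull i (U := f ⁻¹ᵁ U) (V := q ⁻¹ᵁ U) (by rw [← e]; rfl) a = b := by
  obtain ⟨Z, f, c, hc, hcf, hcw⟩ := exists_glued_subringDiagram q B h0 hres hloc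
  choose hcop hran using hc
  have hran' (U hU) : ⊤ ≤ c U hU ⁻¹ᵁ f ⁻¹ᵁ U := by
    rw [hran U hU]; intro x _; exact ⟨x, rfl⟩
  have hf : IsAffineHom f := ⟨fun U hU => by
    rw [hran U hU]
    exact isAffineOpen_opensRange (c U hU)⟩
  -- The sections of `Z` over `f⁻¹ U` are `B U`; followed by the inclusion into the sections of `Y`,
  -- this is the comorphism that defines `i`.
  let ψ (U : X.Opens) (hU : IsAffineOpen U) : Γ(Z, f ⁻¹ᵁ U) →+* B U :=
    (Scheme.ΓSpecIso (.of (B U))).hom.hom.comp (secPull (c U hU) (hran' U hU))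
  have hψ (U hU) : Function.Bijective (ψ U hU) :=
    (ConcreteCategory.bijective_of_isIso (Scheme.ΓSpecIso (.of (B U))).hom).comp
      (bijective_secPull_of_eq_opensRange (c U hU) (hran U hU) _)
  have hψf (U hU a) : ((ψ U hU (secPull f le_rfl a) : B U) : Γ(Y, q ⁻¹ᵁ U)) =
      secPull q le_rfl a := by
    change (((Scheme.ΓSpecIso (.of (B U))).hom (secPull (c U hU) _ (secPull f _ a)) : B U) :
      Γ(Y, q ⁻¹ᵁ U)) = _
    rw [secPull_secPull, secPull_congr (hcf U hU), ← secPull_secPull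
      (h := hU.fromSpec_preimage_self.ge) (h' := le_preimage_top _ _),
      ΓSpecIso_hom_secPull, secPull_fromSpec]
    have : (Scheme.ΓSpecIso Γ(X, U)).hom ((Scheme.ΓSpecIso Γ(X, U)).inv a) = a := by
      rw [← CommRingCat.comp_apply, Iso.inv_hom_id]; rfl
    exact congrArg (secPull q le_rfl) this
  have hψnat (U V hU hV) (h : V ≤ U) (r : Γ(X, U)) (hr : V = X.basicOpen r) (a) :
      secRes (q.preimage_mono h) (ψ U hU a : B U).1 =
        (ψ V hV (secRes (f.preimage_mono h) a) : B V).1 := by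
    subst hr
    change _ = (((Scheme.ΓSpecIso (.of (B (X.basicOpen r)))).hom
      (secPull (c _ hV) _ (secRes _ a)) : B _) : Γ(Y, q ⁻¹ᵁ X.basicOpen r))
    rw [secPull_secRes, secPull_congr (hcw U hU r hV).symm, ← secPull_secPull
      (h := hran' U hU) (h' := le_preimage_top _ _), ΓSpecIso_hom_secPull]
    rfl
  obtain ⟨i, e, hi⟩ := exists_hom_of_affine f q (fun U hU => (B U).subtype.comp (ψ U hU))
    hψf hψnat
  refine ⟨Z, f, i, e, hf, fun U hU => ⟨?_, fun b => ?_⟩⟩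
  · intro a a' h
    rw [hi U hU, hi U hU] at h
    exact (hψ U hU).1 (Subtype.val_injective h)
  · constructor
    · intro hb
      obtain ⟨a, ha⟩ := (hψ U hU).2 ⟨b, hb⟩
      exact ⟨a, (hi U hU a).trans (congrArg Subtype.val ha)⟩
    · rintro ⟨a, rfl⟩
      rw [hi U hU]
      exact (ψ U hU a).2

end RelativeSpec

open scoped MonObj

/-! ### Actions on generalized points -/

section GeneralizedPoints

variable {C : Type*} [Category C] [CartesianMonoidalCategory C] {M Y : C} [MonObj M] [ModObj M Y]

variable (M Y) in
/-- The action morphism. -/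
abbrev smulHom : M ⊗ Y ⟶ Y := ModObj.smul (M := M) (X := Y)

lemma lift_mul_smul {T : C} (a b : T ⟶ M) (y : T ⟶ Y) :
    lift (a * b) y ≫ smulHom M Y = lift a (lift b y ≫ smulHom M Y) ≫ smulHom M Y := by
  have h : (MonObj.mul (X := M)) ▷ Y ≫ smulHom M Y =
    (α_ M M Y).hom ≫ M ◁ smulHom M Y ≫ smulHom M Y := ModObj.mul_smul (M := M) Y
  rw [Hom.mul_def, ← lift_whiskerRight, Category.assoc, h, lift_lift_associator_hom_assoc,
    lift_whiskerLeft_assoc]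

lemma lift_one_smul {T : C} (y : T ⟶ Y) :
    lift (1 : T ⟶ M) y ≫ smulHom M Y = y := by
  have h : (MonObj.one (X := M)) ▷ Y ≫ smulHom M Y = (λ_ Y).hom := ModObj.one_smul (M := M) Y
  rw [Hom.one_def, ← lift_whiskerRight, Category.assoc, h, lift_leftUnitor_hom]

end GeneralizedPoints

section OpenImmersions

lemma bijective_secPull_preimage {X Y : Scheme.{u}} (i : X ⟶ Y) [IsOpenImmersion i] {V : Y.Opens}
    (hV : V ≤ i.opensRange) : Function.Bijective (secPull i (U := V) (V := i ⁻¹ᵁ V) le_rfl) := by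
  have := i.isIso_app V hV
  rw [Scheme.Hom.app_eq_appLE] at this
  exact ConcreteCategory.bijective_of_isIso (i.appLE V (i ⁻¹ᵁ V) le_rfl)

lemma sec_ext_of_openImmersions {I : Type*} {X : I → Scheme.{u}} {Y : Scheme.{u}}
    (i : ∀ k, X k ⟶ Y) [∀ k, IsOpenImmersion (i k)] {V : Y.Opens}
    (hV : ∀ y ∈ V, ∃ k x, i k x = y) {s t : Γ(Y, V)}
    (H : ∀ k, secPull (i k) (V := i k ⁻¹ᵁ V) le_rfl s = secPull (i k) le_rfl t) : s = t := by
  refine sec_ext fun y hy => ?_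
  obtain ⟨k, x, rfl⟩ := hV y hy
  refine ⟨V ⊓ (i k).opensRange, ⟨hy, x, rfl⟩, inf_le_left, ?_⟩
  apply (bijective_secPull_preimage (i k) (V := V ⊓ (i k).opensRange) inf_le_right).1
  rw [secPull_secRes, secPull_secRes]
  have := congrArg (secRes ((i k).preimage_mono (inf_le_left : V ⊓ (i k).opensRange ≤ V))) (H k)
  simpa using this

end OpenImmersions

/-! ### The constant group scheme as a disjoint union of points -/

section ConstantGroup

variable (G K : Type u) [CommGroup G] [Fintype G] [Field K]

/-- The base as a scheme over itself. -/
abbrev basePt : Over (Spec (.of K)) := (Spec (.of K)).asOver (Spec (.of K))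

variable {K} in
/-- The structure morphism. -/
def toBase (Y : Over (Spec (.of K))) : Y ⟶ basePt K :=
  Over.homMk Y.hom (by
    change Y.hom ≫ Spec.map (CommRingCat.ofHom (algebraMap K K)) = Y.hom
    exact (congrArg (Y.hom ≫ ·) (Spec.map_id _)).trans (Category.comp_id _))

variable {G} in
/-- The point of the constant group scheme given by a group element. -/
def constPt (g : G) : basePt K ⟶ constGrp G K :=
  Spec.mapMulEquiv (WithConv.toConv (FunAlg.eval G K g))

variable {G}

/-- Points multiply by convolution of evaluations, and the comultiplication is dual to the
multiplication of `G`. -/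
lemma constPt_mul (g h : G) : constPt K (g * h) = constPt K g * constPt K h := by
  rw [constPt, constPt, constPt, ← map_mul]
  congr 1
  apply WithConv.ofConv_injective
  rw [AlgHom.convMul_def]
  ext f
  change FunAlg.eval G K (g * h) f = Algebra.TensorProduct.lmul' K (Algebra.TensorProduct.map
    (FunAlg.eval G K g) (FunAlg.eval G K h) (FunAlg.comulLin G K f))
  classical
  rw [FunAlg.comulLin_apply]
  simp [FunAlg.eval_delta]

/-- An idempotent element of a group is trivial. -/
lemma constPt_one : constPt (G := G) K 1 = 1 := by
  have := constPt_mul K (1 : G) 1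
  rw [mul_one] at this
  exact (mul_eq_left.mp this.symm)

instance (g : G) : IsOpenImmersion (constPt K g).left :=
  AlgebraicGeometry.instIsOpenImmersionMapOfHomForallEvalRingHom.{u, u} g (fun _ : G => K)

/-- The spectrum of a finite product of rings is the disjoint union of their spectra. -/
lemma exists_constPt (z : (constGrp G K).left) : ∃ g : G, ∃ x, (constPt K g).left x = z := by
  let R : G → CommRingCat.{u} := fun _ => .of K
  obtain ⟨w, rfl⟩ := (sigmaSpec R).surjective z
  obtain ⟨g, x, rfl⟩ := (sigmaOpenCover (fun i ↦ Spec (R i))).exists_eq w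
  refine ⟨g, x, ?_⟩
  have := congrArg (fun k => k x) (ι_sigmaSpec R g)
  exact this.symm

variable (Y : Over (Spec (.of K)))

/-- The inclusion of `Y` into `G × Y` at the group element `g`. -/
def shift (g : G) : Y ⟶ constGrp G K ⊗ Y := lift (toBase Y ≫ constPt K g) (𝟙 Y)

lemma shift_fst (g : G) : shift K Y g ≫ fst _ _ = toBase Y ≫ constPt K g := lift_fst _ _
lemma shift_snd (g : G) : shift K Y g ≫ snd _ _ = 𝟙 Y := lift_snd _ _

end ConstantGroup

/-! ### Translations by group elements -/

section Translations

variable {G K : Type u} [CommGroup G] [Fintype G] [Field K]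

/-- The slice at `g` is the base change of the point `g`. Pasting with the product square gives an
outer rectangle whose horizontal sides are isomorphisms. -/
lemma isPullback_shift (Y : Over (Spec (.of K))) (g : G) :
    IsPullback (shift K Y g).left (toBase Y).left (fst (constGrp G K) Y).left
      (constPt K g).left := by
  have hr : IsPullback (snd (constGrp G K) Y).left (fst (constGrp G K) Y).left Y.hom
      (constGrp G K).hom := (IsPullback.of_hasPullback (constGrp G K).hom Y.hom).flip
  refine IsPullback.of_right ?_ ?_ hr
  · have h1 : (shift K Y g).left ≫ (snd (constGrp G K) Y).left = 𝟙 _ :=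
      congrArg (fun k => k.left) (shift_snd K Y g)
    have h2 : (constPt K g).left ≫ (constGrp G K).hom = (basePt K).hom := Over.w (constPt K g)
    have h3 : IsIso (basePt K).hom := by
      rw [show (basePt K).hom = 𝟙 _ from Spec.map_id _]
      exact IsIso.id _
    rw [h1, h2]
    exact IsPullback.of_horiz_isIso ⟨(Category.id_comp _).trans (Over.w (toBase Y)).symm⟩
  · exact congrArg (fun k => k.left) (shift_fst K Y g)

instance (Y : Over (Spec (.of K))) (g : G) : IsOpenImmersion (shift K Y g).left :=
  MorphismProperty.of_isPullback (P := @IsOpenImmersion) (isPullback_shift Y g).flip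
    (inferInstanceAs (IsOpenImmersion (constPt K g).left))

lemma exists_shift {Y : Over (Spec (.of K))} (z : (constGrp G K ⊗ Y).left) :
    ∃ g : G, ∃ y, (shift K Y g).left y = z := by
  obtain ⟨g, x, hx⟩ := exists_constPt K ((fst (constGrp G K) Y).left z)
  obtain ⟨y, hy, -⟩ := Scheme.exists_preimage_of_isPullback (isPullback_shift Y g) z x hx.symm
  exact ⟨g, y, hy⟩

/-- The slices cover `G × Y`, so identities of functions there can be checked one group element at a
time. -/
lemma sec_ext_of_shift {Y : Over (Spec (.of K))} {W : (constGrp G K ⊗ Y).left.Opens}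
    {s t : Γ((constGrp G K ⊗ Y).left, W)}
    (H : ∀ g : G, secPull (shift K Y g).left (V := (shift K Y g).left ⁻¹ᵁ W) le_rfl s =
      secPull (shift K Y g).left le_rfl t) : s = t :=
  sec_ext_of_openImmersions (fun g => (shift K Y g).left) (fun z _ => exists_shift z) H

variable (Y : Over (Spec (.of K))) [ModObj (constGrp G K) Y]

/-- The automorphism of `Y` given by a group element. -/
def trans (g : G) : Y ⟶ Y := shift K Y g ≫ smulHom (constGrp G K) Y

lemma trans_one : trans (K := K) Y (1 : G) = 𝟙 Y := by
  have : toBase Y ≫ constPt K (1 : G) = 1 := by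
    rw [constPt_one, Hom.one_def, Hom.one_def, ← Category.assoc,
      toUnit_unique (toBase Y ≫ toUnit (basePt K)) (toUnit Y)]
  rw [trans, shift, this, lift_one_smul]

lemma trans_mul (g h : G) : trans (K := K) Y (g * h) = trans Y h ≫ trans Y g := by
  have e : toBase Y ≫ constPt K (g * h) = (toBase Y ≫ constPt K g) * (toBase Y ≫ constPt K h) := by
    rw [constPt_mul, Hom.mul_def, Hom.mul_def, ← Category.assoc, comp_lift]
  have hb : trans Y h ≫ toBase Y = toBase Y := by
    ext1
    exact Over.w (trans Y h)
  rw [trans, shift, e, lift_mul_smul]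
  change lift (toBase Y ≫ constPt K g) (trans Y h) ≫ _ = _
  have e2 : trans Y h ≫ shift K Y g = lift (toBase Y ≫ constPt K g) (trans Y h) := by
    rw [shift, comp_lift, Category.comp_id, ← Category.assoc, hb]
  rw [← e2, Category.assoc]
  rfl

end Translations

/-! ### Torsors under a finite constant group are finite -/

section TorsorFinite

/-- Flat morphisms locally of finite presentation are open, so for a property local on the target
the covers may be refined to quasi-compact ones. -/
lemma descendsAlong_fppf (P : MorphismProperty Scheme.{u})
    [P.DescendsAlong (@Surjective ⊓ @Flat ⊓ @QuasiCompact)] [IsZariskiLocalAtTarget P] :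
    P.DescendsAlong (@Surjective ⊓ @Flat ⊓ @LocallyOfFinitePresentation) :=
  inferInstance

variable {G K : Type u} [CommGroup G] [Fintype G] [Field K]

instance : IsFinite (constGrp G K).hom := by
  change IsFinite (Spec.map (CommRingCat.ofHom (algebraMap K (FunAlg G K))))
  rw [IsFinite.SpecMap_iff]
  exact RingHom.finite_algebraMap.mpr (inferInstanceAs (Module.Finite K (G → K)))

instance (Y : Over (Spec (.of K))) : IsFinite (snd (constGrp G K) Y).left :=
  MorphismProperty.of_isPullback (P := @IsFinite)
    (IsPullback.of_hasPullback (constGrp G K).hom Y.hom)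
    (inferInstanceAs (IsFinite (constGrp G K).hom))

variable {X Y : Over (Spec (.of K))} [ModObj (constGrp G K) Y] {f : Y ⟶ X}
  (hf : IsTorsor (constGrp G K) f)

include hf

lemma IsTorsor.isPullback_left : IsPullback (smulHom (constGrp G K) Y).left
    (snd (constGrp G K) Y).left f.left f.left :=
  hf.isPullback.map (Over.forget _)

lemma IsTorsor.trans_comp (g : G) : trans Y g ≫ f = f := by
  rw [trans, Category.assoc, hf.isPullback.w, ← Category.assoc, shift_snd, Category.id_comp]

/-- Under `Y ×_X Y ≅ G × Y` the diagonal becomes the slice at 1, a section of the finite projection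
`G × Y ⟶ Y` and thus a closed immersion. -/
lemma IsTorsor.isSeparated : IsSeparated f.left := by
  refine ⟨?_⟩
  have h1 : IsClosedImmersion (shift K Y (1 : G)).left := by
    have : IsClosedImmersion ((shift K Y (1 : G)).left ≫ (snd (constGrp G K) Y).left) := by
      rw [show (shift K Y (1 : G)).left ≫ (snd (constGrp G K) Y).left = 𝟙 _ from
        congrArg (fun k => k.left) (shift_snd K Y (1 : G))]
      exact inferInstanceAs (IsClosedImmersion (𝟙 Y.left))
    exact IsClosedImmersion.of_comp _ (snd (constGrp G K) Y).left
  have h2 : pullback.diagonal f.left =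
      (shift K Y (1 : G)).left ≫ hf.isPullback_left.isoPullback.hom := by
    apply pullback.hom_ext
    · rw [Category.assoc, IsPullback.isoPullback_hom_fst, pullback.diagonal_fst]
      exact (congrArg (fun k => k.left) (trans_one (G := G) Y)).symm
    · rw [Category.assoc, IsPullback.isoPullback_hom_snd, pullback.diagonal_snd]
      exact (congrArg (fun k => k.left) (shift_snd K Y (1 : G))).symm
  rw [h2]
  infer_instance

/-- A torsor under a finite constant group is finite. -/
lemma IsTorsor.isFinite : IsFinite f.left := by
  have := hf.isSeparated
  have := hf.flat
  have := hf.surjective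
  have := hf.locallyOfFinitePresentation
  have : MorphismProperty.DescendsAlong @UniversallyClosed
      (@Surjective ⊓ @Flat ⊓ @LocallyOfFinitePresentation) := by
    have := descendsAlong_universallyClosed_surjective_inf_flat_inf_quasicompact
    exact descendsAlong_fppf @UniversallyClosed
  -- The base change of `f` along itself is the projection `G × Y ⟶ Y`, which is finite; the
  -- property descends along `f`.
  have : UniversallyClosed f.left :=
    MorphismProperty.of_isPullback_of_descendsAlong (P := @UniversallyClosed)
      (Q := @Surjective ⊓ @Flat ⊓ @LocallyOfFinitePresentation) hf.isPullback_left.flip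
      ⟨⟨inferInstance, inferInstance⟩, inferInstance⟩
      (inferInstanceAs (UniversallyClosed (snd (constGrp G K) Y).left))
  -- The fibre through `y` is the orbit of `y`, the image of a finite fibre of the projection.
  have : LocallyQuasiFinite f.left := by
    refine LocallyQuasiFinite.of_finite_preimage_singleton _ fun x => ?_
    obtain ⟨y, rfl⟩ := f.left.surjective x
    refine Set.Finite.subset (((snd (constGrp G K) Y).left.finite_preimage_singleton y).image
      (smulHom (constGrp G K) Y).left) fun y' hy' => ?_
    obtain ⟨z, h1, h2⟩ := Scheme.exists_preimage_of_isPullback hf.isPullback_left y' y hy'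
    exact ⟨z, h2, h1⟩
  have : IsProper f.left := {}
  exact IsFinite.of_isProper_of_locallyQuasiFinite f.left

end TorsorFinite

/-! ### Weights of functions on a scheme with an action of `G` -/

section SectionWeights

lemma secPull_comp {X Y Z : Scheme.{u}} {f : X ⟶ Y} {g : Y ⟶ Z} {k : X ⟶ Z} (e : f ≫ g = k)
    {U : Z.Opens} {V : Y.Opens} {W : X.Opens} (h : V ≤ g ⁻¹ᵁ U) (h' : W ≤ f ⁻¹ᵁ V)
    (h'' : W ≤ k ⁻¹ᵁ U) (a : Γ(Z, U)) : secPull f h' (secPull g h a) = secPull k h'' a := by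
  subst e
  exact secPull_secPull f g h h' a

lemma secPull_eq_secRes {X : Scheme.{u}} {f : X ⟶ X} (e : f = 𝟙 X) {U V : X.Opens}
    (h : V ≤ f ⁻¹ᵁ U) (h' : V ≤ U) (a : Γ(X, U)) : secPull f h a = secRes h' a := by
  subst e
  exact secPull_id _ a

lemma secPull_evalSec_comp {T T' : Scheme.{u}} {A : Type u} [CommRing A] {f : T' ⟶ T}
    {h : T ⟶ Spec (.of A)} {k : T' ⟶ Spec (.of A)} (e : f ≫ h = k) {V : T.Opens} {W : T'.Opens}
    (hW : W ≤ f ⁻¹ᵁ V) (a : A) : secPull f hW (evalSec h V a) = evalSec k W a := by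
  subst e
  exact secPull_evalSec f h hW a

/-- Transport of characters along a ring homomorphism to a ring on which `G` acts. -/
def CharAction.lift {G D K C : Type*} [Group G] [Fintype G] [CommGroup D] [Fintype D]
    [CommRing K] [CommRing C] (E : CharAction G D K) (φ : K →+* C) (act : G →* (C →+* C))
    (h : ∀ g k, act g (φ k) = φ k) : CharAction G D C where
  act := act
  ev := ((φ : K →* C).compHom (M := G)).comp E.ev
  act_ev g χ h' := h g _
  inv := φ E.inv
  inv_mul_card := by rw [← map_natCast φ, ← map_mul, E.inv_mul_card, map_one]
  sum_ev g hg := (map_sum φ _ _).symm.trans ((congrArg φ (E.sum_ev g hg)).trans (map_zero φ))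
  sum_ev' χ hχ := (map_sum φ _ _).symm.trans ((congrArg φ (E.sum_ev' χ hχ)).trans (map_zero φ))
  card_eq := E.card_eq

variable {G D K : Type u} [CommGroup G] [Fintype G] [CommGroup D] [Fintype D] [Field K]
  (E : CharAction G D K)

/-- A character as an element of the algebra of functions. -/
def charFun (χ : D) : FunAlg G K := fun g => E.ev χ g

lemma eval_charFun (χ : D) (g : G) : FunAlg.eval G K g (charFun E χ) = E.ev χ g := rfl

variable {Y : Over (Spec (.of K))} [ModObj (constGrp G K) Y] {Z : Scheme.{u}} {q : Y.left ⟶ Z}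
  (hq : ∀ g : G, (trans Y g).left ≫ q = q)

include hq in
lemma preimage_le_trans (g : G) (U : Z.Opens) : q ⁻¹ᵁ U ≤ (trans Y g).left ⁻¹ᵁ q ⁻¹ᵁ U := by
  rw [← Scheme.Hom.comp_preimage, hq g]

/-- The action of `G` on the sections of `Y` over an open subset of the quotient. -/
def secAct (U : Z.Opens) : G →* (Γ(Y.left, q ⁻¹ᵁ U) →+* Γ(Y.left, q ⁻¹ᵁ U)) where
  toFun g := secPull (trans Y g).left (preimage_le_trans hq g U)
  map_one' := RingHom.ext fun c =>
    (secPull_eq_secRes (congrArg (fun k => k.left) (trans_one (G := G) Y)) _ le_rfl c).trans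
      (secRes_self _ c)
  -- Pullback reverses the order of composition; commutativity of `G` restores it.
  map_mul' g h := RingHom.ext fun c =>
    (secPull_comp (congrArg (fun k => k.left) ((trans_mul Y h g).symm.trans
      (congrArg (trans Y) (mul_comm h g)))) (preimage_le_trans hq h U) (preimage_le_trans hq g U)
      (preimage_le_trans hq (g * h) U) c).symm

lemma secAct_apply (U : Z.Opens) (g : G) (c : Γ(Y.left, q ⁻¹ᵁ U)) :
    secAct hq U g c = secPull (trans Y g).left (preimage_le_trans hq g U) c := rfl

lemma evalSec_trans (U : Z.Opens) (g : G) (k : K) :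
    secAct hq U g (evalSec Y.hom _ k) = evalSec Y.hom _ k := by
  exact secPull_evalSec_comp (Over.w (trans Y g)) _ k

/-- The action of `G` on the sections of `Y` over an open subset of the quotient, together with
the characters of `G`. -/
def secChar (U : Z.Opens) : CharAction G D Γ(Y.left, q ⁻¹ᵁ U) :=
  E.lift (evalSec Y.hom _) (secAct hq U) fun g k => evalSec_trans hq U g k

lemma isWt_secChar_iff {U : Z.Opens} {χ : D} {c : Γ(Y.left, q ⁻¹ᵁ U)} :
    (secChar E hq U).IsWt χ c ↔ ∀ g, secPull (trans Y g).left (preimage_le_trans hq g U) c =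
      evalSec Y.hom _ (E.ev χ g) * c := Iff.rfl

lemma isWt_one_secChar_iff {U : Z.Opens} {c : Γ(Y.left, q ⁻¹ᵁ U)} :
    (secChar E hq U).IsWt 1 c ↔
      ∀ g, secPull (trans Y g).left (preimage_le_trans hq g U) c = c :=
  CharAction.isWt_one_iff

variable {E hq}

lemma isWt_secRes {U V : Z.Opens} (h : V ≤ U) {χ : D} {c : Γ(Y.left, q ⁻¹ᵁ U)}
    (hc : (secChar E hq U).IsWt χ c) :
    (secChar E hq V).IsWt χ (secRes (q.preimage_mono h) c) := fun g => by
  have := congrArg (secRes (q.preimage_mono h)) (isWt_secChar_iff E hq |>.mp hc g)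
  rw [secRes_secPull, map_mul, secRes_evalSec] at this
  exact (secPull_secRes _ _ _ c).trans this

lemma isWt_one_secPull {U : Z.Opens} (a : Γ(Z, U)) :
    (secChar E hq U).IsWt 1 (secPull q (V := q ⁻¹ᵁ U) le_rfl a) :=
  (isWt_one_secChar_iff E hq).mpr fun g => by
    rw [secPull_secPull, secPull_congr (hq g)]

lemma evalSec_eq_ev {U : Z.Opens} (χ : D) (g : G) :
    evalSec Y.hom _ (E.ev χ g) = (secChar E hq U).ev χ g := rfl

lemma secPull_shift_smul {U : Z.Opens} {W : (constGrp G K ⊗ Y).left.Opens}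
    (h1 : W ≤ (smulHom (constGrp G K) Y).left ⁻¹ᵁ q ⁻¹ᵁ U) {V : Y.left.Opens} (hV : V ≤ q ⁻¹ᵁ U)
    (g : G) (h : V ≤ (shift K Y g).left ⁻¹ᵁ W) (c : Γ(Y.left, q ⁻¹ᵁ U)) :
    secPull (shift K Y g).left h (secPull (smulHom (constGrp G K) Y).left h1 c) =
      secRes hV (secAct hq U g c) := by
  rw [secPull_secPull, secAct_apply, secRes_secPull]
  rfl

omit [ModObj (constGrp G K) Y] in
lemma secPull_shift_snd {U : Z.Opens} {W : (constGrp G K ⊗ Y).left.Opens}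
    (h2 : W ≤ (snd (constGrp G K) Y).left ⁻¹ᵁ q ⁻¹ᵁ U) {V : Y.left.Opens} (hV : V ≤ q ⁻¹ᵁ U)
    (g : G) (h : V ≤ (shift K Y g).left ⁻¹ᵁ W) (c : Γ(Y.left, q ⁻¹ᵁ U)) :
    secPull (shift K Y g).left h (secPull (snd (constGrp G K) Y).left h2 c) = secRes hV c := by
  exact (secPull_secPull _ _ _ _ c).trans (secPull_eq_secRes
    (congrArg (fun k => k.left) (shift_snd K Y g)) _ hV c)

omit [ModObj (constGrp G K) Y] in
lemma secPull_shift_evalSec {W : (constGrp G K ⊗ Y).left.Opens} {V : Y.left.Opens}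
    (g : G) (h : V ≤ (shift K Y g).left ⁻¹ᵁ W) (φ : FunAlg G K) :
    secPull (shift K Y g).left h (evalSec (fst (constGrp G K) Y).left W φ) =
      evalSec Y.hom V (FunAlg.eval G K g φ) := by
  have : (shift K Y g).left ≫ (fst (constGrp G K) Y).left =
      Y.hom ≫ Spec.map (CommRingCat.ofHom (FunAlg.eval G K g).toRingHom) :=
    congrArg (fun k => k.left) (shift_fst K Y g)
  exact (secPull_evalSec_comp this h φ).trans
    (evalSec_comp_specMap Y.hom (FunAlg.eval G K g).toRingHom V φ)

/-- A section of weight `χ` is multiplied by `χ` under the action morphism. -/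
lemma secPull_smul_of_isWt {U : Z.Opens} {χ : D} {c : Γ(Y.left, q ⁻¹ᵁ U)}
    (hc : (secChar E hq U).IsWt χ c) {W : (constGrp G K ⊗ Y).left.Opens}
    (h1 : W ≤ (smulHom (constGrp G K) Y).left ⁻¹ᵁ q ⁻¹ᵁ U)
    (h2 : W ≤ (snd (constGrp G K) Y).left ⁻¹ᵁ q ⁻¹ᵁ U) :
    secPull (smulHom (constGrp G K) Y).left h1 c =
      evalSec (fst (constGrp G K) Y).left W (charFun E χ) *
        secPull (snd (constGrp G K) Y).left h2 c := by
  -- On the slice at `g` both sides become `χ(g)` times `c`.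
  refine sec_ext_of_shift fun g => ?_
  have hV : (shift K Y g).left ⁻¹ᵁ W ≤ q ⁻¹ᵁ U := by
    refine ((shift K Y g).left.preimage_mono h2).trans ?_
    rw [← Scheme.Hom.comp_preimage, show (shift K Y g).left ≫ (snd (constGrp G K) Y).left = 𝟙 _
      from congrArg (fun k => k.left) (shift_snd K Y g)]
    exact le_rfl
  rw [map_mul, secPull_shift_smul (hq := hq) h1 hV, secPull_shift_snd h2 hV, secPull_shift_evalSec,
    eval_charFun]
  exact (congrArg (secRes hV) (hc g)).trans (by rw [map_mul, ← evalSec_eq_ev, secRes_evalSec])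

end SectionWeights

/-! ### Faithfully flat descent of functions -/

section Descent

/-- The affine line over the integers. -/
abbrev intLine : Scheme.{u} := Spec (.of (FreeCommRing PUnit.{u + 1}))

/-- The coordinate of the affine line. -/
abbrev coord : FreeCommRing PUnit.{u + 1} := FreeCommRing.of PUnit.unit

/-- Functions are regarded as morphisms to the affine line, so that descent of morphisms along an
effective epimorphism gives descent of functions. -/
lemma intLine_hom_ext {T : Scheme.{u}} {h h' : T ⟶ intLine}
    (e : evalSec h ⊤ coord = evalSec h' ⊤ coord) : h = h' := by
  refine evalSec_inj fun a => ?_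
  have : evalSec h ⊤ = evalSec h' ⊤ := FreeCommRing.hom_ext fun _ => e
  rw [this]

lemma exists_intLine_hom {T : Scheme.{u}} (c : Γ(T, ⊤)) :
    ∃ h : T ⟶ intLine, evalSec h ⊤ coord = c := by
  obtain ⟨h, hh⟩ := evalSec_surj (T := T) (FreeCommRing.lift fun _ : PUnit.{u + 1} => c)
  exact ⟨h, by rw [hh]; exact FreeCommRing.lift_of _ _⟩

lemma evalSec_comp_top {T T' : Scheme.{u}} {A : Type u} [CommRing A] (f : T' ⟶ T)
    (h : T ⟶ Spec (.of A)) (a : A) :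
    evalSec (f ≫ h) ⊤ a = secPull f (le_preimage_top f ⊤) (evalSec h ⊤ a) :=
  (secPull_evalSec f h _ a).symm

lemma secPull_restrict {X Y : Scheme.{u}} (f : Y ⟶ X) (U : X.Opens) (r : Γ(X, U)) :
    secPull (f ∣_ U) (le_preimage_top _ ⊤) (secPull U.ι (U := U) (V := ⊤) (by simp) r) =
      secPull (f ⁻¹ᵁ U).ι (by simp) (secPull f (V := f ⁻¹ᵁ U) le_rfl r) :=
  (secPull_comp (k := (f ⁻¹ᵁ U).ι ≫ f) (morphismRestrict_ι f U) _ _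
    (fun x _ => x.2) r).trans (secPull_secPull _ _ _ _ r).symm

lemma effectiveEpi_restrict {X Y : Scheme.{u}} (f : Y ⟶ X) [Flat f] [Surjective f]
    [LocallyOfFinitePresentation f] (U : X.Opens) : EffectiveEpi (f ∣_ U) := by
  have : Flat (f ∣_ U) := MorphismProperty.of_isPullback (P := @Flat)
    (isPullback_morphismRestrict f U).flip ‹_›
  have : Surjective (f ∣_ U) := IsZariskiLocalAtTarget.restrict ‹_› U
  have : LocallyOfFinitePresentation (f ∣_ U) := MorphismProperty.of_isPullback
    (P := @LocallyOfFinitePresentation) (isPullback_morphismRestrict f U).flip ‹_›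
  infer_instance

lemma bijective_secPull_ι {T : Scheme.{u}} (U : T.Opens) :
    Function.Bijective (secPull U.ι (U := U) (V := ⊤) (by simp)) :=
  bijective_secPull_of_eq_opensRange U.ι (by simp) _

variable {X Y : Scheme.{u}} (f : Y ⟶ X) [Flat f] [Surjective f] [LocallyOfFinitePresentation f]

lemma secPull_injective_of_flat (U : X.Opens) :
    Function.Injective (secPull f (U := U) (V := f ⁻¹ᵁ U) le_rfl) := by
  intro s t hst
  obtain ⟨hs, es⟩ := exists_intLine_hom (secPull U.ι (U := U) (V := ⊤) (by simp) s)
  obtain ⟨ht, et⟩ := exists_intLine_hom (secPull U.ι (U := U) (V := ⊤) (by simp) t)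
  have : f ∣_ U ≫ hs = f ∣_ U ≫ ht := by
    apply intLine_hom_ext
    rw [evalSec_comp_top, evalSec_comp_top, es, et, secPull_restrict, secPull_restrict, hst]
  have := effectiveEpi_restrict f U
  obtain rfl := (cancel_epi (f ∣_ U)).mp ‹f ∣_ U ≫ hs = f ∣_ U ≫ ht›
  exact (bijective_secPull_ι U).1 (es.symm.trans et)

/-- Faithfully flat descent for sections. -/
lemma exists_secPull_eq_of_flat {U : X.Opens} (c : Γ(Y, f ⁻¹ᵁ U))
    (H : ∀ (T : Scheme.{u}) (a b : T ⟶ Y), a ≫ f = b ≫ f → ∀ (ha : ⊤ ≤ a ⁻¹ᵁ f ⁻¹ᵁ U)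
      (hb : ⊤ ≤ b ⁻¹ᵁ f ⁻¹ᵁ U), secPull a ha c = secPull b hb c) :
    ∃ r, secPull f le_rfl r = c := by
  obtain ⟨h, e⟩ := exists_intLine_hom (secPull (f ⁻¹ᵁ U).ι (U := f ⁻¹ᵁ U) (V := ⊤) (by simp) c)
  -- The hypothesis `H` says that `h` identifies any two points with the same image in `X`, which is
  -- the condition for it to factor through the effective epimorphism.
  have hh : ∀ {Z : Scheme.{u}} (g₁ g₂ : Z ⟶ f ⁻¹ᵁ U), g₁ ≫ f ∣_ U = g₂ ≫ f ∣_ U →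
      g₁ ≫ h = g₂ ≫ h := by
    intro Z g₁ g₂ hg
    apply intLine_hom_ext
    rw [evalSec_comp_top, evalSec_comp_top, e, secPull_secPull, secPull_secPull]
    refine H Z (g₁ ≫ (f ⁻¹ᵁ U).ι) (g₂ ≫ (f ⁻¹ᵁ U).ι) ?_ _ _
    simp only [Category.assoc, ← morphismRestrict_ι]
    rw [reassoc_of% hg]
  have := effectiveEpi_restrict f U
  let k := EffectiveEpi.desc (f ∣_ U) h hh
  have hk : f ∣_ U ≫ k = h := EffectiveEpi.fac (f ∣_ U) h hh
  obtain ⟨r, hr⟩ := (bijective_secPull_ι U).2 (evalSec k ⊤ coord)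
  refine ⟨r, (bijective_secPull_ι (f ⁻¹ᵁ U)).1 ?_⟩
  rw [← e, ← hk, evalSec_comp_top, ← hr, secPull_restrict]

end Descent

section TorsorDescent

variable {G D K : Type u} [CommGroup G] [Fintype G] [CommGroup D] [Fintype D] [Field K]
  (E : CharAction G D K) {X Y : Over (Spec (.of K))} [ModObj (constGrp G K) Y] {f : Y ⟶ X}
  (hf : IsTorsor (constGrp G K) f)

include hf in
lemma IsTorsor.trans_left (g : G) : (trans Y g).left ≫ f.left = f.left :=
  congrArg (fun k => k.left) (hf.trans_comp g)

/-- Sections of weight one descend along a torsor. -/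
lemma IsTorsor.exists_secPull_eq {U : X.left.Opens} {c : Γ(Y.left, f.left ⁻¹ᵁ U)}
    (hc : (secChar E hf.trans_left U).IsWt 1 c) :
    ∃ r, secPull f.left le_rfl r = c := by
  have := hf.flat
  have := hf.surjective
  have := hf.locallyOfFinitePresentation
  refine exists_secPull_eq_of_flat f.left c fun T a b hab ha hb => ?_
  -- By the torsor condition the pair `(a, b)` is a point of `G × Y`, and functions of trivial
  -- weight have the same pullback under the action and the projection.
  let z : T ⟶ (constGrp G K ⊗ Y).left := hf.isPullback_left.lift a b hab
  have za : z ≫ (smulHom (constGrp G K) Y).left = a := hf.isPullback_left.lift_fst a b hab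
  have zb : z ≫ (snd (constGrp G K) Y).left = b := hf.isPullback_left.lift_snd a b hab
  let W := (smulHom (constGrp G K) Y).left ⁻¹ᵁ f.left ⁻¹ᵁ U ⊓
    (snd (constGrp G K) Y).left ⁻¹ᵁ f.left ⁻¹ᵁ U
  have hza : ⊤ ≤ (z ≫ (smulHom (constGrp G K) Y).left) ⁻¹ᵁ f.left ⁻¹ᵁ U := by rw [za]; exact ha
  have hzb : ⊤ ≤ (z ≫ (snd (constGrp G K) Y).left) ⁻¹ᵁ f.left ⁻¹ᵁ U := by rw [zb]; exact hb
  have hW : ⊤ ≤ z ⁻¹ᵁ W := fun x hx => ⟨hza hx, hzb hx⟩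
  have h1 := secPull_smul_of_isWt hc (W := W) inf_le_left inf_le_right
  have h2 : charFun E (1 : D) = 1 := funext fun g => by rw [charFun, map_one]; rfl
  rw [h2, map_one, one_mul] at h1
  exact ((secPull_comp za inf_le_left hW ha c).symm.trans (congrArg (secPull z hW) h1)).trans
    (secPull_comp zb inf_le_right hW hb c)

end TorsorDescent

/-! ### Local invertible functions of a given weight -/

section LocalUnits

lemma exists_sum_of_isPushout {A B C P : CommRingCat.{u}} {f : A ⟶ B} {g : A ⟶ C} {i : B ⟶ P}
    {j : C ⟶ P} (h : IsPushout f g i j) (z : P) :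
    ∃ s : Finset (B × C), z = ∑ t ∈ s, i t.1 * j t.2 := by
  algebraize [f.hom, g.hom]
  let e := (CommRingCat.isPushout_tensorProduct A B C).isoIsPushout _ _ h
  have hl (b : B) : e.hom (b ⊗ₜ[A] (1 : C)) = i b :=
    congrArg (fun k : B ⟶ P => k b)
      (IsPushout.inl_isoIsPushout_hom _ _ (CommRingCat.isPushout_tensorProduct A B C) h)
  have hr (c : C) : e.hom ((1 : B) ⊗ₜ[A] c) = j c :=
    congrArg (fun k : C ⟶ P => k c)
      (IsPushout.inr_isoIsPushout_hom _ _ (CommRingCat.isPushout_tensorProduct A B C) h)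
  obtain ⟨w, rfl⟩ := (ConcreteCategory.bijective_of_isIso e.hom).2 z
  obtain ⟨s, hs⟩ := TensorProduct.exists_finset (R := A) (M := B) (N := C) w
  refine ⟨s, ?_⟩
  rw [hs, map_sum]
  refine Finset.sum_congr rfl fun t _ => ?_
  rw [← hl, ← hr, ← map_mul, Algebra.TensorProduct.tmul_mul_tmul, mul_one, one_mul]

/-- Otherwise 1 would lie in the maximal ideal of the stalk at `x`. -/
lemma exists_basicOpen_of_sum_eq_one {X : Scheme.{u}} {I : Type*} {U : X.Opens} (s : Finset I)
    (r : I → Γ(X, U)) (h : ∑ i ∈ s, r i = 1) {x : X} (hx : x ∈ U) :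
    ∃ i ∈ s, x ∈ X.basicOpen (r i) := by
  by_contra! H
  have h1 := congrArg (X.presheaf.germ U x hx) h
  rw [map_sum, map_one] at h1
  have h2 : ∑ i ∈ s, X.presheaf.germ U x hx (r i) ∈
      IsLocalRing.maximalIdeal (X.presheaf.stalk x) :=
    Ideal.sum_mem _ fun i hi => by
      have := H i hi
      rw [Scheme.mem_basicOpen _ _ _ hx] at this
      exact (IsLocalRing.mem_maximalIdeal _).mpr this
  rw [h1] at h2
  exact (IsLocalRing.mem_maximalIdeal _).mp h2 isUnit_one

lemma isUnit_secPull_basicOpen {X Y : Scheme.{u}} (f : Y ⟶ X) {U : X.Opens} (r : Γ(X, U))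
    {V : Y.Opens} (h : V ≤ f ⁻¹ᵁ X.basicOpen r) :
    IsUnit (secPull f (h.trans (f.preimage_mono (X.basicOpen_le r))) r) := by
  rw [← secPull_secRes f h (X.basicOpen_le r)]
  exact (X.toRingedSpace.isUnit_res_basicOpen r).map (secPull f h)

variable {G D K : Type u} [CommGroup G] [Fintype G] [CommGroup D] [Fintype D] [Field K]
  (E : CharAction G D K) {X Y : Over (Spec (.of K))} [ModObj (constGrp G K) Y] {f : Y ⟶ X}
  (hf : IsTorsor (constGrp G K) f)

/-- Locally on the base of a torsor there are invertible functions of any given weight. -/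
lemma IsTorsor.exists_unit_isWt (χ : D) (x : X.left) :
    ∃ U : X.left.Opens, x ∈ U ∧ ∃ c : Γ(Y.left, f.left ⁻¹ᵁ U), IsUnit c ∧
      (secChar E hf.trans_left U).IsWt χ c := by
  have := hf.isFinite
  have := hf.flat
  have := hf.surjective
  have := hf.locallyOfFinitePresentation
  obtain ⟨U, hU, hxU, -⟩ := exists_affine_le (V := ⊤) (x := x) trivial
  let W := (smulHom (constGrp G K) Y).left ⁻¹ᵁ f.left ⁻¹ᵁ U ⊓
    (snd (constGrp G K) Y).left ⁻¹ᵁ f.left ⁻¹ᵁ U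
  -- Over `U` the functions on `Y ×_X Y`, that is on `G × Y`, are the tensor square over `Γ(X, U)`
  -- of the functions on `Y`.
  have hP := (isIso_pushoutSection_iff hf.isPullback_left (US := U) (UT := f.left ⁻¹ᵁ U)
    (UX := f.left ⁻¹ᵁ U) (UY := W) le_rfl le_rfl rfl).mp
    (isIso_pushoutSection_of_isAffineOpen _ _ _ _ hU (hU.preimage f.left) (hU.preimage f.left))
  -- Write the function `χ` on `G × Y` as `∑ xᵢ ⊗ yᵢ`; on the slice at `g` this reads `∑ g(xᵢ) yᵢ =
  -- χ(g)`.
  obtain ⟨s, hs⟩ := exists_sum_of_isPushout hP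
    (evalSec (fst (constGrp G K) Y).left W (charFun E χ))
  let A := secChar E hf.trans_left U
  have hsum := A.exists_sum_mul_eq_one s (fun t => t.1) (fun t => t.2) χ fun g => by
    have hV2 : f.left ⁻¹ᵁ U ≤
        ((shift K Y g).left ≫ (snd (constGrp G K) Y).left) ⁻¹ᵁ f.left ⁻¹ᵁ U := by
      rw [show (shift K Y g).left ≫ (snd (constGrp G K) Y).left = 𝟙 _
          from congrArg (fun k => k.left) (shift_snd K Y g)]
      exact le_rfl
    have hV : f.left ⁻¹ᵁ U ≤ (shift K Y g).left ⁻¹ᵁ W := fun y hy =>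
      ⟨preimage_le_trans hf.trans_left g U hy, hV2 hy⟩
    have h1 := congrArg (secPull (shift K Y g).left hV) hs
    rw [secPull_shift_evalSec, map_sum] at h1
    refine (Finset.sum_congr rfl fun t _ => ?_).trans h1.symm
    refine Eq.trans ?_ (map_mul (secPull (shift K Y g).left hV) _ _).symm
    refine congrArg₂ (· * ·) ?_ ?_
    · exact ((secPull_shift_smul (hq := hf.trans_left) (U := U) (W := W) inf_le_left le_rfl g hV
        t.1).trans (secRes_self _ _)).symm
    · exact ((secPull_shift_snd (q := f.left) (U := U) (W := W) inf_le_right le_rfl g hV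
        t.2).trans (secRes_self _ _)).symm
  -- The products have trivial weight and descend to functions `r t` with sum 1. One of these is
  -- invertible near `x`, and then so is its factor of weight `χ`.
  have hw (t : Γ(Y.left, f.left ⁻¹ᵁ U) × Γ(Y.left, f.left ⁻¹ᵁ U)) :
      A.IsWt 1 (A.proj χ t.1 * A.proj χ⁻¹ t.2) := by
    have := (A.isWt_proj χ t.1).mul (A.isWt_proj χ⁻¹ t.2)
    rwa [mul_inv_cancel] at this
  choose r hr using fun t => hf.exists_secPull_eq E (hw t)
  have hr1 : ∑ t ∈ s, r t = 1 := by
    apply secPull_injective_of_flat f.left U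
    rw [map_sum, map_one, ← hsum]
    exact Finset.sum_congr rfl fun t _ => hr t
  obtain ⟨t, -, hxt⟩ := exists_basicOpen_of_sum_eq_one s r hr1 hxU
  refine ⟨X.left.basicOpen (r t), hxt,
    secRes (f.left.preimage_mono (X.left.basicOpen_le (r t))) (A.proj χ t.1), ?_,
    isWt_secRes (X.left.basicOpen_le (r t)) (A.isWt_proj χ t.1)⟩
  have h2 := isUnit_secPull_basicOpen f.left (r t) (V := f.left ⁻¹ᵁ X.left.basicOpen (r t)) le_rfl
  have h3 := congrArg (secRes (f.left.preimage_mono (X.left.basicOpen_le (r t)))) (hr t)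
  rw [secRes_secPull, map_mul] at h3
  rw [h3] at h2
  exact isUnit_of_mul_isUnit_left h2

end LocalUnits

/-! ### Weight pieces as torsion line bundles, and their extension -/

section PicardTorsion

lemma pullUnit_pullUnit {X Y Z : Scheme.{u}} (f : X ⟶ Y) (g : Y ⟶ Z) {U : Z.Opens} {V : Y.Opens}
    {W : X.Opens} (h : V ≤ g ⁻¹ᵁ U) (h' : W ≤ f ⁻¹ᵁ V) (a : Γ(Z, U)ˣ) :
    pullUnit f h' (pullUnit g h a) = pullUnit (f ≫ g) (h'.trans (f.preimage_mono h)) a :=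
  Units.ext (secPull_secPull f g h h' a)

lemma resUnit_self {X : Scheme.{u}} {U : X.Opens} (h : U ≤ U) (a : Γ(X, U)ˣ) :
    resUnit h a = a := Units.ext (secRes_self h a)

/-- A power of a cocycle. -/
def LineCocycle.pow {X : Scheme.{u}} (c : LineCocycle X) (n : ℕ) : LineCocycle X where
  U := c.U
  mem := c.mem
  g x y := c.g x y ^ n
  cocycle x y z W hx hy hz := by
    simp only [map_pow]
    rw [← mul_pow, c.cocycle x y z W hx hy hz]

/-- The class of a cocycle. -/
def Pic.mk {X : Scheme.{u}} (c : LineCocycle X) : Pic X := Quotient.mk _ c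

lemma Pic.mk_pow {X : Scheme.{u}} (c : LineCocycle X) (n : ℕ) :
    Pic.mk c ^ n = Pic.mk (c.pow n) := by
  induction n with
  | zero =>
    rw [pow_zero]
    refine Quotient.sound (LineCocycle.rel_of_eq fun x y W h₁ h₂ => ?_)
    exact (map_one (resUnit h₁)).trans ((map_one (resUnit h₂)).symm.trans
      (congrArg (resUnit (U := c.U x ⊓ c.U y) h₂) (pow_zero (c.g x y)).symm))
  | succ n ih =>
    rw [pow_succ, ih]
    refine Quotient.sound (LineCocycle.rel_of_eq fun x y W h₁ h₂ => ?_)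
    have l : (c.U x ⊓ c.U x) ⊓ (c.U y ⊓ c.U y) ≤ c.U x ⊓ c.U y := inf_le_inf inf_le_left inf_le_left
    have key (h₁ : W ≤ (c.U x ⊓ c.U x) ⊓ (c.U y ⊓ c.U y)) (h₂ : W ≤ c.U x ⊓ c.U y) :
        resUnit h₁ (resUnit l (c.g x y ^ n) * resUnit l (c.g x y)) =
          resUnit h₂ (c.g x y ^ (n + 1)) := by
      rw [pow_succ, map_mul, map_mul, resUnit_resUnit, resUnit_resUnit]
    exact key h₁ h₂

variable {G D K : Type u} [CommGroup G] [Fintype G] [CommGroup D] [Fintype D] [Field K]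
  (E : CharAction G D K) {X Y : Over (Spec (.of K))} [ModObj (constGrp G K) Y] {f : Y ⟶ X}
  (hf : IsTorsor (constGrp G K) f)

include hf in
lemma IsTorsor.pullUnit_injective (U : X.left.Opens) :
    Function.Injective (pullUnit f.left (U := U) (V := f.left ⁻¹ᵁ U) le_rfl) := fun a b h => by
  have := hf.flat
  have := hf.surjective
  have := hf.locallyOfFinitePresentation
  exact Units.ext (secPull_injective_of_flat f.left U (congrArg Units.val h))

/-- The inverse of `c` has trivial weight too, so it descends along with `c`. -/
lemma IsTorsor.exists_pullUnit_eq {U : X.left.Opens} (c : Γ(Y.left, f.left ⁻¹ᵁ U)ˣ)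
    (hc : (secChar E hf.trans_left U).IsWt 1 (c : Γ(Y.left, f.left ⁻¹ᵁ U))) :
    ∃ r, pullUnit f.left le_rfl r = c := by
  have := hf.flat
  have := hf.surjective
  have := hf.locallyOfFinitePresentation
  obtain ⟨r, hr⟩ := hf.exists_secPull_eq E hc
  obtain ⟨r', hr'⟩ := hf.exists_secPull_eq E
    (c := (c⁻¹ : Γ(Y.left, f.left ⁻¹ᵁ U)ˣ)) (by
      have := hc.inv_of_mul_eq_one c.mul_inv
      rwa [inv_one] at this)
  have h : r * r' = 1 := secPull_injective_of_flat f.left U (by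
    rw [map_mul, hr, hr', map_one]
    exact c.mul_inv)
  exact ⟨⟨r, r', h, by rw [mul_comm, h]⟩, Units.ext hr⟩

lemma isWt_resUnit {Z : Scheme.{u}} {q : Y.left ⟶ Z} {hq : ∀ g : G, (trans Y g).left ≫ q = q}
    {U V : Z.Opens} (h : V ≤ U) {χ : D} {c : Γ(Y.left, q ⁻¹ᵁ U)ˣ}
    (hc : (secChar E hq U).IsWt χ (c : Γ(Y.left, q ⁻¹ᵁ U))) :
    (secChar E hq V).IsWt χ
      (resUnit (q.preimage_mono h) c : Γ(Y.left, q ⁻¹ᵁ V)ˣ).val :=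
  isWt_secRes h hc

/-- The functions of weight `χ` form a line bundle on the base: ratios of local unit generators have
trivial weight, so they descend and serve as transition functions. -/
lemma IsTorsor.exists_lineCocycle (χ : D) :
    ∃ (c : LineCocycle X.left) (a : ∀ x, Γ(Y.left, f.left ⁻¹ᵁ c.U x)ˣ),
      (∀ x, (secChar E hf.trans_left (c.U x)).IsWt χ (a x).val) ∧
      (∀ x y, pullUnit f.left (V := f.left ⁻¹ᵁ (c.U x ⊓ c.U y)) le_rfl (c.g x y) =
        resUnit (f.left.preimage_mono inf_le_left) (a x) *
          (resUnit (f.left.preimage_mono inf_le_right) (a y))⁻¹) := by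
  choose U hxU a hau haw using hf.exists_unit_isWt E χ
  let a' (x) : Γ(Y.left, f.left ⁻¹ᵁ U x)ˣ := (hau x).unit
  have haw' (x) : (secChar E hf.trans_left (U x)).IsWt χ (a' x).val := haw x
  have hg (x y) := hf.exists_pullUnit_eq E (U := U x ⊓ U y)
    (resUnit (f.left.preimage_mono inf_le_left) (a' x) *
      (resUnit (f.left.preimage_mono inf_le_right) (a' y))⁻¹) (by
    have h1 := isWt_resUnit E (inf_le_left : U x ⊓ U y ≤ U x) (haw' x)
    have h2 := isWt_resUnit E (inf_le_right : U x ⊓ U y ≤ U y) (haw' y)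
    have h3 := h1.mul (h2.inv_of_mul_eq_one (Units.mul_inv _))
    rw [mul_inv_cancel] at h3
    exact h3)
  choose g hg using hg
  have hg' (x y) {W : X.left.Opens} (h : W ≤ U x ⊓ U y) :
      pullUnit f.left (f.left.preimage_mono h) (g x y) =
        resUnit (f.left.preimage_mono (h.trans inf_le_left)) (a' x) *
          (resUnit (f.left.preimage_mono (h.trans inf_le_right)) (a' y))⁻¹ := by
    have := congrArg (resUnit (f.left.preimage_mono h)) (hg x y)
    rw [resUnit_pullUnit, map_mul, map_inv, resUnit_resUnit, resUnit_resUnit] at this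
    exact this
  refine ⟨⟨U, hxU, g, fun x y z W hx hy hz => ?_⟩, a', haw', hg⟩
  apply hf.pullUnit_injective
  rw [map_mul, pullUnit_resUnit, pullUnit_resUnit, pullUnit_resUnit, hg' x y (le_inf hx hy),
    hg' y z (le_inf hy hz), hg' x z (le_inf hx hz)]
  group

/-- The line bundle of sections of a given weight of a torsor is torsion. -/
lemma IsTorsor.mk_mem_torsionPic {χ : D} {m : ℕ} (hm : χ ^ m = 1) (c : LineCocycle X.left)
    (a : ∀ x, Γ(Y.left, f.left ⁻¹ᵁ c.U x)ˣ)
    (ha : ∀ x, (secChar E hf.trans_left (c.U x)).IsWt χ (a x).val)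
    (hg : ∀ x y, pullUnit f.left (V := f.left ⁻¹ᵁ (c.U x ⊓ c.U y)) le_rfl (c.g x y) =
        resUnit (f.left.preimage_mono inf_le_left) (a x) *
          (resUnit (f.left.preimage_mono inf_le_right) (a y))⁻¹) :
    Pic.mk c ∈ torsionPic m X.left := by
  change Pic.mk c ^ m = 1
  rw [Pic.mk_pow]
  -- The `m`-th powers of the generators descend to units `b x`, which trivialize the `m`-th power
  -- of the bundle.
  have hb (x) := hf.exists_pullUnit_eq E (a x ^ m) (by
    have := (ha x).pow m
    rw [hm] at this
    rw [Units.val_pow_eq_pow_val]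
    exact this)
  choose b hb using hb
  refine Quotient.sound ⟨c.U, c.mem, fun _ => le_rfl, fun _ => le_top, fun x => (b x)⁻¹,
    fun x y => ?_⟩
  have hb' (x) {W : X.left.Opens} (h : W ≤ c.U x) : pullUnit f.left (f.left.preimage_mono h) (b x) =
      resUnit (f.left.preimage_mono h) (a x) ^ m := by
    have := congrArg (resUnit (f.left.preimage_mono h)) (hb x)
    rwa [resUnit_pullUnit, map_pow] at this
  have key : resUnit inf_le_left (b x)⁻¹ * c.g x y ^ m =
      resUnit (V := c.U x ⊓ c.U y) inf_le_right (b y)⁻¹ := by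
    apply hf.pullUnit_injective
    rw [map_mul, pullUnit_resUnit, pullUnit_resUnit, map_pow, map_inv, map_inv, hb' x inf_le_left,
      hb' y inf_le_right, hg x y, mul_pow, inv_pow, inv_mul_cancel_left]
  refine (congrArg (resUnit inf_le_left (b x)⁻¹ * ·)
    (resUnit_self le_rfl (c.g x y ^ m))).trans (key.trans ?_)
  exact ((congrArg (· * resUnit inf_le_right (b y)⁻¹) (map_one (resUnit _))).trans (one_mul _)).symm

lemma LineCocycle.exists_of_map_mk_eq {X Z : Scheme.{u}} {j : X ⟶ Z} {c : LineCocycle Z}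
    {c₀ : LineCocycle X} (H : Pic.map j (Pic.mk c) = Pic.mk c₀) :
    ∃ (W : X → X.Opens) (h : ∀ x, Γ(X, W x)ˣ), (∀ x, x ∈ W x) ∧ (∀ x, W x ≤ j ⁻¹ᵁ c.U (j x)) ∧
      (∀ x, W x ≤ c₀.U x) ∧ ∀ (x y) (V : X.Opens) (h₁ : V ≤ W x) (h₂ : V ≤ W y)
      (h₃ : V ≤ j ⁻¹ᵁ (c.U (j x) ⊓ c.U (j y))) (h₄ : V ≤ c₀.U x ⊓ c₀.U y),
      resUnit h₁ (h x) * pullUnit j h₃ (c.g (j x) (j y)) =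
        resUnit h₄ (c₀.g x y) * resUnit h₂ (h y) := by
  obtain ⟨W, hW, hc, hd, h, H⟩ := Quotient.exact H
  refine ⟨W, h, hW, hc, hd, fun x y V h₁ h₂ h₃ h₄ => ?_⟩
  have e := congrArg (resUnit (V := V) (le_inf h₁ h₂)) (H x y)
  rw [map_mul, map_mul, resUnit_resUnit, resUnit_resUnit, resUnit_resUnit, resUnit_resUnit] at e
  refine Eq.trans (congrArg (resUnit h₁ (h x) * ·) ?_) e
  exact (resUnit_pullUnit j (V := j ⁻¹ᵁ c.U (j x) ⊓ j ⁻¹ᵁ c.U (j y)) le_rfl _ _).symm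

-- The bundle of weight `χ⁻¹` is the restriction of a cocycle `c` on `Z`. Dividing the units `h`
-- that compare the two by the generators `a` of weight `χ⁻¹` gives units `d` of weight `χ` whose
-- transition functions come from `Z`.
include hf in
lemma IsTorsor.exists_trivialization {Z : Scheme.{u}} (j : X.left ⟶ Z) {m : ℕ}
    (hPic : Set.SurjOn (Pic.map j) (torsionPic m Z) (torsionPic m X.left))
    (χ : D) (hm : χ ^ m = 1) :
    ∃ (c : LineCocycle Z) (W : X.left → X.left.Opens) (d : ∀ x, Γ(Y.left, f.left ⁻¹ᵁ W x)ˣ),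
      (∀ x, x ∈ W x) ∧ (∀ x, W x ≤ j ⁻¹ᵁ c.U (j x)) ∧
      (∀ x, (secChar E hf.trans_left (W x)).IsWt χ (d x).val) ∧
      ∀ (x y) (V : Y.left.Opens) (h1 : V ≤ f.left ⁻¹ᵁ W x) (h2 : V ≤ f.left ⁻¹ᵁ W y)
        (h3 : V ≤ (f.left ≫ j) ⁻¹ᵁ (c.U (j x) ⊓ c.U (j y))),
        resUnit h1 (d x) * pullUnit (f.left ≫ j) h3 (c.g (j x) (j y)) = resUnit h2 (d y) := by
  obtain ⟨c₀, a, ha, hg⟩ := hf.exists_lineCocycle E χ⁻¹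
  obtain ⟨M, -, hM⟩ := hPic (hf.mk_mem_torsionPic E (m := m) (by rw [inv_pow, hm, inv_one])
    c₀ a ha hg)
  obtain ⟨c, rfl⟩ := Quotient.exists_rep M
  obtain ⟨W, h, hW, hc, hd, H⟩ := LineCocycle.exists_of_map_mk_eq hM
  refine ⟨c, W, fun x => (resUnit (f.left.preimage_mono (hd x)) (a x))⁻¹ *
    pullUnit f.left le_rfl (h x), hW, hc, fun x => ?_, fun x y V h1 h2 h3 => ?_⟩
  · have h1 := (isWt_resUnit E (hd x) (ha x)).inv_of_mul_eq_one (Units.mul_inv _)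
    have h2 : (secChar E hf.trans_left (W x)).IsWt 1
      (pullUnit f.left (V := f.left ⁻¹ᵁ W x) le_rfl (h x)).val := isWt_one_secPull (h x).val
    have h3 := h1.mul h2
    rwa [inv_inv, mul_one] at h3
  · have h12 : V ≤ f.left ⁻¹ᵁ (W x ⊓ W y) := fun t ht => ⟨h1 ht, h2 ht⟩
    have k : W x ⊓ W y ≤ c₀.U x ⊓ c₀.U y := inf_le_inf (hd x) (hd y)
    have k' : W x ⊓ W y ≤ j ⁻¹ᵁ (c.U (j x) ⊓ c.U (j y)) := fun t ht => ⟨hc x ht.1, hc y ht.2⟩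
    have e := congrArg (pullUnit f.left h12) (H x y _ inf_le_left inf_le_right k' k)
    have e' := congrArg (resUnit (h12.trans (f.left.preimage_mono k))) (hg x y)
    rw [resUnit_pullUnit, map_mul, map_inv, resUnit_resUnit, resUnit_resUnit] at e'
    rw [map_mul, map_mul, pullUnit_resUnit, pullUnit_pullUnit, pullUnit_resUnit, pullUnit_resUnit,
      e'] at e
    rw [map_mul, map_mul, map_inv, map_inv, resUnit_resUnit, resUnit_resUnit, resUnit_pullUnit,
      resUnit_pullUnit, mul_assoc, e]
    group

include hf in
/-- If the torsion line bundles on `X` extend along `j : X ⟶ Z`, then a torsor over `X` has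
invertible functions of any given weight locally on `Z`. -/
theorem IsTorsor.exists_unit_isWt_of_surjOn {Z : Scheme.{u}} (j : X.left ⟶ Z) {m : ℕ}
    (hPic : Set.SurjOn (Pic.map j) (torsionPic m Z) (torsionPic m X.left))
    (hq : ∀ g : G, (trans Y g).left ≫ f.left ≫ j = f.left ≫ j)
    (χ : D) (hm : χ ^ m = 1) (z : Z) :
    ∃ U : Z.Opens, z ∈ U ∧ ∃ e : Γ(Y.left, (f.left ≫ j) ⁻¹ᵁ U), IsUnit e ∧
      (secChar E hq U).IsWt χ e := by
  obtain ⟨c, W, d, hW, hc, hdw, hdc⟩ := hf.exists_trivialization E j hPic χ hm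
  let q := f.left ≫ j
  let V := c.U z
  let N (x) : X.left.Opens := W x ⊓ j ⁻¹ᵁ V
  have hN (x) : f.left ⁻¹ᵁ N x ≤ q ⁻¹ᵁ (c.U (j x) ⊓ V) := fun t ht => ⟨hc x ht.1, ht.2⟩
  have hNV (x) : f.left ⁻¹ᵁ N x ≤ q ⁻¹ᵁ V := fun t ht => ht.2
  -- Over `V` the cocycle `c` is trivialized by its frame at `z`: after multiplication by the
  -- transition function from `j x` to `z`, the units `d x` agree on overlaps.
  obtain ⟨s, hs⟩ : ∃ s : ∀ x, Γ(Y.left, f.left ⁻¹ᵁ N x)ˣ, ∀ x, s x =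
      resUnit (f.left.preimage_mono inf_le_left) (d x) * pullUnit q (hN x) (c.g (j x) z) :=
    ⟨_, fun _ => rfl⟩
  obtain ⟨e, he⟩ := sec_glue (V := q ⁻¹ᵁ V) (fun x => f.left ⁻¹ᵁ N x) hNV
    (fun y hy => ⟨f.left y, hW _, hy⟩) (fun x => (s x).val)
    (fun x y t hx hy => by
      have l : f.left ⁻¹ᵁ N x ⊓ f.left ⁻¹ᵁ N y ≤ q ⁻¹ᵁ (c.U (j x) ⊓ c.U (j y) ⊓ V) :=
        fun t ht => ⟨⟨hc x ht.1.1, hc y ht.2.1⟩, ht.1.2⟩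
      refine ⟨f.left ⁻¹ᵁ N x ⊓ f.left ⁻¹ᵁ N y, ⟨hx, hy⟩, inf_le_left,
        inf_le_right, congrArg Units.val (?_ : resUnit _ (s x) = resUnit _ (s y))⟩
      have e1 := hdc x y _ (inf_le_left.trans (f.left.preimage_mono inf_le_left))
        (inf_le_right.trans (f.left.preimage_mono inf_le_left))
        (l.trans (q.preimage_mono inf_le_left))
      have e2 := congrArg (pullUnit q l) (c.cocycle (j x) (j y) z _
        (inf_le_left.trans inf_le_left) (inf_le_left.trans inf_le_right) inf_le_right)
      rw [map_mul, pullUnit_resUnit, pullUnit_resUnit, pullUnit_resUnit] at e2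
      rw [hs, hs, map_mul, map_mul, resUnit_resUnit, resUnit_resUnit, resUnit_pullUnit,
        resUnit_pullUnit, ← e1, mul_assoc, e2])
  refine ⟨V, c.mem z, e, sec_isUnit fun y hy => ?_, (isWt_secChar_iff E hq).mpr fun g =>
    sec_ext fun y hy => ?_⟩
  · refine ⟨f.left ⁻¹ᵁ N (f.left y), ⟨hW _, hy⟩, hNV _, ?_⟩
    rw [he]
    exact (s _).isUnit
  · refine ⟨f.left ⁻¹ᵁ N (f.left y), ⟨hW _, hy⟩, hNV _, ?_⟩
    generalize f.left y = x
    have hw : (secChar E hf.trans_left (N x)).IsWt χ (s x).val := by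
      have h1 := isWt_resUnit E (inf_le_left : N x ≤ W x) (hdw x)
      have k : N x ≤ j ⁻¹ᵁ (c.U (j x) ⊓ V) := fun t ht => ⟨hc x ht.1, ht.2⟩
      have h2 : (secChar E hf.trans_left (N x)).IsWt 1
          (secPull f.left (V := f.left ⁻¹ᵁ N x) le_rfl (pullUnit j k (c.g (j x) z)).val) :=
        isWt_one_secPull _
      have h3 := h1.mul h2
      rw [mul_one] at h3
      refine (congrArg (CharAction.IsWt _ χ) ?_).mp h3
      rw [hs]
      exact congrArg (_ * ·) (secPull_secPull f.left j _ _ _)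
    have h1 := (isWt_secChar_iff E hf.trans_left).mp hw g
    rw [← he x, secPull_secRes] at h1
    rw [secRes_secPull, map_mul, secRes_evalSec]
    exact h1

end PicardTorsion

/-! ### Functions on the generic and special fibres -/

section BaseChange

variable {R : Type u} [CommRing R] (Z : Over (Spec (.of R)))

/-- The sections of a base change over an affine open subset. -/
lemma isPushout_baseChange (B : Type u) [CommRing B] [Algebra R B] {W : Z.left.Opens}
    (hW : IsAffineOpen W) :
    IsPushout (CommRingCat.ofHom (evalSec Z.hom W)) (CommRingCat.ofHom (algebraMap R B))
      (CommRingCat.ofHom (secPull (baseChangeProj B Z) (V := baseChangeProj B Z ⁻¹ᵁ W) le_rfl))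
      (CommRingCat.ofHom (evalSec ((baseChange R B).obj Z).hom (baseChangeProj B Z ⁻¹ᵁ W))) := by
  have H : IsPullback (baseChangeProj B Z) ((baseChange R B).obj Z).hom Z.hom (specMap R B) :=
    IsPullback.of_hasPullback _ _
  have hP := (isIso_pushoutSection_iff H (US := ⊤) (UT := ⊤) (UX := W)
    (UY := baseChangeProj B Z ⁻¹ᵁ W) (le_preimage_top _ _) (le_preimage_top _ _)
    (le_antisymm (le_inf le_rfl (le_preimage_top _ _)) inf_le_left)).mp
    (isIso_pushoutSection_of_isAffineOpen _ _ _ _ (isAffineOpen_top _) (isAffineOpen_top _) hW)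
  refine hP.of_iso (Scheme.ΓSpecIso (.of R)) (Iso.refl _) (Scheme.ΓSpecIso (.of B)) (Iso.refl _)
    ?_ ?_ ?_ ?_
  · ext a
    change secPull Z.hom _ a = secPull Z.hom _ ((Scheme.ΓSpecIso (.of R)).inv
      ((Scheme.ΓSpecIso (.of R)).hom a))
    rw [← CommRingCat.comp_apply, Iso.hom_inv_id]
    rfl
  · have := Scheme.ΓSpecIso_naturality (CommRingCat.ofHom (algebraMap R B))
    rw [← this, Scheme.Hom.appTop, Scheme.Hom.app_eq_appLE]
    rfl
  · exact (Category.comp_id _).trans (Category.id_comp _).symm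
  · ext a
    change secPull _ _ a = secPull _ _ ((Scheme.ΓSpecIso (.of B)).inv
      ((Scheme.ΓSpecIso (.of B)).hom a))
    rw [← CommRingCat.comp_apply (Scheme.ΓSpecIso (.of B)).hom, Iso.hom_inv_id]
    rfl

/-- A section vanishing on the fibre over a quotient of the base ring. -/
lemma exists_mul_of_secPull_eq_zero {π : R} {B : Type u} [CommRing B] [Algebra R B]
    (hπ : ∀ r, algebraMap R B r = 0 → π ∣ r) (hB : Function.Surjective (algebraMap R B))
    {W : Z.left.Opens} (hW : IsAffineOpen W) {a : Γ(Z.left, W)}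
    (ha : secPull (baseChangeProj B Z) (V := baseChangeProj B Z ⁻¹ᵁ W) le_rfl a = 0) :
    evalSec Z.hom W π ∣ a := by
  let I := Ideal.span {evalSec Z.hom W π}
  have hk (r : R) (hr : r ∈ RingHom.ker (algebraMap R B)) :
      (Ideal.Quotient.mk I).comp (evalSec Z.hom W) r = 0 := by
    rw [RingHom.comp_apply, Ideal.Quotient.eq_zero_iff_mem, Ideal.mem_span_singleton]
    exact map_dvd _ (hπ r hr)
  -- Functions on the fibre are `Γ(Z, W) ⊗ B`. Since the kernel of `R → B` consists of multiples of
  -- `π`, reduction modulo `π` factors through them.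
  let φ : B →+* Γ(Z.left, W) ⧸ I := RingHom.liftOfSurjective (algebraMap R B) hB
    ⟨(Ideal.Quotient.mk I).comp (evalSec Z.hom W), hk⟩
  have hφ (r : R) : φ (algebraMap R B r) = Ideal.Quotient.mk I (evalSec Z.hom W r) :=
    RingHom.liftOfRightInverse_comp_apply _ _ _ ⟨_, hk⟩ r
  have hP := isPushout_baseChange Z B hW
  have hc : CommRingCat.ofHom (evalSec Z.hom W) ≫ CommRingCat.ofHom (Ideal.Quotient.mk I) =
      CommRingCat.ofHom (algebraMap R B) ≫ CommRingCat.ofHom φ := by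
    ext r
    exact (hφ r).symm
  have h1 := congrArg (fun k => k.hom a) (hP.inl_desc _ _ hc)
  have h2 : Ideal.Quotient.mk I a = 0 := by
    refine h1.symm.trans ?_
    change (hP.desc _ _ hc).hom (secPull (baseChangeProj B Z) _ a) = 0
    rw [ha, map_zero]
  rwa [Ideal.Quotient.eq_zero_iff_mem, Ideal.mem_span_singleton] at h2

variable (K : Type u) [Field K] [Algebra R K] [IsFractionRing R K]

/-- Denominators can be cleared: a function on the generic fibre is a finite sum of products of
functions on `W` and elements of `K`. -/
lemma exists_mul_eq_secPull [IsDomain R] {W : Z.left.Opens} (hW : IsAffineOpen W)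
    (b : Γ(((baseChange R K).obj Z).left, baseChangeProj K Z ⁻¹ᵁ W)) :
    ∃ s : R, s ≠ 0 ∧ ∃ a : Γ(Z.left, W),
      secPull (baseChangeProj K Z) (V := baseChangeProj K Z ⁻¹ᵁ W) le_rfl a =
        evalSec ((baseChange R K).obj Z).hom _ (algebraMap R K s) * b := by
  obtain ⟨t, rfl⟩ := exists_sum_of_isPushout (isPushout_baseChange Z K hW) b
  classical
  obtain ⟨s, hs⟩ := IsLocalization.exist_integer_multiples_of_finset (nonZeroDivisors R)
    (t.image Prod.snd)
  have hs' (x) (hx : x ∈ t) : ∃ r : R, algebraMap R K r = algebraMap R K s * x.2 := by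
    obtain ⟨r, hr⟩ := hs x.2 (Finset.mem_image_of_mem _ hx)
    exact ⟨r, hr.trans (Algebra.smul_def _ _)⟩
  choose! r hr using hs'
  refine ⟨s, nonZeroDivisors.coe_ne_zero s, ∑ x ∈ t, x.1 * evalSec Z.hom W (r x), ?_⟩
  rw [map_sum, Finset.mul_sum]
  refine Finset.sum_congr rfl fun x hx => ?_
  have h1 : secPull (baseChangeProj K Z) (V := baseChangeProj K Z ⁻¹ᵁ W) le_rfl
      (evalSec Z.hom W (r x)) = evalSec ((baseChange R K).obj Z).hom _ (algebraMap R K (r x)) :=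
    congrArg (fun k => k.hom (r x)) (isPushout_baseChange Z K hW).w
  rw [map_mul, h1, hr x hx, map_mul]
  exact mul_left_comm _ _ _

lemma flat_evalSec [Flat Z.hom] {W : Z.left.Opens} (hW : IsAffineOpen W) :
    (evalSec Z.hom W).Flat := by
  refine RingHom.Flat.comp (RingHom.Flat.of_bijective ?_)
    (Z.hom.flat_appLE (isAffineOpen_top _) hW (le_preimage_top _ _))
  exact ConcreteCategory.bijective_of_isIso (Scheme.ΓSpecIso (.of R)).inv

/-- By flatness, tensoring the inclusion of `R` in `K` with `Γ(Z, W)` keeps it injective. -/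
lemma secPull_baseChangeProj_injective [IsDomain R] [Flat Z.hom] {W : Z.left.Opens}
    (hW : IsAffineOpen W) :
    Function.Injective (secPull (baseChangeProj K Z) (V := baseChangeProj K Z ⁻¹ᵁ W) le_rfl) := by
  let _ : Algebra R Γ(Z.left, W) := (evalSec Z.hom W).toAlgebra
  have : Module.Flat R Γ(Z.left, W) := flat_evalSec Z hW
  let e := (CommRingCat.isPushout_tensorProduct R Γ(Z.left, W) K).isoIsPushout _ _
    (isPushout_baseChange Z K hW)
  have hl (b : Γ(Z.left, W)) : e.hom (b ⊗ₜ[R] (1 : K)) =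
      secPull (baseChangeProj K Z) (V := baseChangeProj K Z ⁻¹ᵁ W) le_rfl b :=
    congrArg (fun k => k.hom b) (IsPushout.inl_isoIsPushout_hom _ _
      (CommRingCat.isPushout_tensorProduct R Γ(Z.left, W) K) (isPushout_baseChange Z K hW))
  intro a b hab
  rw [← hl, ← hl] at hab
  exact Algebra.TensorProduct.includeLeft_injective (S := R) (IsFractionRing.injective R K)
    ((ConcreteCategory.bijective_of_isIso e.hom).1 hab)

lemma isUnit_evalSec_baseChange {V : ((baseChange R K).obj Z).left.Opens} {s : R} (hs : s ≠ 0) :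
    IsUnit (evalSec ((baseChange R K).obj Z).hom V (algebraMap R K s)) :=
  (IsUnit.mk0 _ (by rwa [ne_eq, IsFractionRing.to_map_eq_zero_iff])).map _

lemma secPull_evalSec_baseChange (B : Type u) [CommRing B] [Algebra R B] {W : Z.left.Opens}
    {V : ((baseChange R B).obj Z).left.Opens} (hV : V ≤ baseChangeProj B Z ⁻¹ᵁ W) (r : R) :
    secPull (baseChangeProj B Z) hV (evalSec Z.hom W r) =
      evalSec ((baseChange R B).obj Z).hom V (algebraMap R B r) :=
  (secPull_evalSec_comp (pullback.condition (f := Z.hom) (g := specMap R B)) hV r).trans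
    (evalSec_comp_specMap _ (algebraMap R B) V r)

end BaseChange

/-! ### Extension of integral functions on a normal scheme -/

section Normality

variable {R : Type u} [CommRing R] [IsDomain R] (Z : Over (Spec (.of R)))
  (K : Type u) [Field K] [Algebra R K] [IsFractionRing R K]

include K in
lemma mul_evalSec_eq_zero [Flat Z.hom] {W : Z.left.Opens} (hW : IsAffineOpen W) {s : R}
    (hs : s ≠ 0) {a : Γ(Z.left, W)} (h : evalSec Z.hom W s * a = 0) : a = 0 := by
  apply secPull_baseChangeProj_injective Z K hW
  have h1 := congrArg (secPull (baseChangeProj K Z) (V := baseChangeProj K Z ⁻¹ᵁ W) le_rfl) h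
  rw [map_mul, secPull_evalSec_baseChange, map_zero] at h1
  rw [map_zero]
  exact (isUnit_evalSec_baseChange Z K hs).mul_right_eq_zero.mp h1

-- Otherwise `s` would vanish near `x`; as it is a nonzerodivisor there, `1 = 0` would follow.
include K in
lemma germ_evalSec_ne_zero [Flat Z.hom] {W : Z.left.Opens} {x : Z.left} (hx : x ∈ W) {s : R}
    (hs : s ≠ 0) : Z.left.presheaf.germ W x hx (evalSec Z.hom W s) ≠ 0 := by
  intro h
  rw [← map_zero (Z.left.presheaf.germ W x hx).hom] at h
  obtain ⟨V, hxV, i, i', e⟩ := Z.left.presheaf.germ_eq x hx hx _ _ h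
  obtain ⟨V', hV', hxV', hVV'⟩ := exists_affine_le hxV
  have e1 : secRes (hVV'.trans (leOfHom i)) (evalSec Z.hom W s) = 0 := by
    have := congrArg (secRes hVV') e
    rw [map_zero, map_zero] at this
    rw [← secRes_secRes (leOfHom i) hVV']
    exact this
  rw [secRes_evalSec] at e1
  have h1 := mul_evalSec_eq_zero Z K hV' hs (a := 1) (by rw [mul_one, e1])
  have h2 := congrArg (Z.left.presheaf.germ V' x hxV') h1
  rw [map_one, map_zero] at h2
  exact one_ne_zero h2

/-- On a normal flat scheme, a function on the generic fibre that is integral over an affine open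
subset extends to it. -/
lemma exists_secPull_eq_of_isIntegralElem [Flat Z.hom] [IsNormalScheme Z.left]
    {W : Z.left.Opens} (hW : IsAffineOpen W)
    (b : Γ(((baseChange R K).obj Z).left, baseChangeProj K Z ⁻¹ᵁ W))
    (hb : (secPull (baseChangeProj K Z) (V := baseChangeProj K Z ⁻¹ᵁ W) le_rfl).IsIntegralElem b) :
    ∃ a, secPull (baseChangeProj K Z) (V := baseChangeProj K Z ⁻¹ᵁ W) le_rfl a = b := by
  obtain ⟨s, hs, a, ha⟩ := exists_mul_eq_secPull Z K hW b
  -- With `b = a / s`, it remains to see that `s` divides `a`. This is tested in the stalks, which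
  -- are integrally closed.
  suffices h : a ∈ Ideal.span {evalSec Z.hom W s} by
    obtain ⟨c, rfl⟩ := Ideal.mem_span_singleton.mp h
    refine ⟨c, (isUnit_evalSec_baseChange Z K hs).mul_left_cancel ?_⟩
    rw [← ha, map_mul, secPull_evalSec_baseChange]
  rw [hW.mem_ideal_iff]
  intro x hx
  let O := Z.left.presheaf.stalk x
  have : IsDomain O := IsNormalScheme.isDomain x
  have : IsIntegrallyClosed O := IsNormalScheme.isIntegrallyClosed x
  let g : Γ(Z.left, W) →+* O := (Z.left.presheaf.germ W x hx).hom
  let ψ : Γ(Z.left, W) →+* FractionRing O := (algebraMap O (FractionRing O)).comp g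
  have hinj : Function.Injective (ψ.comp (evalSec Z.hom W)) := by
    rw [injective_iff_map_eq_zero]
    intro r hr
    by_contra h
    refine germ_evalSec_ne_zero Z K hx h ?_
    exact (IsFractionRing.to_map_eq_zero_iff (K := FractionRing O)).mp hr
  let κ : K →+* FractionRing O := IsFractionRing.lift hinj
  have hκ (r : R) : κ (algebraMap R K r) = ψ (evalSec Z.hom W r) :=
    IsFractionRing.lift_algebraMap hinj r
  have hP := isPushout_baseChange Z K hW
  have hc : CommRingCat.ofHom (evalSec Z.hom W) ≫ CommRingCat.ofHom ψ =
      CommRingCat.ofHom (algebraMap R K) ≫ CommRingCat.ofHom κ := by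
    ext r
    exact (hκ r).symm
  -- `δ` reads a function on the generic fibre as a fraction of the stalk; `δ b` is integral and
  -- hence lies in the stalk.
  let δ := (hP.desc _ _ hc).hom
  have hδ (a) : δ (secPull (baseChangeProj K Z) (V := baseChangeProj K Z ⁻¹ᵁ W) le_rfl a) = ψ a :=
    congrArg (fun k => k.hom a) (hP.inl_desc _ _ hc)
  have hδb : IsIntegral O (δ b) := by
    obtain ⟨p, hp, hp0⟩ := hb
    refine ⟨p.map g, hp.map g, ?_⟩
    rw [Polynomial.eval₂_map]
    have := congrArg δ hp0
    rw [Polynomial.hom_eval₂, map_zero] at this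
    rw [← this]
    congr 1
    ext a
    exact (hδ a).symm
  obtain ⟨c, hc'⟩ := IsIntegrallyClosed.isIntegral_iff.mp hδb
  have h1 := congrArg δ ha
  rw [hδ, map_mul, ← secPull_evalSec_baseChange Z K le_rfl, hδ, ← hc'] at h1
  have h2 : g a = g (evalSec Z.hom W s) * c := by
    apply IsFractionRing.injective O (FractionRing O)
    rw [map_mul]
    exact h1
  change g a ∈ _
  rw [h2]
  exact Ideal.mul_mem_right _ _ (Ideal.mem_map_of_mem g (Ideal.mem_span_singleton_self _))

end Normality

/-! ### The normalization computed by integral functions -/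

section NormalizationSections

/-- Sections of the normalization over an affine open subset. -/
lemma bijOn_secPull_toNormalization {X Y : Scheme.{u}} (q : Y ⟶ X) [QuasiCompact q]
    [QuasiSeparated q] {U : X.Opens} (hU : IsAffineOpen U)
    (h : q ⁻¹ᵁ U ≤ q.toNormalization ⁻¹ᵁ q.fromNormalization ⁻¹ᵁ U) :
    Function.Injective (secPull q.toNormalization h) ∧ ∀ b,
      (secPull q (V := q ⁻¹ᵁ U) le_rfl).IsIntegralElem b ↔
        ∃ a, secPull q.toNormalization h a = b := by
  let _ := (q.app U).hom.toAlgebra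
  have hv : ∀ a, secPull q.toNormalization h a = ((q.normalizationObjIso hU).hom a).val :=
    fun a => (congrArg (fun k => k.hom a) (q.normalizationObjIso_hom_val hU)).symm
  have hbij := ConcreteCategory.bijective_of_isIso (q.normalizationObjIso hU).hom
  constructor
  · intro a b hab
    rw [hv, hv] at hab
    exact hbij.1 (Subtype.val_injective hab)
  · intro b
    have e : secPull q (V := q ⁻¹ᵁ U) le_rfl = (q.app U).hom := by
      rw [Scheme.Hom.app_eq_appLE]; rfl
    have hb' : (secPull q (V := q ⁻¹ᵁ U) le_rfl).IsIntegralElem b ↔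
        b ∈ integralClosure Γ(X, U) Γ(Y, q ⁻¹ᵁ U) := by
      rw [mem_integralClosure_iff, e]
      rfl
    rw [hb']
    constructor
    · intro hb
      obtain ⟨a, ha⟩ := hbij.2 ⟨b, hb⟩
      exact ⟨a, (hv a).trans (congrArg Subtype.val ha)⟩
    · rintro ⟨a, rfl⟩
      rw [hv]
      exact ((q.normalizationObjIso hU).hom a).2

end NormalizationSections

/-! ### The order of a unit along the special fibre -/

section Uniformizer

/-- Clearing the denominators of `b` and `b⁻¹` gives numerators whose product is a unit times a
power of `π`, and a divisor of a power of a prime is itself a unit times a power. The order `l - k`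
may be negative, so it is recorded by two exponents. -/
lemma exists_pow_mul_eq {R A C : Type*} [CommRing R] [IsDomain R] [IsDiscreteValuationRing R]
    [CommRing A] [IsDomain A] [CommRing C] (φ : R →+* A) (i : A →+* C)
    (hi : Function.Injective i) (hC : ∀ b, ∃ s, s ≠ 0 ∧ ∃ a, i a = i (φ s) * b) {π : R}
    (hπ : Irreducible π) (hp : IsUnit (φ π) ∨ Prime (φ π)) (b : Cˣ) :
    ∃ (u : Aˣ) (k l : ℕ), i (φ π) ^ k * b = i (φ π) ^ l * i u := by
  obtain ⟨s, hs, a, ha⟩ := hC b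
  obtain ⟨s', hs', a', ha'⟩ := hC (b⁻¹ : Cˣ)
  obtain ⟨n, w, rfl⟩ := IsDiscreteValuationRing.eq_unit_mul_pow_irreducible hs hπ
  obtain ⟨n', w', rfl⟩ := IsDiscreteValuationRing.eq_unit_mul_pow_irreducible hs' hπ
  let v : Aˣ := Units.map φ.toMonoidHom w
  let v' : Aˣ := Units.map φ.toMonoidHom w'
  have hv : φ w = v := rfl
  have hv' : φ w' = v' := rfl
  have haa : a * a' = (v * v' : Aˣ) * φ π ^ (n + n') := by
    apply hi
    rw [map_mul, ha, ha', mul_mul_mul_comm, b.mul_inv, mul_one, ← map_mul, ← map_mul φ,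
      mul_mul_mul_comm, ← pow_add, map_mul φ, map_mul φ, map_pow, hv, hv', Units.val_mul]
  rw [map_mul, map_pow, hv, map_mul, map_pow] at ha
  rcases hp with hp | hp
  · have hau : IsUnit a := isUnit_of_mul_isUnit_left (haa ▸ (v * v').isUnit.mul (hp.pow _))
    refine ⟨v⁻¹ * hau.unit, n, 0, ?_⟩
    rw [pow_zero, one_mul, Units.val_mul, map_mul, IsUnit.unit_spec, ha, ← mul_assoc, ← mul_assoc,
      ← map_mul, Units.inv_mul, map_one, one_mul]
  · have hd : a ∣ φ π ^ (n + n') := (Units.dvd_mul_left (u := v * v')).mp ⟨a', haa.symm⟩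
    obtain ⟨l, -, y, hy⟩ := (dvd_prime_pow hp _).mp hd
    refine ⟨v⁻¹ * y⁻¹, n, l, ?_⟩
    have e : a = φ π ^ l * (y⁻¹ : Aˣ) := by rw [← hy, mul_assoc, Units.mul_inv, mul_one]
    rw [e, map_mul, map_pow] at ha
    rw [Units.val_mul, map_mul, mul_left_comm, ha, ← mul_assoc, ← mul_assoc, ← map_mul,
      Units.inv_mul, map_one, one_mul]

variable {R : Type u} [CommRing R] [IsDomain R] [IsDiscreteValuationRing R]

lemma dvd_of_residue_eq_zero {π : R} (hπ : Irreducible π) (r : R)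
    (h : algebraMap R (IsLocalRing.ResidueField R) r = 0) : π ∣ r := by
  rw [IsLocalRing.ResidueField.algebraMap_eq, IsLocalRing.residue_eq_zero_iff,
    hπ.maximalIdeal_eq] at h
  exact Ideal.mem_span_singleton.mp h

lemma residue_irreducible {π : R} (hπ : Irreducible π) :
    algebraMap R (IsLocalRing.ResidueField R) π = 0 := by
  rw [IsLocalRing.ResidueField.algebraMap_eq, IsLocalRing.residue_eq_zero_iff,
    hπ.maximalIdeal_eq]
  exact Ideal.mem_span_singleton_self π

variable (X : Over (Spec (.of R))) (K : Type u) [Field K] [Algebra R K] [IsFractionRing R K]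

-- A function vanishing on the special fibre is divisible by `π`, and the functions on the integral
-- special fibre form a domain. If `U` misses the special fibre, `π` divides 1.
include K in
lemma isUnit_or_prime_evalSec [Flat X.hom]
    [IsIntegral ((baseChange R (IsLocalRing.ResidueField R)).obj X).left] {π : R}
    (hπ : Irreducible π) {U : X.left.Opens} (hU : IsAffineOpen U) [Nontrivial Γ(X.left, U)] :
    IsUnit (evalSec X.hom U π) ∨ Prime (evalSec X.hom U π) := by
  let k := IsLocalRing.ResidueField R
  let p := baseChangeProj k X
  have hdvd {a : Γ(X.left, U)} (ha : secPull p (V := p ⁻¹ᵁ U) le_rfl a = 0) :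
      evalSec X.hom U π ∣ a :=
    exists_mul_of_secPull_eq_zero X (dvd_of_residue_eq_zero hπ) IsLocalRing.residue_surjective hU ha
  have h0 : secPull p (V := p ⁻¹ᵁ U) le_rfl (evalSec X.hom U π) = 0 := by
    rw [secPull_evalSec_baseChange, residue_irreducible hπ, map_zero]
  by_cases hne : Nonempty (p ⁻¹ᵁ U)
  · by_cases hu : IsUnit (evalSec X.hom U π)
    · exact Or.inl hu
    · refine Or.inr ⟨fun h => ?_, hu, fun a b hab => ?_⟩
      · exact one_ne_zero (mul_evalSec_eq_zero X K hU hπ.ne_zero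
          (a := (1 : Γ(X.left, U))) (by rw [h, zero_mul]))
      · obtain ⟨c, hc⟩ := hab
        have h1 := congrArg (secPull p (V := p ⁻¹ᵁ U) le_rfl) hc
        rw [map_mul, map_mul, h0, zero_mul] at h1
        have : IsDomain Γ(((baseChange R k).obj X).left, p ⁻¹ᵁ U) := inferInstance
        exact (mul_eq_zero.mp h1).imp hdvd hdvd
  · left
    have hbot : p ⁻¹ᵁ U = ⊥ := by
      ext x
      exact ⟨fun hx => (hne ⟨x, hx⟩).elim, fun hx => hx.elim⟩
    have : Subsingleton Γ(((baseChange R k).obj X).left, p ⁻¹ᵁ U) := by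
      rw [hbot]; infer_instance
    exact isUnit_of_dvd_one (hdvd (Subsingleton.elim _ _))

end Uniformizer

/-! ### Use of the reduced special fibre of the normalization -/

section Reducedness

variable {R K : Type u} [CommRing R] [CommRing K] [Algebra R K] {X : Over (Spec (.of R))}
  {Y : Over (Spec (.of K))} (f : Y ⟶ (baseChange R K).obj X)

lemma hom_comp_specMap : (f.left ≫ baseChangeProj K X) ≫ X.hom = Y.hom ≫ specMap R K := by
  have h1 : baseChangeProj K X ≫ X.hom = ((baseChange R K).obj X).hom ≫ specMap R K :=
    pullback.condition
  rw [Category.assoc, h1, ← Category.assoc, Over.w]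

/-- Integral functions are the functions on the normalization. There `e ^ m` vanishes on the special
fibre, so `e` does by reducedness, and a function vanishing on the special fibre is divisible by
`π`. -/
lemma exists_integral_mul_eq [IsDomain R] [IsDiscreteValuationRing R] [IsNoetherian Y.left]
    (hred : IsReduced
      ((baseChange R (IsLocalRing.ResidueField R)).obj (normalizationIn f)).left)
    {π : R} (hπ : Irreducible π) {U : X.left.Opens} (hU : IsAffineOpen U)
    {e b : Γ(Y.left, (f.left ≫ baseChangeProj K X) ⁻¹ᵁ U)} {m : ℕ}
    (he : (secPull (f.left ≫ baseChangeProj K X)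
      (V := (f.left ≫ baseChangeProj K X) ⁻¹ᵁ U) le_rfl).IsIntegralElem e)
    (hb : (secPull (f.left ≫ baseChangeProj K X)
      (V := (f.left ≫ baseChangeProj K X) ⁻¹ᵁ U) le_rfl).IsIntegralElem b)
    (h : e ^ m = evalSec Y.hom _ (algebraMap R K π) * b) :
    ∃ c, (secPull (f.left ≫ baseChangeProj K X)
      (V := (f.left ≫ baseChangeProj K X) ⁻¹ᵁ U) le_rfl).IsIntegralElem c ∧
      e = evalSec Y.hom _ (algebraMap R K π) * c := by
  let N := normalizationIn f
  have hN : N.left = (f.left ≫ baseChangeProj K X).normalization := rfl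
  let q := f.left ≫ baseChangeProj K X
  let τ : Y.left ⟶ N.left := q.toNormalization
  let ν : N.left ⟶ X.left := q.fromNormalization
  have hτ : τ ≫ N.hom = Y.hom ≫ specMap R K := by
    rw [← hom_comp_specMap f]
    exact (Category.assoc _ _ _).symm.trans
      (congrArg (· ≫ X.hom) (Scheme.Hom.toNormalization_fromNormalization q))
  have hle : q ⁻¹ᵁ U ≤ τ ⁻¹ᵁ ν ⁻¹ᵁ U := by
    have : τ ≫ ν = q := Scheme.Hom.toNormalization_fromNormalization q
    rw [← Scheme.Hom.comp_preimage, this]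
  obtain ⟨hinj, hint⟩ := bijOn_secPull_toNormalization q hU hle
  have hint' : ∀ b, (secPull q (V := q ⁻¹ᵁ U) le_rfl).IsIntegralElem b ↔
        ∃ a, secPull τ hle a = b := hint
  have hinj' : Function.Injective (secPull τ hle) := hinj
  have hνa : IsAffineHom ν := inferInstanceAs (IsAffineHom q.fromNormalization)
  have hW : IsAffineOpen (ν ⁻¹ᵁ U) := hU.preimage ν
  obtain ⟨e', rfl⟩ := (hint' e).mp he
  obtain ⟨b', rfl⟩ := (hint' b).mp hb
  have hϖ : ∀ r, secPull τ hle (evalSec N.hom (ν ⁻¹ᵁ U) r) = evalSec Y.hom _ (algebraMap R K r) :=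
    fun r => (secPull_evalSec_comp hτ hle r).trans (evalSec_comp_specMap Y.hom _ _ r)
  have h' : e' ^ m = evalSec N.hom (ν ⁻¹ᵁ U) π * b' := by
    apply hinj'
    rw [map_pow, map_mul, hϖ]
    exact h
  have hz : secPull (baseChangeProj (IsLocalRing.ResidueField R) N) 
      (V := baseChangeProj (IsLocalRing.ResidueField R) N ⁻¹ᵁ ν ⁻¹ᵁ U) le_rfl e' = 0 := by
    have := hred.component_reduced
      (baseChangeProj (IsLocalRing.ResidueField R) N ⁻¹ᵁ ν ⁻¹ᵁ U)
    refine IsReduced.eq_zero _ ⟨m, ?_⟩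
    rw [← map_pow, h', map_mul, secPull_evalSec_baseChange, residue_irreducible hπ, map_zero,
      zero_mul]
  obtain ⟨c, hc⟩ := exists_mul_of_secPull_eq_zero N (dvd_of_residue_eq_zero hπ)
    IsLocalRing.residue_surjective hW hz
  refine ⟨secPull τ hle c, (hint' _).mpr ⟨c, rfl⟩, ?_⟩
  rw [hc, map_mul, hϖ]

end Reducedness

/-! ### Making the `m`-th power a unit -/

section RootExtraction

lemma isIntegralElem_of_pow {A C : Type*} [CommRing A] [CommRing C] (f : A →+* C) {c : C} {m : ℕ}
    (hm : 0 < m) (hc : f.IsIntegralElem (c ^ m)) : f.IsIntegralElem c := by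
  algebraize [f]
  exact IsIntegral.of_pow hm hc

/-- `A`, `B` and `C` stand for the functions on `U`, on its generic fibre and on the torsor above
it; `hn` is normality and `hr` comes from the reduced special fibre. A power of `π` reduces the
order `d` of `e ^ m` modulo `m`, and a nonzero remainder can only occur when `π` is invertible in
`A`. -/
lemma exists_zpow_mul_pow_eq {R A B C : Type*} [CommRing R] [IsDomain R]
    [IsDiscreteValuationRing R] [CommRing A] [IsDomain A] [CommRing B] [CommRing C] (φ : R →+* A)
    {i : A →+* B} (hi : Function.Injective i) (hB : ∀ b, ∃ s, s ≠ 0 ∧ ∃ a, i a = i (φ s) * b)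
    (hn : ∀ b, i.IsIntegralElem b → ∃ a, i a = b) {F : B →+* C} (hF : Function.Injective F) {π : R}
    (hπ : Irreducible π) (hp : IsUnit (φ π) ∨ Prime (φ π)) (ϖ : Bˣ) (hϖ : i (φ π) = ϖ) {m : ℕ}
    (hm : 0 < m)
    (hr : ∀ e b, (F.comp i).IsIntegralElem e → (F.comp i).IsIntegralElem b → e ^ m = F ϖ * b →
      ∃ c, (F.comp i).IsIntegralElem c ∧ e = F ϖ * c)
    (e : Cˣ) (b : Bˣ) (he : e ^ m = Units.map F.toMonoidHom b) :
    ∃ (n : ℤ) (u : Aˣ), ((Units.map F.toMonoidHom (ϖ ^ n) * e : Cˣ) : C) ^ m = F (i u) := by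
  obtain ⟨u, k, l, h⟩ := exists_pow_mul_eq φ i hi hB hπ hp b
  let ϖ' : Cˣ := Units.map F.toMonoidHom ϖ
  let v : Cˣ := Units.map (F.comp i).toMonoidHom u
  have h1 : ϖ' ^ k * e ^ m = ϖ' ^ l * v := by
    rw [he]
    ext
    have := congrArg F h
    simpa [hϖ, ϖ', v] using this
  set d : ℤ := l - k with hd
  have h2 : e ^ m = ϖ' ^ d * v := by
    rw [hd, zpow_sub, zpow_natCast, zpow_natCast, mul_right_comm, ← h1]
    rw [mul_comm (ϖ' ^ k), mul_assoc, mul_inv_cancel, mul_one]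
  obtain ⟨r, hr0⟩ : ∃ r : ℕ, d % m = r :=
    ⟨(d % m).toNat, (Int.toNat_of_nonneg (Int.emod_nonneg _ (by positivity))).symm⟩
  have hrm : r < m := by
    have := Int.emod_lt_of_pos d (b := m) (by positivity)
    omega
  have h3 : (ϖ' ^ (-(d / m)) * e) ^ m = ϖ' ^ r * v := by
    rw [mul_pow, h2, ← mul_assoc, ← zpow_natCast, ← zpow_mul, ← zpow_add, ← zpow_natCast, ← hr0]
    congr 2
    have := Int.emod_add_mul_ediv d m
    linarith
  have hint : ∀ a, (F.comp i).IsIntegralElem (F (i a)) := fun a => (F.comp i).isIntegralElem_map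
  obtain ⟨u', hu'⟩ : ∃ u' : Aˣ, (u' : A) = φ π ^ r * u := by
    rcases Nat.eq_zero_or_pos r with rfl | hrpos
    · exact ⟨u, by simp⟩
    -- For `r > 0` the corrected `e` is integral with `m`-th power divisible by `π`, so it equals `π
    -- c` with `c` integral.
    · suffices hunit : IsUnit (φ π) from ⟨hunit.unit ^ r * u, by simp⟩
      have h4 : (((ϖ' ^ (-(d / m)) * e : Cˣ) : C)) ^ m = F ϖ * F (i (φ π ^ (r - 1) * u)) := by
        have := congrArg Units.val h3
        rw [Units.val_pow_eq_pow_val] at this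
        rw [this, ← map_mul, ← hϖ, ← map_mul, ← mul_assoc, mul_pow_sub_one hrpos.ne']
        simp [ϖ', v, hϖ]
      obtain ⟨c, hc, hce⟩ := hr _ _ (isIntegralElem_of_pow _ hm (by
        rw [h4, ← hϖ, ← map_mul, ← map_mul]; exact hint _)) (hint _) h4
      -- Cancel in `π ^ m * c ^ m = π ^ r * u`; the exponent `m - r - 1` is a true difference
      -- because `r < m`.
      have h5 : F (↑ϖ⁻¹ : B) = c ^ m * F (i (φ π ^ (m - r - 1) * ↑u⁻¹)) := by
        have hm' : m = (r - 1) + 1 + ((m - r - 1) + 1) := by omega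
        have h6 : F ϖ ^ m * c ^ m = F ϖ ^ ((r - 1) + 1) * F (i u) := by
          rw [← mul_pow, ← hce, h4, map_mul, map_mul, map_pow, map_pow, hϖ]
          ring
        have hw : F ϖ * F (↑ϖ⁻¹ : B) = 1 := by rw [← map_mul, ϖ.mul_inv, map_one]
        have hv : F (i u) * F (i (↑u⁻¹ : A)) = 1 := by
          rw [← map_mul, ← map_mul, u.mul_inv, map_one, map_one]
        have hwm : F ϖ ^ m * F (↑ϖ⁻¹ : B) ^ m = 1 := by rw [← mul_pow, hw, one_pow]
        rw [map_mul, map_mul, map_pow, map_pow, hϖ]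
        generalize F ϖ = x at *
        generalize F (↑ϖ⁻¹ : B) = y at *
        generalize F (i u) = z at *
        generalize F (i (↑u⁻¹ : A)) = w at *
        calc y = y * (x ^ m * y ^ m) * (z * w) := by rw [hwm, hv]; ring
          _ = (x ^ ((r - 1) + 1) * z) * x ^ (m - r - 1) * w * y ^ m * (x * y) := by
            conv_lhs => rw [show x ^ m = x ^ ((r - 1) + 1 + ((m - r - 1) + 1)) from by rw [← hm']]
            ring
          _ = (x ^ m * y ^ m) * (c ^ m * (x ^ (m - r - 1) * w)) * (x * y) := by rw [← h6]; ring
          _ = _ := by rw [hwm, hw]; ring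
      -- Integrality of `ϖ⁻¹` over `A` is reflected by the injection `F`, and normality then puts
      -- `ϖ⁻¹` in `A`.
      obtain ⟨a, ha⟩ := hn _ (RingHom.IsIntegralElem.of_map hF
        (h5 ▸ RingHom.IsIntegralElem.mul _ (by
          have : (F.comp i).IsIntegralElem (c ^ m) := by
            algebraize [F.comp i]
            exact IsIntegral.pow hc m
          exact this) (hint _)))
      refine IsUnit.of_mul_eq_one a (hi ?_)
      rw [map_mul, ha, hϖ, ϖ.mul_inv, map_one]
  refine ⟨-(d / m), u', ?_⟩
  have := congrArg Units.val h3
  rw [Units.val_pow_eq_pow_val] at this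
  rw [map_zpow]
  refine this.trans ?_
  rw [hu', map_mul, map_mul, map_pow, map_pow, hϖ]
  simp [ϖ', v]

end RootExtraction

/-! ### Unit generators over neighbourhoods in `X` -/

section WeightUnits

lemma secPull_comp_secPull {X Y Z : Scheme.{u}} (f : X ⟶ Y) (g : Y ⟶ Z) (U : Z.Opens) :
    (secPull f (U := g ⁻¹ᵁ U) (V := (f ≫ g) ⁻¹ᵁ U) le_rfl).comp
      (secPull g (V := g ⁻¹ᵁ U) le_rfl) = secPull (f ≫ g) le_rfl :=
  RingHom.ext fun a => secPull_secPull f g le_rfl le_rfl a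

variable {R K : Type u} [CommRing R] [IsDomain R] [IsDiscreteValuationRing R] [Field K]
  [Algebra R K] [IsFractionRing R K] {X : Over (Spec (.of R))}

lemma nontrivial_sections {X : Scheme.{u}} {U : X.Opens} {x : X} (hx : x ∈ U) :
    Nontrivial Γ(X, U) :=
  (X.presheaf.germ U x hx).hom.domain_nontrivial

-- The ring embeds in the functions on the integral generic fibre; the part of that fibre over `U`
-- is non-empty because its ring of functions is nonzero.
omit [IsDiscreteValuationRing R] in
variable (K) in
lemma isDomain_sections [Flat X.hom] [IsIntegral ((baseChange R K).obj X).left]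
    {U : X.left.Opens} (hU : IsAffineOpen U) [Nontrivial Γ(X.left, U)] :
    IsDomain Γ(X.left, U) := by
  have hi := secPull_baseChangeProj_injective X K hU
  have hne : Nonempty ↥(baseChangeProj K X ⁻¹ᵁ U) := by
    by_contra h
    rw [not_nonempty_iff] at h
    have h2 : (baseChangeProj K X ⁻¹ᵁ U) = ⊥ := by
      ext z
      exact ⟨fun hz => (h.false ⟨z, hz⟩).elim, fun hz => hz.elim⟩
    have h3 : Subsingleton Γ(((baseChange R K).obj X).left, baseChangeProj K X ⁻¹ᵁ U) := by
      rw [h2]; infer_instance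
    exact not_subsingleton _ hi.subsingleton
  have := @IsIntegral.component_integral ((baseChange R K).obj X).left _
    (baseChangeProj K X ⁻¹ᵁ U) hne
  exact hi.isDomain _

variable {G D : Type u} [CommGroup G] [Fintype G] [CommGroup D] [Fintype D]
  (E : CharAction G D K) {Y : Over (Spec (.of K))} [ModObj (constGrp G K) Y]
  {f : Y ⟶ (baseChange R K).obj X} (hf : IsTorsor (constGrp G K) f)

omit [IsDomain R] [IsDiscreteValuationRing R] [IsFractionRing R K] in
include hf in
lemma IsTorsor.trans_proj (g : G) :
    (trans Y g).left ≫ f.left ≫ baseChangeProj K X = f.left ≫ baseChangeProj K X := by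
  rw [← Category.assoc, hf.trans_left]

/-- These are the local generators of the model. The unit supplied by the Picard hypothesis is
corrected by a power of the uniformizer, which is a constant of `K` and so does not change the
weight. -/
theorem IsTorsor.exists_root [Flat X.hom] [IsNormalScheme X.left]
    [IsIntegral ((baseChange R K).obj X).left]
    [IsIntegral ((baseChange R (IsLocalRing.ResidueField R)).obj X).left] [IsNoetherian Y.left]
    (hred : IsReduced
      ((baseChange R (IsLocalRing.ResidueField R)).obj (normalizationIn f)).left) {m : ℕ}
    (hPic : Set.SurjOn (Pic.map (baseChangeProj K X))
      (torsionPic m X.left) (torsionPic m ((baseChange R K).obj X).left))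
    (hm : 0 < m) (χ : D) (hχ : χ ^ m = 1) (x : X.left) :
    ∃ U : X.left.Opens, IsAffineOpen U ∧ x ∈ U ∧
      ∃ (e : Γ(Y.left, (f.left ≫ baseChangeProj K X) ⁻¹ᵁ U)ˣ) (u : Γ(X.left, U)ˣ),
        (secChar E hf.trans_proj U).IsWt χ e.val ∧
        e.val ^ m = secPull (f.left ≫ baseChangeProj K X) le_rfl u.val := by
  obtain ⟨π, hπ⟩ := IsDiscreteValuationRing.exists_irreducible R
  obtain ⟨U₀, hxU₀, e₀, he₀, hw₀⟩ :=
    hf.exists_unit_isWt_of_surjOn E (baseChangeProj K X) hPic hf.trans_proj χ hχ x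
  obtain ⟨U, hU, hxU, hUU⟩ := exists_affine_le hxU₀
  have : Nontrivial Γ(X.left, U) := nontrivial_sections hxU
  have : IsDomain Γ(X.left, U) := isDomain_sections K hU
  let q := f.left ≫ baseChangeProj K X
  let e : Γ(Y.left, q ⁻¹ᵁ U)ˣ := resUnit (q.preimage_mono hUU) he₀.unit
  have hw : (secChar E hf.trans_proj U).IsWt χ e.val := isWt_secRes hUU hw₀
  -- As `χ ^ m = 1`, the power `e ^ m` descends to a unit on the generic fibre of `U`.
  have hwm : (secChar E hf.trans_proj U).IsWt 1 (e ^ m).val := by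
    rw [Units.val_pow_eq_pow_val, ← hχ]
    exact hw.pow m
  obtain ⟨b, hb⟩ := hf.exists_pullUnit_eq E (U := baseChangeProj K X ⁻¹ᵁ U) (e ^ m) hwm
  have := hf.flat
  have := hf.surjective
  have := hf.locallyOfFinitePresentation
  let i : Γ(X.left, U) →+* Γ(((baseChange R K).obj X).left, baseChangeProj K X ⁻¹ᵁ U) :=
    secPull (baseChangeProj K X) le_rfl
  let F : Γ(((baseChange R K).obj X).left, baseChangeProj K X ⁻¹ᵁ U) →+* Γ(Y.left, q ⁻¹ᵁ U) :=
    secPull f.left le_rfl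
  have hF : Function.Injective F := secPull_injective_of_flat f.left (baseChangeProj K X ⁻¹ᵁ U)
  have hFi : F.comp i = secPull q le_rfl := secPull_comp_secPull f.left (baseChangeProj K X) U
  have hπ0 : algebraMap R K π ≠ 0 := by
    simpa using hπ.ne_zero
  let ϖ₀ : Kˣ := Units.mk0 _ hπ0
  let ϖ : Γ(((baseChange R K).obj X).left, baseChangeProj K X ⁻¹ᵁ U)ˣ :=
    Units.map (evalSec ((baseChange R K).obj X).hom _).toMonoidHom ϖ₀
  have hFK : ∀ k, F (evalSec ((baseChange R K).obj X).hom _ k) = evalSec Y.hom (q ⁻¹ᵁ U) k :=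
    fun k => secPull_evalSec_comp (Over.w f) _ k
  have hi : Function.Injective i := secPull_baseChangeProj_injective X K hU
  have hB : ∀ b, ∃ s : R, s ≠ 0 ∧ ∃ a, i a = i (evalSec X.hom U s) * b := fun b => by
    obtain ⟨s, hs, a, ha⟩ := exists_mul_eq_secPull X K hU b
    refine ⟨s, hs, a, ha.trans ?_⟩
    exact congrArg (· * b) (secPull_evalSec_baseChange X K le_rfl s).symm
  have hn : ∀ b, i.IsIntegralElem b → ∃ a, i a = b := exists_secPull_eq_of_isIntegralElem X K hU
  have hp : IsUnit (evalSec X.hom U π) ∨ Prime (evalSec X.hom U π) :=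
    isUnit_or_prime_evalSec X K hπ hU
  have hiϖ : i (evalSec X.hom U π) = ϖ := secPull_evalSec_baseChange X K le_rfl π
  have hϖ : F ϖ = evalSec Y.hom (q ⁻¹ᵁ U) (algebraMap R K π) := hFK _
  have hr : ∀ e b, (F.comp i).IsIntegralElem e → (F.comp i).IsIntegralElem b → e ^ m = F ϖ * b →
      ∃ c, (F.comp i).IsIntegralElem c ∧ e = F ϖ * c := by
    rw [hFi, hϖ]
    intro e b he hb h
    exact exists_integral_mul_eq f hred hπ hU he hb h
  have hb' : e ^ m = Units.map F.toMonoidHom b := hb.symm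
  obtain ⟨n, u, hu⟩ := exists_zpow_mul_pow_eq (evalSec X.hom U) hi hB hn hF hπ hp ϖ hiϖ hm hr e b hb'
  refine ⟨U, hU, hxU, Units.map F.toMonoidHom (ϖ ^ n) * e, u, ?_,
    hu.trans (congrArg (fun k => k u.val) hFi)⟩
  have h1 : (Units.map F.toMonoidHom (ϖ ^ n)).val =
      evalSec Y.hom (q ⁻¹ᵁ U) ((ϖ₀ ^ n : Kˣ) : K) := by
    rw [← hFK, ← map_zpow]
    rfl
  have h2 := CharAction.IsWt.mul (A := secChar E hf.trans_proj U) (χ := 1)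
    (a := (Units.map F.toMonoidHom (ϖ ^ n)).val) (by
      rw [h1]
      exact (isWt_one_secChar_iff E hf.trans_proj).mpr fun g => evalSec_trans hf.trans_proj U g _) hw
  rw [one_mul] at h2
  exact h2

end WeightUnits

/-! ### Group-like functions and diagonalizable groups -/

section GroupLike

variable {R A : Type u} [CommRing R] [CommRing A]

/-- Points are multiplied by composing with the comultiplication, which sends a group-like `a` to `a
⊗ a`. -/
lemma evalSec_hom_mul [Bialgebra R A] {T : Over (Spec (.of R))}
    (s t : T ⟶ (Spec (.of A)).asOver (Spec (.of R))) {a : A} (ha : IsGroupLikeElem R a)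
    (V : T.left.Opens) :
    evalSec (s * t).left V a = evalSec s.left V a * evalSec t.left V a := by
  -- The pair `(s, t)` as a point of the spectrum of `A ⊗ A`.
  let σ : T.left ⟶ Spec (.of (A ⊗[R] A)) := (lift s t).left ≫ (pullbackSpecIso R A A).hom
  have h1 : σ ≫ Spec.map (CommRingCat.ofHom Algebra.TensorProduct.includeLeftRingHom) =
      s.left := by
    have e : (pullbackSpecIso R A A).hom ≫
        Spec.map (CommRingCat.ofHom Algebra.TensorProduct.includeLeftRingHom) =
        pullback.fst (specMap R A) (specMap R A) := pullbackSpecIso_hom_fst R A A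
    have e' : (lift s t).left ≫ (fst ((Spec (.of A)).asOver (Spec (.of R)))
        ((Spec (.of A)).asOver (Spec (.of R)))).left = s.left :=
      congrArg (fun k => k.left) (lift_fst s t)
    exact (Category.assoc _ _ _).trans ((congrArg ((lift s t).left ≫ ·) e).trans e')
  have h2 : σ ≫ Spec.map (CommRingCat.ofHom
      (Algebra.TensorProduct.includeRight : A →ₐ[R] A ⊗[R] A).toRingHom) = t.left := by
    have e : (pullbackSpecIso R A A).hom ≫ Spec.map (CommRingCat.ofHom
        (Algebra.TensorProduct.includeRight : A →ₐ[R] A ⊗[R] A).toRingHom) =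
        pullback.snd (specMap R A) (specMap R A) := pullbackSpecIso_hom_snd R A A
    have e' : (lift s t).left ≫ (snd ((Spec (.of A)).asOver (Spec (.of R)))
        ((Spec (.of A)).asOver (Spec (.of R)))).left = t.left :=
      congrArg (fun k => k.left) (lift_snd s t)
    exact (Category.assoc _ _ _).trans ((congrArg ((lift s t).left ≫ ·) e).trans e')
  have h3 : (s * t).left = σ ≫ Spec.map (CommRingCat.ofHom
      (Bialgebra.comulAlgHom R A).toRingHom) :=
    (congrArg (fun k => k.left) (Hom.mul_def s t)).trans (Category.assoc _ _ _).symm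
  have h4 : (Bialgebra.comulAlgHom R A).toRingHom a =
      Algebra.TensorProduct.includeLeftRingHom a *
        (Algebra.TensorProduct.includeRight : A →ₐ[R] A ⊗[R] A).toRingHom a := by
    refine ha.comul_eq_tmul_self.trans ?_
    simp
  rw [h3, evalSec_comp_specMap, h4, map_mul, ← evalSec_comp_specMap, ← evalSec_comp_specMap, h1, h2]

end GroupLike

section DiagonalizableGroup

variable (R D : Type u) [CommRing R] [CommGroup D]

/-- The diagonalizable group scheme with character group `D`. -/
abbrev diagGrp : Over (Spec (.of R)) :=
  (Spec (.of (MonoidAlgebra R D))).asOver (Spec (.of R))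

variable {R D}

/-- The value of a character at a point of a diagonalizable group scheme. -/
def chr {T : Over (Spec (.of R))} (t : T ⟶ diagGrp R D) (V : T.left.Opens) : D →* Γ(T.left, V) :=
  (evalSec t.left V : MonoidAlgebra R D →* Γ(T.left, V)).comp (MonoidAlgebra.of R D)

variable {T T' : Over (Spec (.of R))}

lemma secPull_chr (f : T' ⟶ T) (t : T ⟶ diagGrp R D) {V : T.left.Opens} {W : T'.left.Opens}
    (h : W ≤ f.left ⁻¹ᵁ V) (χ : D) : secPull f.left h (chr t V χ) = chr (f ≫ t) W χ :=
  secPull_evalSec f.left t.left h _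

lemma secRes_chr (t : T ⟶ diagGrp R D) {V W : T.left.Opens} (h : W ≤ V) (χ : D) :
    secRes h (chr t V χ) = chr t W χ :=
  secRes_evalSec t.left h _

lemma chr_mul (s t : T ⟶ diagGrp R D) (V : T.left.Opens) (χ : D) :
    chr (s * t) V χ = chr s V χ * chr t V χ :=
  evalSec_hom_mul s t (MonoidAlgebra.isGroupLikeElem_of χ) V

lemma chr_one (V : T.left.Opens) (χ : D) : chr (1 : T ⟶ diagGrp R D) V χ = 1 := by
  have h := chr_mul (1 : T ⟶ diagGrp R D) 1 V χ
  rw [mul_one] at h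
  have hu : IsUnit (chr (1 : T ⟶ diagGrp R D) V χ) := (Group.isUnit χ).map _
  exact hu.mul_eq_left.mp h.symm

lemma evalSec_algebraMap {A : Type u} [CommRing A] [Algebra R A]
    (t : T ⟶ (Spec (.of A)).asOver (Spec (.of R))) (V : T.left.Opens)
    (r : R) : evalSec t.left V (algebraMap R A r) = evalSec T.hom V r := by
  have h : t.left ≫ Spec.map (CommRingCat.ofHom (algebraMap R A)) = T.hom := Over.w t
  exact (evalSec_comp_specMap t.left (algebraMap R A) V r).symm.trans
    (congrArg (fun k => evalSec k V r) h)

lemma diagGrp_hom_ext {s t : T ⟶ diagGrp R D} (h : ∀ χ, chr s ⊤ χ = chr t ⊤ χ) : s = t := by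
  refine Over.OverMorphism.ext (evalSec_inj fun a => ?_)
  have : (evalSec s.left ⊤ : MonoidAlgebra R D →+* Γ(T.left, ⊤)) = evalSec t.left ⊤ :=
    MonoidAlgebra.ringHom_ext (fun r => by
      have := (evalSec_algebraMap s ⊤ r).trans (evalSec_algebraMap t ⊤ r).symm
      simpa [MonoidAlgebra.algebraMap_def] using this) h
  exact congrArg (fun k => k a) this

/-- With `diagGrp_hom_ext` this identifies `T`-points with homomorphisms from `D` to functions on
`T`; the values are units automatically, `D` being a group. -/
lemma exists_diagGrp_hom (c : D →* Γ(T.left, ⊤)) : ∃ t : T ⟶ diagGrp R D, ∀ χ, chr t ⊤ χ = c χ := by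
  let _ : Algebra R Γ(T.left, ⊤) := (evalSec T.hom ⊤).toAlgebra
  obtain ⟨t, ht⟩ := evalSec_surj (MonoidAlgebra.lift R _ D c).toRingHom
  refine ⟨Over.homMk t (evalSec_inj fun r => ?_), fun χ => ?_⟩
  · refine (evalSec_comp_specMap t (algebraMap R (MonoidAlgebra R D)) ⊤ r).trans ?_
    rw [ht]
    exact (MonoidAlgebra.lift R _ D c).commutes r
  · refine (congrArg (fun k => k (MonoidAlgebra.of R D χ)) ht).trans ?_
    exact MonoidAlgebra.lift_of _ _

end DiagonalizableGroup

/-! ### Gradings with invertible components and the torsors they define -/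

/-- A grading of the direct image of `𝒪_Y` along `f : Y ⟶ X` by a finite abelian group `D`, such
that the component of degree `1` is `𝒪_X` and every component is locally generated by a unit. -/
structure Grading {Y X : Scheme.{u}} (f : Y ⟶ X) (D : Type u) [CommGroup D] [Fintype D] where
  /-- the homogeneous sections -/
  wt : ∀ U : X.Opens, D → Γ(Y, f ⁻¹ᵁ U) → Prop
  /-- the homogeneous components -/
  comp : ∀ U : X.Opens, D → Γ(Y, f ⁻¹ᵁ U) → Γ(Y, f ⁻¹ᵁ U)
  wt_comp : ∀ {U}, IsAffineOpen U → ∀ χ a, wt U χ (comp U χ a)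
  comp_self : ∀ {U}, IsAffineOpen U → ∀ {χ a}, wt U χ a → comp U χ a = a
  comp_ne : ∀ {U}, IsAffineOpen U → ∀ {χ ψ a}, wt U χ a → ψ ≠ χ → comp U ψ a = 0
  comp_add : ∀ {U}, IsAffineOpen U → ∀ χ a b, comp U χ (a + b) = comp U χ a + comp U χ b
  sum_comp : ∀ {U}, IsAffineOpen U → ∀ a, ∑ χ, comp U χ a = a
  wt_mul : ∀ {U}, IsAffineOpen U → ∀ {χ ψ a b}, wt U χ a → wt U ψ b → wt U (χ * ψ) (a * b)
  wt_res : ∀ {U V} (h : V ≤ U), IsAffineOpen U → IsAffineOpen V → ∀ {χ a}, wt U χ a →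
    wt V χ (secRes (f.preimage_mono h) a)
  wt_one_iff : ∀ {U}, IsAffineOpen U → ∀ {a}, wt U 1 a ↔ ∃ r, secPull f le_rfl r = a
  secPull_injective : ∀ {U}, IsAffineOpen U → Function.Injective
    (secPull f (U := U) (V := f ⁻¹ᵁ U) le_rfl)
  exists_unit : ∀ x χ, ∃ U, IsAffineOpen U ∧ x ∈ U ∧ ∃ e, wt U χ e ∧ IsUnit e

namespace Grading

variable {Y X : Scheme.{u}} {f : Y ⟶ X} {D : Type u} [CommGroup D] [Fintype D] (A : Grading f D)

/-- In `1 = ∑ b_ψ a` only `ψ = χ⁻¹` contributes to the trivial degree, so the component of `b` of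
degree `χ⁻¹` is already an inverse of `a`. -/
lemma wt_inv {U : X.Opens} (hU : IsAffineOpen U) {χ : D} {a b : Γ(Y, f ⁻¹ᵁ U)} (ha : A.wt U χ a)
    (h : a * b = 1) : A.wt U χ⁻¹ b := by
  classical
  have h1 : A.wt U 1 (1 : Γ(Y, f ⁻¹ᵁ U)) := (A.wt_one_iff hU).mpr ⟨1, map_one _⟩
  have h2 : ∑ ψ, A.comp U ψ b * a = 1 := by
    rw [← Finset.sum_mul, A.sum_comp hU, mul_comm, h]
  have h3 : ∀ s : Finset D, A.comp U 1 (∑ ψ ∈ s, A.comp U ψ b * a) =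
      ∑ ψ ∈ s, A.comp U 1 (A.comp U ψ b * a) := fun s => by
    let c : Γ(Y, f ⁻¹ᵁ U) →+ Γ(Y, f ⁻¹ᵁ U) := AddMonoidHom.mk' (A.comp U 1) (A.comp_add hU 1)
    exact map_sum c _ _
  have h4 := h3 Finset.univ
  rw [h2, A.comp_self hU h1, Finset.sum_eq_single χ⁻¹] at h4
  · have h5 := A.comp_self hU (A.wt_mul hU (A.wt_comp hU χ⁻¹ b) ha)
    rw [inv_mul_cancel] at h5
    rw [h5] at h4
    have h6 : b = A.comp U χ⁻¹ b := by
      calc b = (A.comp U χ⁻¹ b * a) * b := by rw [← h4, one_mul]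
        _ = _ := by rw [mul_assoc, h, mul_one]
    rw [h6]
    exact A.wt_comp hU _ _
  · intro ψ _ hψ
    refine A.comp_ne hU (A.wt_mul hU (A.wt_comp hU ψ b) ha) fun h => hψ ?_
    exact eq_inv_of_mul_eq_one_left h.symm
  · simp

variable {T : Scheme.{u}}

/-- The action of a character `c` on a point of `Y` gives the point `h` of `Y`. -/
def IsAct (c : D →* Γ(T, ⊤)) (y h : T ⟶ Y) : Prop :=
  ∀ U, IsAffineOpen U → ∀ χ a, A.wt U χ a → ∀ (W : T.Opens) (h1 : W ≤ h ⁻¹ᵁ f ⁻¹ᵁ U)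
    (h2 : W ≤ y ⁻¹ᵁ f ⁻¹ᵁ U), secPull h h1 a = secRes le_top (c χ) * secPull y h2 a

lemma ext_of_isAct [IsAffineHom f] {c : D →* Γ(T, ⊤)} {y h h' : T ⟶ Y} (e : h ≫ f = y ≫ f)
    (e' : h' ≫ f = y ≫ f) (H : A.IsAct c y h) (H' : A.IsAct c y h') : h = h' := by
  refine hom_ext_of_affine f fun x => ?_
  obtain ⟨U, hU, hx, -⟩ := exists_affine_le (V := ⊤) (x := f (y x)) trivial
  have hh : (y ≫ f) ⁻¹ᵁ U ≤ h ⁻¹ᵁ f ⁻¹ᵁ U := by rw [← e]; rfl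
  have hh' : (y ≫ f) ⁻¹ᵁ U ≤ h' ⁻¹ᵁ f ⁻¹ᵁ U := by rw [← e']; rfl
  refine ⟨U, hU, (y ≫ f) ⁻¹ᵁ U, hx, hh, hh', fun s => ?_⟩
  rw [← A.sum_comp hU s, map_sum, map_sum]
  refine Finset.sum_congr rfl fun χ _ => ?_
  rw [H U hU χ _ (A.wt_comp hU χ s) _ hh le_rfl, H' U hU χ _ (A.wt_comp hU χ s) _ hh' le_rfl]

variable (c : D →* Γ(T, ⊤)) (y : T ⟶ Y) {W : T.Opens}

/-- The comorphism of the action of a character on a point of `Y`. -/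
def actFun {U : X.Opens} (hW : W ≤ y ⁻¹ᵁ f ⁻¹ᵁ U) (a : Γ(Y, f ⁻¹ᵁ U)) : Γ(T, W) :=
  ∑ χ, secRes le_top (c χ) * secPull y hW (A.comp U χ a)

variable {U : X.Opens} (hW : W ≤ y ⁻¹ᵁ f ⁻¹ᵁ U) (hU : IsAffineOpen U)

include hU in
lemma actFun_of_wt {χ : D} {a : Γ(Y, f ⁻¹ᵁ U)} (ha : A.wt U χ a) :
    A.actFun c y hW a = secRes le_top (c χ) * secPull y hW a := by
  rw [actFun, Finset.sum_eq_single χ, A.comp_self hU ha]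
  · intro ψ _ hψ
    rw [A.comp_ne hU ha hψ, map_zero, mul_zero]
  · simp

/-- The comorphism of the action as an additive map. -/
def actAdd : Γ(Y, f ⁻¹ᵁ U) →+ Γ(T, W) :=
  AddMonoidHom.mk' (A.actFun c y hW) fun a b => by
    simp only [actFun, A.comp_add hU, map_add, mul_add, Finset.sum_add_distrib]

lemma actAdd_of_wt {χ : D} {a : Γ(Y, f ⁻¹ᵁ U)} (ha : A.wt U χ a) :
    A.actAdd c y hW hU a = secRes le_top (c χ) * secPull y hW a :=
  A.actFun_of_wt c y hW hU ha

/-- The comorphism of the action as a ring homomorphism. -/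
def actHom : Γ(Y, f ⁻¹ᵁ U) →+* Γ(T, W) where
  __ := A.actAdd c y hW hU
  map_one' := by
    refine (A.actAdd_of_wt c y hW hU ((A.wt_one_iff hU).mpr ⟨1, map_one _⟩)).trans ?_
    rw [map_one, map_one, map_one, mul_one]
  map_mul' a b := by
    change A.actAdd c y hW hU (a * b) = A.actAdd c y hW hU a * A.actAdd c y hW hU b
    conv_lhs => rw [← A.sum_comp hU a, ← A.sum_comp hU b]
    conv_rhs => rw [← A.sum_comp hU a, ← A.sum_comp hU b]
    rw [Finset.sum_mul_sum, map_sum, map_sum, map_sum, Finset.sum_mul_sum]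
    refine Finset.sum_congr rfl fun χ _ => ?_
    rw [map_sum]
    refine Finset.sum_congr rfl fun ψ _ => ?_
    have h1 := A.wt_comp hU χ a
    have h2 := A.wt_comp hU ψ b
    rw [A.actAdd_of_wt c y hW hU h1, A.actAdd_of_wt c y hW hU h2,
      A.actAdd_of_wt c y hW hU (A.wt_mul hU h1 h2), map_mul, map_mul, map_mul]
    ring

lemma actHom_of_wt {χ : D} {a : Γ(Y, f ⁻¹ᵁ U)} (ha : A.wt U χ a) :
    A.actHom c y hW hU a = secRes le_top (c χ) * secPull y hW a :=
  A.actFun_of_wt c y hW hU ha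

lemma actHom_secPull (h : W ≤ (y ≫ f) ⁻¹ᵁ U) (r : Γ(X, U)) :
    A.actHom c y hW hU (secPull f le_rfl r) = secPull (y ≫ f) h r := by
  rw [A.actHom_of_wt c y hW hU ((A.wt_one_iff hU).mpr ⟨r, rfl⟩), map_one, map_one, one_mul]
  exact secPull_secPull y f le_rfl hW r

lemma secRes_actHom {V : X.Opens} (hV : IsAffineOpen V) (hVU : V ≤ U) {W' : T.Opens} (h : W' ≤ W)
    (hW' : W' ≤ y ⁻¹ᵁ f ⁻¹ᵁ V) (a : Γ(Y, f ⁻¹ᵁ U)) :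
    secRes h (A.actHom c y hW hU a) = A.actHom c y hW' hV (secRes (f.preimage_mono hVU) a) := by
  rw [← A.sum_comp hU a, map_sum, map_sum, map_sum, map_sum]
  refine Finset.sum_congr rfl fun χ _ => ?_
  have h1 := A.wt_comp hU χ a
  rw [A.actHom_of_wt c y hW hU h1, A.actHom_of_wt c y hW' hV (A.wt_res hVU hU hV h1), map_mul,
    secRes_secRes, secRes_secPull, secPull_secRes]

/-- Scaling the degree `χ` by `c χ` is a ring homomorphism because `c` is multiplicative, and these
homomorphisms glue since `f` is affine. -/
lemma exists_isAct [IsAffineHom f] : ∃ h : T ⟶ Y, h ≫ f = y ≫ f ∧ A.IsAct c y h := by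
  have hle (U) : (y ≫ f) ⁻¹ᵁ U ≤ y ⁻¹ᵁ f ⁻¹ᵁ U := le_rfl
  obtain ⟨h, e, H⟩ := exists_hom_of_affine f (y ≫ f) (fun U hU => A.actHom c y (hle U) hU)
    (fun U hU a => A.actHom_secPull c y (hle U) hU le_rfl a)
    (fun U V hU hV hVU r _ a => A.secRes_actHom c y (hle U) hU hV hVU _ (hle V) a)
  refine ⟨h, e, fun U hU χ a ha W h1 h2 => ?_⟩
  have h2' : W ≤ (y ≫ f) ⁻¹ᵁ U := h2
  have h3 := congrArg (secRes h2') ((H U hU a).trans (A.actHom_of_wt c y (hle U) hU ha))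
  rw [map_mul, secRes_secRes, secRes_secPull] at h3
  exact h3.trans (congrArg (secRes le_top (c χ) * ·) (secRes_secPull y _ _ _))

variable {a b : T ⟶ Y} (e : a ≫ f = b ≫ f)

include e in
lemma secPull_secPull_eq {U : X.Opens} {W : T.Opens} (h1 : W ≤ a ⁻¹ᵁ f ⁻¹ᵁ U)
    (h2 : W ≤ b ⁻¹ᵁ f ⁻¹ᵁ U) (r : Γ(X, U)) :
    secPull a h1 (secPull f le_rfl r) = secPull b h2 (secPull f le_rfl r) :=
  (secPull_comp e le_rfl h1 h2 r).trans (secPull_comp rfl le_rfl h2 h2 r).symm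

variable (a b) in
/-- The sections of degree `χ` on the points `a` and `b` differ by the factor `t` over `W`. -/
def IsFactor (W : T.Opens) (χ : D) (t : Γ(T, W)) : Prop :=
  ∀ U, IsAffineOpen U → ∀ s, A.wt U χ s → ∀ (W' : T.Opens) (h : W' ≤ W) (h1 : W' ≤ a ⁻¹ᵁ f ⁻¹ᵁ U)
    (h2 : W' ≤ b ⁻¹ᵁ f ⁻¹ᵁ U), secPull a h1 s = secRes h t * secPull b h2 s

-- It suffices to test one unit generator of degree `χ` near each point: any other section of degree
-- `χ` is this generator times a function from `X`, on which `a` and `b` agree.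
include e in
lemma isFactor_of_local {W : T.Opens} {χ : D} {t : Γ(T, W)}
    (H : ∀ x ∈ W, ∃ U, IsAffineOpen U ∧ ∃ s, A.wt U χ s ∧ IsUnit s ∧ ∃ (W' : T.Opens) (_ : x ∈ W')
      (h : W' ≤ W) (h1 : W' ≤ a ⁻¹ᵁ f ⁻¹ᵁ U) (h2 : W' ≤ b ⁻¹ᵁ f ⁻¹ᵁ U),
      secPull a h1 s = secRes h t * secPull b h2 s) : A.IsFactor a b W χ t := by
  intro U₀ hU₀ s₀ hs₀ W₀ hW₀ h1 h2
  refine sec_ext fun x hx => ?_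
  obtain ⟨U, hU, s, hs, hsu, W', hx', h', h1', h2', H'⟩ := H x (hW₀ hx)
  obtain ⟨V, hV, hxV, hVU⟩ := exists_affine_le (V := U ⊓ U₀) (x := f (b x)) ⟨h2' hx', h2 hx⟩
  have hVU₁ : V ≤ U := hVU.trans inf_le_left
  have hVU₀ : V ≤ U₀ := hVU.trans inf_le_right
  have hsV := A.wt_res hVU₁ hU hV hs
  have hs₀V := A.wt_res hVU₀ hU₀ hV hs₀
  obtain ⟨v, hv⟩ := (hsu.map (secRes (f.preimage_mono hVU₁))).exists_right_inv
  have hm := A.wt_mul hV hs₀V (A.wt_inv hV hsV hv)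
  rw [mul_inv_cancel, A.wt_one_iff hV] at hm
  obtain ⟨r, hr⟩ := hm
  have hr' : secRes (f.preimage_mono hVU₀) s₀ =
      secPull f le_rfl r * secRes (f.preimage_mono hVU₁) s := by
    rw [hr, mul_assoc, mul_comm v, hv, mul_one]
  let N : T.Opens := W₀ ⊓ W' ⊓ b ⁻¹ᵁ f ⁻¹ᵁ V
  have hNW₀ : N ≤ W₀ := inf_le_left.trans inf_le_left
  have hNW' : N ≤ W' := inf_le_left.trans inf_le_right
  have hNb : N ≤ b ⁻¹ᵁ f ⁻¹ᵁ V := inf_le_right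
  have hNa : N ≤ a ⁻¹ᵁ f ⁻¹ᵁ V := by
    have h3 : N ≤ (a ≫ f) ⁻¹ᵁ V := by rw [e]; exact hNb
    exact h3
  refine ⟨N, ⟨⟨hx, hx'⟩, hxV⟩, hNW₀, ?_⟩
  have H'' := congrArg (secRes hNW') H'
  rw [map_mul, secRes_secRes, secRes_secPull, secRes_secPull,
    ← secPull_secRes a hNa (f.preimage_mono hVU₁), ← secPull_secRes b hNb (f.preimage_mono hVU₁)]
    at H''
  rw [map_mul, secRes_secRes, secRes_secPull, secRes_secPull,
    ← secPull_secRes a hNa (f.preimage_mono hVU₀), ← secPull_secRes b hNb (f.preimage_mono hVU₀),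
    hr', map_mul, map_mul, H'', secPull_secPull_eq e hNa hNb]
  ring

include e in
lemma exists_unit_near (x : T) (χ : D) : ∃ U, IsAffineOpen U ∧ f (b x) ∈ U ∧ ∃ s, A.wt U χ s ∧
    IsUnit s ∧ (b ≫ f) ⁻¹ᵁ U ≤ a ⁻¹ᵁ f ⁻¹ᵁ U ∧ (b ≫ f) ⁻¹ᵁ U ≤ b ⁻¹ᵁ f ⁻¹ᵁ U := by
  obtain ⟨U, hU, hx, s, hs, hsu⟩ := A.exists_unit (f (b x)) χ
  exact ⟨U, hU, hx, s, hs, hsu, by rw [← e]; rfl, le_rfl⟩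

include e in
lemma IsFactor.unique {W : T.Opens} {χ : D} {t t' : Γ(T, W)} (h : A.IsFactor a b W χ t)
    (h' : A.IsFactor a b W χ t') : t = t' := by
  refine sec_ext fun x hx => ?_
  obtain ⟨U, hU, hxU, s, hs, hsu, h1, h2⟩ := A.exists_unit_near e x χ
  refine ⟨W ⊓ (b ≫ f) ⁻¹ᵁ U, ⟨hx, hxU⟩, inf_le_left, ?_⟩
  refine (hsu.map (secPull b (inf_le_right.trans h2))).mul_left_injective ?_
  exact (h U hU s hs _ inf_le_left (inf_le_right.trans h1) _).symm.trans
    (h' U hU s hs _ inf_le_left _ _)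

-- Locally the factor is the quotient of the pullbacks of a unit generator along `a` and `b`;
-- uniqueness makes these quotients glue.
include e in
lemma exists_isFactor (χ : D) : ∃ t, A.IsFactor a b ⊤ χ t := by
  choose U hU hxU s hs hsu h1 h2 using fun x => A.exists_unit_near e x χ
  have hloc : ∀ x, ∃ t, A.IsFactor a b ((b ≫ f) ⁻¹ᵁ U x) χ t := fun x => by
    obtain ⟨v, hv⟩ := ((hsu x).map (secPull b (h2 x))).exists_right_inv
    refine ⟨secPull a (h1 x) (s x) * v, A.isFactor_of_local e fun z hz =>
      ⟨U x, hU x, s x, hs x, hsu x, _, hz, le_rfl, h1 x, h2 x, ?_⟩⟩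
    rw [secRes_self, mul_assoc, mul_comm v, hv, mul_one]
  choose t ht using hloc
  have hmono : ∀ (W W' : T.Opens) (h : W' ≤ W) (t : Γ(T, W)), A.IsFactor a b W χ t →
      A.IsFactor a b W' χ (secRes h t) := fun W W' h t ht U hU s hs V hV h1 h2 => by
    rw [secRes_secRes]
    exact ht U hU s hs V _ h1 h2
  obtain ⟨τ, hτ⟩ := sec_glue (V := ⊤) (fun x : ULift.{u} T => (b ≫ f) ⁻¹ᵁ U x.down)
    (fun _ => le_top) (fun x _ => ⟨⟨x⟩, hxU x⟩) (fun x => t x.down) fun i j x hi hj =>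
      ⟨_ ⊓ _, ⟨hi, hj⟩, inf_le_left, inf_le_right,
        IsFactor.unique A e (hmono _ _ _ _ (ht _)) (hmono _ _ _ _ (ht _))⟩
  refine ⟨τ, A.isFactor_of_local e fun x _ =>
    ⟨U x, hU x, s x, hs x, hsu x, _, hxU x, le_top, h1 x, h2 x, ?_⟩⟩
  rw [hτ ⟨x⟩]
  refine (ht x _ (hU x) _ (hs x) _ le_rfl (h1 x) (h2 x)).trans ?_
  rw [secRes_self]

include e in
lemma IsFactor.mul {χ ψ : D} {t t' : Γ(T, ⊤)} (h : A.IsFactor a b ⊤ χ t)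
    (h' : A.IsFactor a b ⊤ ψ t') : A.IsFactor a b ⊤ (χ * ψ) (t * t') := by
  refine A.isFactor_of_local e fun x hx => ?_
  obtain ⟨U, hU, hxU, s, hs, hsu, h1, h2⟩ := A.exists_unit_near e x χ
  obtain ⟨U', hU', hxU', s', hs', hsu', h1', h2'⟩ := A.exists_unit_near e x ψ
  obtain ⟨V, hV, hxV, hVU⟩ := exists_affine_le (V := U ⊓ U') (x := f (b x)) ⟨hxU, hxU'⟩
  have hsV := A.wt_res (hVU.trans inf_le_left) hU hV hs
  have hsV' := A.wt_res (hVU.trans inf_le_right) hU' hV hs'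
  have hb : (b ≫ f) ⁻¹ᵁ V ≤ b ⁻¹ᵁ f ⁻¹ᵁ V := le_rfl
  have ha : (b ≫ f) ⁻¹ᵁ V ≤ a ⁻¹ᵁ f ⁻¹ᵁ V := by rw [← e]; rfl
  refine ⟨V, hV, _, A.wt_mul hV hsV hsV', (hsu.map _).mul (hsu'.map _), _, hxV, le_top, ha, hb, ?_⟩
  rw [map_mul, map_mul, map_mul, h V hV _ hsV _ le_top ha hb, h' V hV _ hsV' _ le_top ha hb]
  ring

include e in
/-- Two points of `Y` over the same point of `X` differ by a character. -/
lemma exists_char : ∃ c : D →* Γ(T, ⊤), A.IsAct c b a := by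
  choose t ht using A.exists_isFactor e
  have h1 : A.IsFactor a b ⊤ 1 (1 : Γ(T, ⊤)) := fun U hU s hs W _ h1 h2 => by
    obtain ⟨r, rfl⟩ := (A.wt_one_iff hU).mp hs
    rw [map_one, one_mul, secPull_secPull_eq e h1 h2]
  exact ⟨{ toFun := t
           map_one' := IsFactor.unique A e (ht 1) h1
           map_mul' := fun χ ψ => IsFactor.unique A e (ht (χ * ψ)) (IsFactor.mul A e (ht χ) (ht ψ)) },
    fun U hU χ s hs W h1 h2 => ht χ U hU s hs W le_top h1 h2⟩

include e in
/-- The character that acts on a given point is determined by the effect of the action. -/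
lemma char_unique {c c' : D →* Γ(T, ⊤)} (h : A.IsAct c b a) (h' : A.IsAct c' b a) :
    c = c' :=
  MonoidHom.ext fun χ => IsFactor.unique A e
    (fun U hU s hs W _ h1 h2 => h U hU χ s hs W h1 h2)
    fun U hU s hs W _ h1 h2 => h' U hU χ s hs W h1 h2

end Grading

/-! ### The underlying algebra is free of rank `|D|` -/

section FreeExtension

/-- The `e χ` form a basis, so `C` is finite free. `D` is non-empty, so `φ` is injective, and a
finite injective homomorphism is surjective on spectra. -/
lemma flat_and_finitePresentation_of_basis {A C D : Type u} [CommRing A] [CommRing C] [Fintype D]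
    [Nonempty D] (φ : A →+* C) (e : D → C) (hinj : ∀ r : D → A, ∑ χ, φ (r χ) * e χ = 0 → r = 0)
    (hsurj : ∀ c, ∃ r : D → A, ∑ χ, φ (r χ) * e χ = c) :
    φ.Flat ∧ φ.FinitePresentation ∧ Function.Surjective (PrimeSpectrum.comap φ) := by
  algebraize [φ]
  let l : (D → A) →ₗ[A] C := Fintype.linearCombination A e
  have hl : ∀ r, l r = ∑ χ, φ (r χ) * e χ := fun r => by
    rw [Fintype.linearCombination_apply]
    exact Finset.sum_congr rfl fun χ _ => Algebra.smul_def _ _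
  let l' : (D → A) ≃ₗ[A] C := LinearEquiv.ofBijective l
    ⟨(injective_iff_map_eq_zero l).mpr fun r h => hinj r ((hl r).symm.trans h), fun c => by
      obtain ⟨r, hr⟩ := hsurj c
      exact ⟨r, (hl r).trans hr⟩⟩
  have : Module.Free A C := Module.Free.of_equiv l'
  have : Module.Finite A C := Module.Finite.equiv l'
  have : Module.FinitePresentation A C := Module.finitePresentation_of_projective A C
  have hfp : Algebra.FinitePresentation A C := inferInstance
  refine ⟨show Module.Flat A C from inferInstance, hfp, ?_⟩
  refine (PrimeSpectrum.comap_surjective_iff_injective_of_finite (R := A) (S := C)).mpr ?_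
  rw [injective_iff_map_eq_zero]
  intro a ha
  have := hinj (fun _ => a) (by
    have ha' : φ a = 0 := ha
    simp [ha'])
  exact congrFun this (Classical.arbitrary D)

end FreeExtension

namespace Grading

variable {Y X : Scheme.{u}} {f : Y ⟶ X} {D : Type u} [CommGroup D] [Fintype D] (A : Grading f D)

lemma exists_units (x : X) : ∃ U, IsAffineOpen U ∧ x ∈ U ∧ ∃ e : D → Γ(Y, f ⁻¹ᵁ U),
    ∀ χ, A.wt U χ (e χ) ∧ IsUnit (e χ) := by
  choose U hU hx e he heu using A.exists_unit x
  obtain ⟨V, hV, hxV, hVU⟩ := exists_affine_le (V := ⨅ χ, U χ) (x := x) (by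
    rw [← SetLike.mem_coe, TopologicalSpace.Opens.coe_iInf]
    exact Set.mem_iInter.mpr hx)
  have hVU' : ∀ χ, V ≤ U χ := fun χ => hVU.trans (iInf_le _ χ)
  exact ⟨V, hV, hxV, fun χ => secRes (f.preimage_mono (hVU' χ)) (e χ), fun χ =>
    ⟨A.wt_res (hVU' χ) (hU χ) hV (he χ), (heu χ).map _⟩⟩

lemma comp_sum {U : X.Opens} (hU : IsAffineOpen U) {c : D → Γ(Y, f ⁻¹ᵁ U)}
    (hc : ∀ χ, A.wt U χ (c χ)) (ψ : D) : A.comp U ψ (∑ χ, c χ) = c ψ := by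
  let p : Γ(Y, f ⁻¹ᵁ U) →+ Γ(Y, f ⁻¹ᵁ U) := AddMonoidHom.mk' (A.comp U ψ) (A.comp_add hU ψ)
  refine (map_sum p _ _).trans ((Finset.sum_eq_single ψ ?_ ?_).trans (A.comp_self hU (hc ψ)))
  · intro χ _ hχ
    exact A.comp_ne hU (hc χ) hχ.symm
  · simp

/-- The units `e χ` are a basis: a section of degree `χ` divided by `e χ` has trivial degree and so
comes from `X`. -/
lemma secPull_flat_finitePresentation {U : X.Opens} (hU : IsAffineOpen U)
    {e : D → Γ(Y, f ⁻¹ᵁ U)} (he : ∀ χ, A.wt U χ (e χ) ∧ IsUnit (e χ)) :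
    (secPull f (U := U) (V := f ⁻¹ᵁ U) le_rfl).Flat ∧
      (secPull f (U := U) (V := f ⁻¹ᵁ U) le_rfl).FinitePresentation ∧
      Function.Surjective (PrimeSpectrum.comap (secPull f (U := U) (V := f ⁻¹ᵁ U) le_rfl)) := by
  have hb : ∀ r χ, A.wt U χ (secPull f le_rfl r * e χ) := fun r χ => by
    simpa using A.wt_mul hU ((A.wt_one_iff hU).mpr ⟨r, rfl⟩) (he χ).1
  refine flat_and_finitePresentation_of_basis _ e (fun r h => ?_) fun c => ?_
  · ext χ
    have h1 := A.comp_sum hU (fun χ => hb (r χ) χ) χ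
    rw [h] at h1
    have h0 := A.comp_self hU ((A.wt_one_iff hU).mpr ⟨0, rfl⟩)
    rw [map_zero] at h0
    have h2 : A.comp U χ 0 = 0 := by
      have := A.comp_add hU χ 0 0
      rwa [add_zero, left_eq_add] at this
    rw [h2] at h1
    apply A.secPull_injective hU
    rw [Pi.zero_apply, map_zero]
    exact ((he χ).2.mul_left_eq_zero).mp h1.symm
  · have : ∀ χ, ∃ r, secPull f le_rfl r * e χ = A.comp U χ c := fun χ => by
      obtain ⟨v, hv⟩ := (he χ).2.exists_right_inv
      have h1 := A.wt_mul hU (A.wt_comp hU χ c) (A.wt_inv hU (he χ).1 hv)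
      rw [mul_inv_cancel, A.wt_one_iff hU] at h1
      obtain ⟨r, hr⟩ := h1
      exact ⟨r, by rw [hr, mul_assoc, mul_comm v, hv, mul_one]⟩
    choose r hr using this
    exact ⟨r, by rw [← A.sum_comp hU c]; exact Finset.sum_congr rfl fun χ _ => hr χ⟩

variable [IsAffineHom f]

include A in
lemma flat : Flat f := by
  rw [HasRingHomProperty.iff_exists_appLE (P := @Flat)
    (RingHom.Flat.stableUnderComposition.stableUnderCompositionWithLocalizationAway
      RingHom.Flat.holdsForLocalizationAway).1]
  intro y
  obtain ⟨U, hU, hy, e, he⟩ := A.exists_units (f y)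
  exact ⟨⟨U, hU⟩, ⟨_, hU.preimage f⟩, hy, le_rfl, (A.secPull_flat_finitePresentation hU he).1⟩

include A in
lemma locallyOfFinitePresentation : LocallyOfFinitePresentation f := by
  rw [HasRingHomProperty.iff_exists_appLE (P := @LocallyOfFinitePresentation)
    (RingHom.finitePresentation_stableUnderComposition.stableUnderCompositionWithLocalizationAway
      RingHom.finitePresentation_holdsForLocalizationAway).1]
  intro y
  obtain ⟨U, hU, hy, e, he⟩ := A.exists_units (f y)
  exact ⟨⟨U, hU⟩, ⟨_, hU.preimage f⟩, hy, le_rfl, (A.secPull_flat_finitePresentation hU he).2.1⟩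

include A in
lemma surjective : Surjective f := ⟨fun x => by
  obtain ⟨U, hU, hx, e, he⟩ := A.exists_units x
  rw [← SetLike.mem_coe, ← hU.range_fromSpec] at hx
  obtain ⟨p, rfl⟩ := hx
  obtain ⟨p', rfl⟩ := (A.secPull_flat_finitePresentation hU he).2.2 p
  refine ⟨(hU.preimage f).fromSpec p', ?_⟩
  have := hU.SpecMap_appLE_fromSpec f (hU.preimage f) le_rfl
  exact (congrArg (fun k => k p') this).symm⟩

end Grading

/-! ### From a grading to an action and a torsor -/

section ModuleObjects

variable {C : Type*} [Category C] [CartesianMonoidalCategory C] {M Y : C} [MonObj M]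

/-- A module object structure from an action on generalized points. -/
abbrev modObjOfLift (a : M ⊗ Y ⟶ Y) (h1 : ∀ (T : C) (y : T ⟶ Y), lift (1 : T ⟶ M) y ≫ a = y)
    (h2 : ∀ (T : C) (g h : T ⟶ M) (y : T ⟶ Y),
      lift (g * h) y ≫ a = lift g (lift h y ≫ a) ≫ a) : ModObj M Y where
  smul := a
  one_smul := by
    have h : (MonObj.one (X := M)) ▷ Y ≫ a = (λ_ Y).hom := by
      have := h1 _ (λ_ Y).hom
      rw [Hom.one_def, ← lift_whiskerRight, Category.assoc] at this
      refine Eq.trans ?_ this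
      rw [← Category.assoc]
      congr 1
      ext1
      · simp [toUnit_unique (toUnit (𝟙_ C ⊗ Y)) (fst _ _)]
      · simp [leftUnitor_hom]
    exact h
  mul_smul := by
    have h : (MonObj.mul (X := M)) ▷ Y ≫ a = (α_ M M Y).hom ≫ M ◁ a ≫ a := by
      have := h2 _ (fst (M ⊗ M) Y ≫ fst M M) (fst _ _ ≫ snd M M) (snd _ Y)
      rw [Hom.mul_def, ← lift_whiskerRight, Category.assoc] at this
      have e1 : lift (lift (fst (M ⊗ M) Y ≫ fst M M) (fst _ _ ≫ snd M M)) (snd _ Y) = 𝟙 _ := by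
        ext1
        · ext1 <;> simp
        · simp
      have e2 : lift (fst (M ⊗ M) Y ≫ fst M M) (lift (fst (M ⊗ M) Y ≫ snd M M) (snd _ Y) ≫ a) =
          (α_ M M Y).hom ≫ M ◁ a := by
        ext1
        · simp
        · simp only [lift_snd, Category.assoc, whiskerLeft_snd]
          rw [← Category.assoc]
          congr 1
          ext1 <;> simp
      rw [e1, e2, Category.id_comp, Category.assoc] at this
      exact this
    exact h

end ModuleObjects

namespace Grading

section Composition

variable {Y X : Scheme.{u}} {f : Y ⟶ X} {D : Type u} [CommGroup D] [Fintype D] (A : Grading f D)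
  {T T' : Scheme.{u}}

lemma isAct_one (y : T ⟶ Y) : A.IsAct 1 y y := fun U hU χ a ha W h1 h2 => by
  rw [MonoidHom.one_apply, map_one, one_mul]

variable {A}

lemma IsAct.comp {c : D →* Γ(T, ⊤)} {y h : T ⟶ Y} (H : A.IsAct c y h) (k : T' ⟶ T)
    {c' : D →* Γ(T', ⊤)} (hc : ∀ χ, secPull k (le_preimage_top k ⊤) (c χ) = c' χ)
    {y' h' : T' ⟶ Y} (hy : k ≫ y = y') (hh : k ≫ h = h') : A.IsAct c' y' h' := by
  subst hy hh
  intro U hU χ a ha W h1 h2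
  have h1' : W ≤ k ⁻¹ᵁ (h ⁻¹ᵁ f ⁻¹ᵁ U ⊓ y ⁻¹ᵁ f ⁻¹ᵁ U) := le_inf h1 h2
  have := congrArg (secPull k h1') (H U hU χ a ha _ inf_le_left inf_le_right)
  rw [map_mul, secPull_comp rfl inf_le_left h1' h1, secPull_comp rfl inf_le_right h1' h2,
    secPull_secRes, ← secRes_secPull k (le_preimage_top k ⊤) le_top, hc] at this
  exact this

lemma IsAct.trans {c c' c'' : D →* Γ(T, ⊤)} {y h k : T ⟶ Y} (e : h ≫ f = y ≫ f)
    (H : A.IsAct c y h) (H' : A.IsAct c' h k) (hc : ∀ χ, c'' χ = c' χ * c χ) :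
    A.IsAct c'' y k := by
  intro U hU χ a ha W h1 h2
  have h3 : W ≤ h ⁻¹ᵁ f ⁻¹ᵁ U := by
    have : W ≤ (h ≫ f) ⁻¹ᵁ U := by rw [e]; exact h2
    exact this
  rw [H' U hU χ a ha W h1 h3, H U hU χ a ha W h3 h2, hc, map_mul, mul_assoc]

end Composition

section Action

variable {R D : Type u} [CommRing R] [CommGroup D] [Fintype D] {X Y : Over (Spec (.of R))}
  {f : Y ⟶ X} (A : Grading f.left D) [IsAffineHom f.left]

/-- The action is that of the universal character on the universal point; its values on other points
are pulled back from there. -/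
lemma exists_action : ∃ a : diagGrp R D ⊗ Y ⟶ Y, a ≫ f = snd _ _ ≫ f ∧
    A.IsAct (chr (fst (diagGrp R D) Y) ⊤) (snd (diagGrp R D) Y).left a.left := by
  obtain ⟨h, e, H⟩ := A.exists_isAct (chr (fst (diagGrp R D) Y) ⊤) (snd (diagGrp R D) Y).left
  refine ⟨Over.homMk h ?_, Over.OverMorphism.ext e, H⟩
  have h1 : f.left ≫ X.hom = Y.hom := Over.w f
  have h2 : (snd (diagGrp R D) Y).left ≫ Y.hom = (diagGrp R D ⊗ Y).hom := Over.w _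
  calc h ≫ Y.hom = (h ≫ f.left) ≫ X.hom := by rw [Category.assoc, h1]
    _ = _ := by rw [e, Category.assoc, h1, h2]

/-- The action of a diagonalizable group scheme defined by a grading. -/
def action : diagGrp R D ⊗ Y ⟶ Y := A.exists_action.choose

lemma action_comp : A.action ≫ f = snd _ _ ≫ f := A.exists_action.choose_spec.1

lemma lift_action_comp {T : Over (Spec (.of R))} (g : T ⟶ diagGrp R D) (y : T ⟶ Y) :
    (lift g y ≫ A.action) ≫ f = y ≫ f := by
  rw [Category.assoc, action_comp, lift_snd_assoc]

lemma isAct_lift {T : Over (Spec (.of R))} (g : T ⟶ diagGrp R D) (y : T ⟶ Y) :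
    A.IsAct (chr g ⊤) y.left (lift g y ≫ A.action).left :=
  IsAct.comp A.exists_action.choose_spec.2 (lift g y).left
    (fun χ => by
      rw [secPull_chr (lift g y) (fst (diagGrp R D) Y) (V := ⊤) (W := ⊤) (le_preimage_top _ _),
        lift_fst])
    (congrArg (fun k => k.left) (lift_snd g y)) rfl

lemma hom_ext {T : Over (Spec (.of R))} {c : D →* Γ(T.left, ⊤)} {y h h' : T ⟶ Y}
    (e : h ≫ f = y ≫ f) (e' : h' ≫ f = y ≫ f) (H : A.IsAct c y.left h.left)
    (H' : A.IsAct c y.left h'.left) : h = h' :=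
  Over.OverMorphism.ext (A.ext_of_isAct (congrArg (fun k => k.left) e)
    (congrArg (fun k => k.left) e') H H')

lemma lift_one_action {T : Over (Spec (.of R))} (y : T ⟶ Y) : lift 1 y ≫ A.action = y := by
  refine A.hom_ext (A.lift_action_comp 1 y) rfl (A.isAct_lift 1 y) ?_
  have h : chr (1 : T ⟶ diagGrp R D) ⊤ = 1 := MonoidHom.ext fun χ => chr_one ⊤ χ
  rw [h]
  exact A.isAct_one y.left

/-- Both sides are the action on `y` of the product of the two characters, and `hom_ext` says that
this determines the point. -/
lemma lift_mul_action {T : Over (Spec (.of R))} (g h : T ⟶ diagGrp R D) (y : T ⟶ Y) :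
    lift (g * h) y ≫ A.action = lift g (lift h y ≫ A.action) ≫ A.action :=
  A.hom_ext (A.lift_action_comp _ y)
    ((A.lift_action_comp g _).trans (A.lift_action_comp h y)) (A.isAct_lift (g * h) y)
    (IsAct.trans (congrArg (fun k => k.left) (A.lift_action_comp h y)) (A.isAct_lift h y)
      (A.isAct_lift g _) fun χ => chr_mul g h ⊤ χ)

/-- The action as a module object structure. -/
abbrev modObj : ModObj (diagGrp R D) Y :=
  modObjOfLift A.action (fun _ => A.lift_one_action) (fun _ => A.lift_mul_action)

/-- Two points of `Y` over the same point of `X` differ by a unique homomorphism from `D` to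
functions, that is by a unique point of the diagonalizable group. -/
lemma isPullback_of_action :
    IsPullback A.action (snd (diagGrp R D) Y) f f := by
  have key (s : PullbackCone f f) : ∃ g : s.pt ⟶ diagGrp R D, lift g s.snd ≫ A.action = s.fst := by
    have e : s.fst.left ≫ f.left = s.snd.left ≫ f.left :=
      congrArg (fun k => k.left) s.condition
    obtain ⟨c, hc⟩ := A.exists_char e
    obtain ⟨g, hg⟩ := exists_diagGrp_hom (R := R) c
    refine ⟨g, A.hom_ext (A.lift_action_comp g s.snd) s.condition (A.isAct_lift g s.snd) ?_⟩
    rwa [show chr g ⊤ = c from MonoidHom.ext hg]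
  refine ⟨⟨A.action_comp⟩, ⟨PullbackCone.IsLimit.mk A.action_comp
    (fun s => lift (key s).choose s.snd) (fun s => (key s).choose_spec) (fun s => lift_snd _ _)
    fun s m h1 h2 => ?_⟩⟩
  have hm : m = lift (m ≫ fst _ _) s.snd := by
    rw [← h2]
    ext1 <;> simp
  rw [hm]
  congr 1
  have h3 : lift (m ≫ fst _ _) s.snd ≫ A.action = s.fst := by rw [← hm, h1]
  have h4 := (key s).choose_spec
  generalize (key s).choose = g at h4
  generalize m ≫ fst _ _ = g' at h3
  have e : s.fst.left ≫ f.left = s.snd.left ≫ f.left := congrArg (fun k => k.left) s.condition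
  have h5 := A.isAct_lift g s.snd
  have h6 := A.isAct_lift g' s.snd
  rw [h4] at h5
  rw [h3] at h6
  exact diagGrp_hom_ext fun χ => congrArg (fun k => k χ) (A.char_unique e h6 h5)

/-- A grading defines a torsor under a diagonalizable group scheme. -/
theorem isTorsor : letI := A.modObj; IsTorsor (diagGrp R D) f :=
  letI := A.modObj
  { flat := A.flat
    surjective := A.surjective
    locallyOfFinitePresentation := A.locallyOfFinitePresentation
    isPullback := A.isPullback_of_action }

end Action

end Grading

/-! ### Quasi-coherence of integral functions -/

section IntegralSections

lemma exists_secRes_eq_pow_mul {X : Scheme.{u}} {W : X.Opens} (hW : IsAffineOpen W) (s : Γ(X, W))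
    {V : X.Opens} (e : V = X.basicOpen s) (h : V ≤ W) (a : Γ(X, V)) :
    ∃ (n : ℕ) (b : Γ(X, W)), secRes h b = secRes h s ^ n * a := by
  subst e
  exact exists_eq_pow_mul_of_isAffineOpen X W hW s a

lemma exists_pow_mul_eq_zero {X : Scheme.{u}} {W : X.Opens} (hW : IsCompact W.1) (s : Γ(X, W))
    {V : X.Opens} (e : V = X.basicOpen s) (h : V ≤ W) {a : Γ(X, W)} (ha : secRes h a = 0) :
    ∃ n : ℕ, s ^ n * a = 0 := by
  subst e
  exact exists_pow_mul_eq_zero_of_res_basicOpen_eq_zero_of_isCompact X hW a s ha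

lemma preimage_basicOpen_secPull {X Y : Scheme.{u}} (q : Y ⟶ X) {U : X.Opens} (r : Γ(X, U)) :
    q ⁻¹ᵁ X.basicOpen r = Y.basicOpen (secPull q (V := q ⁻¹ᵁ U) le_rfl r) := by
  rw [Scheme.Hom.preimage_basicOpen, Scheme.Hom.app_eq_appLE]; rfl

variable {X Y : Scheme.{u}} (q : Y ⟶ X)

/-- A section over `q⁻¹ U` that is integral over `Γ(X, U)`. -/
abbrev IsIntegralSec (U : X.Opens) (c : Γ(Y, q ⁻¹ᵁ U)) : Prop :=
  (secPull q (U := U) (V := q ⁻¹ᵁ U) le_rfl).IsIntegralElem c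

lemma isIntegralSec_secPull {U : X.Opens} (a : Γ(X, U)) :
    IsIntegralSec q U (secPull q le_rfl a) := RingHom.isIntegralElem_map _

variable {q}

lemma IsIntegralSec.sum {U : X.Opens} {ι' : Type*} (s : Finset ι') {c : ι' → Γ(Y, q ⁻¹ᵁ U)}
    (hc : ∀ i ∈ s, IsIntegralSec q U (c i)) : IsIntegralSec q U (∑ i ∈ s, c i) :=
  Finset.sum_induction c (IsIntegralSec q U) (fun _ _ => RingHom.IsIntegralElem.add _)
    (RingHom.isIntegralElem_zero _) hc

lemma IsIntegralSec.res {U V : X.Opens} (h : V ≤ U) {c : Γ(Y, q ⁻¹ᵁ U)}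
    (hc : IsIntegralSec q U c) : IsIntegralSec q V (secRes (q.preimage_mono h) c) := by
  obtain ⟨p, hp, hp0⟩ := hc
  refine ⟨p.map (secRes h), hp.map _, ?_⟩
  have := congrArg (secRes (q.preimage_mono h)) hp0
  rw [Polynomial.hom_eval₂, map_zero] at this
  rw [Polynomial.eval₂_map, ← this]
  congr 1
  exact RingHom.ext fun a => (secPull_secRes q _ _ a).trans (secRes_secPull q _ _ a).symm

/-- Integral functions are the functions on the normalization, which is affine over `X`, so
denominators can be cleared there. -/
lemma IsIntegralSec.exists_of_basicOpen [QuasiCompact q] [QuasiSeparated q] {U : X.Opens}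
    (hU : IsAffineOpen U) (r : Γ(X, U)) {c : Γ(Y, q ⁻¹ᵁ X.basicOpen r)}
    (hc : IsIntegralSec q (X.basicOpen r) c) :
    ∃ (n : ℕ) (b : Γ(Y, q ⁻¹ᵁ U)), IsIntegralSec q U b ∧
      secRes (q.preimage_mono (X.basicOpen_le r)) b =
        secPull q (q.preimage_mono (X.basicOpen_le r)) r ^ n * c := by
  have hle : ∀ U, q ⁻¹ᵁ U ≤ q.toNormalization ⁻¹ᵁ q.fromNormalization ⁻¹ᵁ U := fun U => by
    rw [← Scheme.Hom.comp_preimage, q.toNormalization_fromNormalization]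
  obtain ⟨-, h1⟩ := bijOn_secPull_toNormalization q (hU.basicOpen r) (hle _)
  obtain ⟨-, h2⟩ := bijOn_secPull_toNormalization q hU (hle _)
  obtain ⟨a, rfl⟩ := (h1 c).mp hc
  obtain ⟨n, b, hb⟩ := exists_secRes_eq_pow_mul (hU.preimage q.fromNormalization)
    (secPull q.fromNormalization le_rfl r)
    (preimage_basicOpen_secPull q.fromNormalization r)
    (q.fromNormalization.preimage_mono (X.basicOpen_le r)) a
  refine ⟨n, secPull q.toNormalization (hle U) b, (h2 _).mpr ⟨b, rfl⟩, ?_⟩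
  have := congrArg (secPull q.toNormalization (hle _)) hb
  rw [map_mul, map_pow, secRes_secPull,
    secPull_comp q.toNormalization_fromNormalization _ _
      (q.preimage_mono (X.basicOpen_le r))] at this
  rw [← this, secRes_secPull, secPull_secRes]

end IntegralSections

/-! ### The subalgebra of functions with integral components -/

section WeightIntegral

variable {G D K : Type u} [CommGroup G] [Fintype G] [CommGroup D] [Fintype D] [Field K]
  (E : CharAction G D K) {Y : Over (Spec (.of K))} [ModObj (constGrp G K) Y] {Z : Scheme.{u}}
  {q : Y.left ⟶ Z} (hq : ∀ g : G, (trans Y g).left ≫ q = q)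

lemma proj_secRes {U V : Z.Opens} (h : V ≤ U) (χ : D) (c : Γ(Y.left, q ⁻¹ᵁ U)) :
    (secChar E hq V).proj χ (secRes (q.preimage_mono h) c) =
      secRes (q.preimage_mono h) ((secChar E hq U).proj χ c) := by
  have hw := fun ψ => isWt_secRes h ((secChar E hq U).isWt_proj ψ c)
  conv_lhs => rw [← (secChar E hq U).sum_proj c, map_sum, map_sum]
  rw [Finset.sum_eq_single χ, (hw χ).proj_self]
  · intro ψ _ hψ
    exact (hw ψ).proj_ne hψ.symm
  · simp

/-- The sections of `q_* 𝒪_Y` whose homogeneous components are integral. -/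
def weightIntegral (U : Z.Opens) : Subring Γ(Y.left, q ⁻¹ᵁ U) where
  -- The projections divide by `|G|`, which need not be invertible on the base. Integrality of `c`
  -- would not pass to its components, so it is imposed on them.
  carrier := {c | ∀ χ, IsIntegralSec q U ((secChar E hq U).proj χ c)}
  zero_mem' χ := by
    rw [map_zero]
    exact RingHom.isIntegralElem_zero _
  one_mem' χ := by
    classical
    by_cases h : χ = 1
    · rw [h, (CharAction.IsWt.one (A := secChar E hq U)).proj_self]
      exact RingHom.isIntegralElem_one _
    · rw [(CharAction.IsWt.one (A := secChar E hq U)).proj_ne h]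
      exact RingHom.isIntegralElem_zero _
  add_mem' ha hb χ := by
    rw [map_add]
    exact RingHom.IsIntegralElem.add _ (ha χ) (hb χ)
  neg_mem' ha χ := by
    rw [map_neg]
    exact RingHom.IsIntegralElem.neg _ (ha χ)
  mul_mem' ha hb χ := by
    rw [CharAction.proj_mul]
    exact IsIntegralSec.sum _ fun ψ _ => RingHom.IsIntegralElem.mul _ (ha ψ) (hb _)

variable {E hq}

lemma mem_weightIntegral_of_isWt {U : Z.Opens} {χ : D} {c : Γ(Y.left, q ⁻¹ᵁ U)}
    (hc : (secChar E hq U).IsWt χ c) :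
    c ∈ weightIntegral E hq U ↔ IsIntegralSec q U c := by
  refine ⟨fun h => hc.proj_self ▸ h χ, fun h ψ => ?_⟩
  by_cases e : ψ = χ
  · rwa [e, hc.proj_self]
  · rw [hc.proj_ne e]
    exact RingHom.isIntegralElem_zero _

lemma secPull_mem_weightIntegral {U : Z.Opens} (a : Γ(Z, U)) :
    secPull q le_rfl a ∈ weightIntegral E hq U :=
  (mem_weightIntegral_of_isWt (isWt_one_secPull a)).mpr (isIntegralSec_secPull q a)

lemma proj_mem_weightIntegral {U : Z.Opens} {c : Γ(Y.left, q ⁻¹ᵁ U)}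
    (hc : c ∈ weightIntegral E hq U) (χ : D) :
    (secChar E hq U).proj χ c ∈ weightIntegral E hq U :=
  (mem_weightIntegral_of_isWt ((secChar E hq U).isWt_proj χ c)).mpr (hc χ)

lemma secRes_mem_weightIntegral {U V : Z.Opens} (h : V ≤ U) {c : Γ(Y.left, q ⁻¹ᵁ U)}
    (hc : c ∈ weightIntegral E hq U) :
    secRes (q.preimage_mono h) c ∈ weightIntegral E hq V := fun χ => by
  rw [proj_secRes E hq h]
  exact (hc χ).res h

/-- The components of `c` of weight other than `χ` vanish on the basic open, so a power of `r` kills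
them; there are finitely many. -/
lemma isWt_basicOpen [QuasiCompact q] {U : Z.Opens} (hU : IsAffineOpen U) (r : Γ(Z, U)) {χ : D}
    {c : Γ(Y.left, q ⁻¹ᵁ U)} (hc : (secChar E hq (Z.basicOpen r)).IsWt χ
      (secRes (q.preimage_mono (Z.basicOpen_le r)) c)) :
    ∃ n : ℕ, (secChar E hq U).IsWt χ (secPull q le_rfl r ^ n * c) := by
  have h0 : ∀ ψ, ψ ≠ χ → ∃ n : ℕ, secPull q le_rfl r ^ n * (secChar E hq U).proj ψ c = 0 :=
    fun ψ hψ => exists_pow_mul_eq_zero (q.isCompact_preimage hU.isCompact) _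
      (preimage_basicOpen_secPull q r) (q.preimage_mono (Z.basicOpen_le r))
      ((proj_secRes E hq (Z.basicOpen_le r) ψ c).symm.trans (hc.proj_ne hψ))
  choose! n hn using h0
  refine ⟨∑ ψ, n ψ, ?_⟩
  have : secPull q le_rfl r ^ (∑ ψ, n ψ) * c =
      secPull q le_rfl r ^ (∑ ψ, n ψ) * (secChar E hq U).proj χ c := by
    conv_lhs => rw [← (secChar E hq U).sum_proj c, Finset.mul_sum]
    refine Finset.sum_eq_single χ (fun ψ _ hψ => ?_) (by simp)
    obtain ⟨k, hk⟩ := Nat.exists_eq_add_of_le'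
      (Finset.single_le_sum (f := n) (fun _ _ => Nat.zero_le _) (Finset.mem_univ ψ))
    rw [hk, pow_add, mul_assoc, hn ψ hψ, mul_zero]
  rw [this]
  simpa using (isWt_one_secPull r).pow (∑ ψ, n ψ) |>.mul
    ((secChar E hq U).isWt_proj χ c)

lemma exists_mem_weightIntegral_of_basicOpen [QuasiCompact q] [QuasiSeparated q] {U : Z.Opens}
    (hU : IsAffineOpen U) (r : Γ(Z, U)) {c : Γ(Y.left, q ⁻¹ᵁ Z.basicOpen r)}
    (hc : c ∈ weightIntegral E hq (Z.basicOpen r)) :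
    ∃ n : ℕ, ∃ b ∈ weightIntegral E hq U, secRes (q.preimage_mono (Z.basicOpen_le r)) b =
      secPull q (q.preimage_mono (Z.basicOpen_le r)) r ^ n * c := by
  have h : ∀ χ, ∃ n : ℕ, ∃ b ∈ weightIntegral E hq U,
      secRes (q.preimage_mono (Z.basicOpen_le r)) b =
        secPull q (q.preimage_mono (Z.basicOpen_le r)) r ^ n *
          (secChar E hq (Z.basicOpen r)).proj χ c := fun χ => by
    obtain ⟨n, b, hb, hbc⟩ := (hc χ).exists_of_basicOpen hU r
    have hr : (secChar E hq (Z.basicOpen r)).IsWt 1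
        (secPull q (q.preimage_mono (Z.basicOpen_le r)) r) := by
      rw [← secRes_secPull q le_rfl (q.preimage_mono (Z.basicOpen_le r))]
      exact isWt_secRes (Z.basicOpen_le r) (isWt_one_secPull r)
    have hw : (secChar E hq (Z.basicOpen r)).IsWt χ
        (secRes (q.preimage_mono (Z.basicOpen_le r)) b) := by
      rw [hbc]
      simpa using (hr.pow n).mul ((secChar E hq (Z.basicOpen r)).isWt_proj χ c)
    obtain ⟨k, hk⟩ := isWt_basicOpen hU r hw
    refine ⟨k + n, _, (mem_weightIntegral_of_isWt hk).mpr (RingHom.IsIntegralElem.mul _ ?_ hb), ?_⟩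
    · rw [← map_pow]
      exact isIntegralSec_secPull q _
    · rw [map_mul, map_pow, secRes_secPull, hbc, pow_add, mul_assoc]
  choose n b hb hbc using h
  -- A common exponent for all components: each numerator is multiplied by the missing power of `r`.
  refine ⟨∑ χ, n χ, ∑ χ, secPull q le_rfl r ^ (∑ ψ, n ψ - n χ) * b χ,
    Subring.sum_mem _ fun χ _ => Subring.mul_mem _ (Subring.pow_mem _
      (secPull_mem_weightIntegral r) _) (hb χ), ?_⟩
  conv_rhs => rw [← (secChar E hq (Z.basicOpen r)).sum_proj c]
  rw [map_sum, Finset.mul_sum]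
  refine Finset.sum_congr rfl fun χ _ => ?_
  have hle := Finset.single_le_sum (f := n) (fun _ _ => Nat.zero_le _) (Finset.mem_univ χ)
  rw [map_mul, map_pow, secRes_secPull, hbc, ← mul_assoc, ← pow_add, Nat.sub_add_cancel hle]

end WeightIntegral

/-! ### The graded model over `X` -/

section GradedModel

variable {G D K : Type u} [CommGroup G] [Fintype G] [CommGroup D] [Fintype D] [Field K]
  (E : CharAction G D K) {Y : Over (Spec (.of K))} [ModObj (constGrp G K) Y] {Z : Scheme.{u}}
  {q : Y.left ⟶ Z} (hq : ∀ g : G, (trans Y g).left ≫ q = q)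

lemma le_preimage_of_comp_eq {X Y Z : Scheme.{u}} {i : X ⟶ Y} {f : Y ⟶ Z} {q : X ⟶ Z}
    (e : i ≫ f = q) (U : Z.Opens) : q ⁻¹ᵁ U ≤ i ⁻¹ᵁ f ⁻¹ᵁ U := by rw [← e]; rfl

variable {Y' : Scheme.{u}} {f' : Y' ⟶ Z} {i : Y.left ⟶ Y'} (e : i ≫ f' = q)

open Classical in
/-- The homogeneous component of a section of the model `Y'`. -/
def modelComp (U : Z.Opens) (χ : D) (a : Γ(Y', f' ⁻¹ᵁ U)) : Γ(Y', f' ⁻¹ᵁ U) :=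
  -- Over affine opens the component exists by `secPull_modelComp`; the value 0 is a default
  -- elsewhere.
  if h : ∃ b : Γ(Y', f' ⁻¹ᵁ U), secPull i (le_preimage_of_comp_eq e U) b =
    (secChar E hq U).proj χ (secPull i (le_preimage_of_comp_eq e U) a) then h.choose else 0

variable {E hq}

lemma secPull_modelComp (hmem : ∀ U, IsAffineOpen U → ∀ b, b ∈ weightIntegral E hq U ↔
      ∃ a, secPull i (le_preimage_of_comp_eq e U) a = b) {U : Z.Opens} (hU : IsAffineOpen U)
    (χ : D) (a : Γ(Y', f' ⁻¹ᵁ U)) :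
    secPull i (le_preimage_of_comp_eq e U) (modelComp E hq e U χ a) =
      (secChar E hq U).proj χ (secPull i (le_preimage_of_comp_eq e U) a) := by
  have h := (hmem U hU _).mp (proj_mem_weightIntegral ((hmem U hU _).mpr ⟨a, rfl⟩) χ)
  rw [modelComp, dif_pos h]
  exact h.choose_spec

/-- The grading of the model defined by the weights. -/
def modelGrading
    (hinj : ∀ U, IsAffineOpen U → Function.Injective (secPull i (le_preimage_of_comp_eq e U)))
    (hmem : ∀ U, IsAffineOpen U → ∀ b, b ∈ weightIntegral E hq U ↔
      ∃ a, secPull i (le_preimage_of_comp_eq e U) a = b)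
    (hone : ∀ U, IsAffineOpen U → ∀ c, (secChar E hq U).IsWt 1 c → IsIntegralSec q U c →
      ∃ r, secPull q le_rfl r = c)
    (hZ : ∀ U, IsAffineOpen U → Function.Injective (secPull q (U := U) (V := q ⁻¹ᵁ U) le_rfl))
    (hunit : ∀ x χ, ∃ U, IsAffineOpen U ∧ x ∈ U ∧ ∃ c : Γ(Y.left, q ⁻¹ᵁ U)ˣ,
      (secChar E hq U).IsWt χ c.val ∧ IsIntegralSec q U c.val ∧ IsIntegralSec q U (c⁻¹).val) :
    Grading f' D where
  wt U χ a := (secChar E hq U).IsWt χ (secPull i (le_preimage_of_comp_eq e U) a)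
  comp := modelComp E hq e
  wt_comp hU χ a := by
    rw [secPull_modelComp e hmem hU]
    exact CharAction.isWt_proj _ _ _
  comp_self hU χ a ha := by
    apply hinj _ hU
    rw [secPull_modelComp e hmem hU, ha.proj_self]
  comp_ne hU χ ψ a ha h := by
    apply hinj _ hU
    rw [secPull_modelComp e hmem hU, ha.proj_ne h, map_zero]
  comp_add hU χ a b := by
    apply hinj _ hU
    rw [map_add, secPull_modelComp e hmem hU, secPull_modelComp e hmem hU,
      secPull_modelComp e hmem hU, map_add, map_add]
  sum_comp hU a := by
    apply hinj _ hU
    rw [map_sum]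
    simp only [secPull_modelComp e hmem hU]
    exact CharAction.sum_proj _ _
  wt_mul {_} _ {_ _ a b} ha hb := by
    have := ha.mul hb
    rwa [← map_mul] at this
  wt_res {U V} h hU hV {χ a} ha := by
    have := isWt_secRes h ha
    rw [secRes_secPull] at this
    rw [secPull_secRes]
    exact this
  wt_one_iff {U} hU {a} := by
    constructor
    · intro ha
      obtain ⟨r, hr⟩ := hone U hU _ ha
        ((mem_weightIntegral_of_isWt ha).mp ((hmem U hU _).mpr ⟨a, rfl⟩))
      refine ⟨r, hinj U hU ?_⟩
      rw [← hr]
      exact secPull_comp e _ _ _ r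
    · rintro ⟨r, rfl⟩
      have := isWt_one_secPull (E := E) (hq := hq) r
      rw [← secPull_comp e le_rfl (le_preimage_of_comp_eq e U) le_rfl r] at this
      exact this
  secPull_injective {U} hU a b h := by
    apply hZ U hU
    rw [← secPull_comp e le_rfl (le_preimage_of_comp_eq e U) le_rfl a, h]
    exact secPull_comp e le_rfl (le_preimage_of_comp_eq e U) le_rfl b
  exists_unit x χ := by
    obtain ⟨U, hU, hx, c, hc, h1, h2⟩ := hunit x χ
    obtain ⟨a, ha⟩ := (hmem U hU _).mp ((mem_weightIntegral_of_isWt hc).mpr h1)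
    obtain ⟨b, hb⟩ := (hmem U hU _).mp ((mem_weightIntegral_of_isWt
      (hc.inv_of_mul_eq_one c.mul_inv)).mpr h2)
    refine ⟨U, hU, hx, a, ha ▸ hc, IsUnit.of_mul_eq_one b (hinj U hU ?_)⟩
    rw [map_mul, ha, hb, c.mul_inv, map_one]

end GradedModel

section Model

variable {R K : Type u} [CommRing R] [IsDomain R] [IsDiscreteValuationRing R] [Field K]
  [Algebra R K] [IsFractionRing R K] {X : Over (Spec (.of R))}
  {G D : Type u} [CommGroup G] [Fintype G] [CommGroup D] [Fintype D]
  (E : CharAction G D K) {Y : Over (Spec (.of K))} [ModObj (constGrp G K) Y]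
  {f : Y ⟶ (baseChange R K).obj X} (hf : IsTorsor (constGrp G K) f)

omit [IsDiscreteValuationRing R] in
include hf in
lemma IsTorsor.secPull_proj_injective [Flat X.hom] {U : X.left.Opens} (hU : IsAffineOpen U) :
    Function.Injective (secPull (f.left ≫ baseChangeProj K X) (U := U)
      (V := (f.left ≫ baseChangeProj K X) ⁻¹ᵁ U) le_rfl) := by
  have := hf.flat
  have := hf.surjective
  have := hf.locallyOfFinitePresentation
  rw [← secPull_comp_secPull f.left (baseChangeProj K X) U]
  exact (secPull_injective_of_flat f.left (baseChangeProj K X ⁻¹ᵁ U)).comp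
    (secPull_baseChangeProj_injective X K hU)

-- Trivial weight makes `c` descend to the generic fibre of `U`, where it is still integral, and
-- normality extends it to `U`. Thus the trivial component of the model is `𝒪_X`.
omit [IsDiscreteValuationRing R] in
lemma IsTorsor.exists_secPull_proj_eq [Flat X.hom] [IsNormalScheme X.left] {U : X.left.Opens}
    (hU : IsAffineOpen U) {c : Γ(Y.left, (f.left ≫ baseChangeProj K X) ⁻¹ᵁ U)}
    (hc : (secChar E hf.trans_proj U).IsWt 1 c)
    (hi : IsIntegralSec (f.left ≫ baseChangeProj K X) U c) :
    ∃ r, secPull (f.left ≫ baseChangeProj K X) le_rfl r = c := by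
  have := hf.flat
  have := hf.surjective
  have := hf.locallyOfFinitePresentation
  obtain ⟨b, rfl⟩ := hf.exists_secPull_eq E (U := baseChangeProj K X ⁻¹ᵁ U) hc
  have hi' := hi
  unfold IsIntegralSec at hi'
  rw [← secPull_comp_secPull f.left (baseChangeProj K X) U] at hi'
  obtain ⟨a, rfl⟩ := exists_secPull_eq_of_isIntegralElem X K hU b
    (RingHom.IsIntegralElem.of_map
      (secPull_injective_of_flat f.left (baseChangeProj K X ⁻¹ᵁ U)) hi')
  exact ⟨a, (secPull_comp rfl _ _ _ a).symm⟩

/-- The graded affine `X`-scheme that extends a torsor over the generic fibre. -/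
theorem IsTorsor.exists_model [Flat X.hom] [IsNormalScheme X.left]
    [IsIntegral ((baseChange R K).obj X).left]
    [IsIntegral ((baseChange R (IsLocalRing.ResidueField R)).obj X).left] [IsNoetherian Y.left]
    (hred : IsReduced
      ((baseChange R (IsLocalRing.ResidueField R)).obj (normalizationIn f)).left) {m : ℕ}
    (hPic : Set.SurjOn (Pic.map (baseChangeProj K X))
      (torsionPic m X.left) (torsionPic m ((baseChange R K).obj X).left))
    (hm : 0 < m) (hχ : ∀ χ : D, χ ^ m = 1) :
    ∃ (Y' : Scheme.{u}) (f' : Y' ⟶ X.left) (i : Y.left ⟶ Y')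
      (e : i ≫ f' = f.left ≫ baseChangeProj K X) (A : Grading f' D), IsAffineHom f' ∧
      (∀ U, IsAffineOpen U → Function.Injective (secPull i (le_preimage_of_comp_eq e U))) ∧
      ∀ U χ a, A.wt U χ a → (secChar E hf.trans_proj U).IsWt χ
        (secPull i (le_preimage_of_comp_eq e U) a) := by
  obtain ⟨Y', f', i, e, hf', H⟩ := exists_relativeSpec (f.left ≫ baseChangeProj K X)
    (weightIntegral E hf.trans_proj) (fun U a => secPull_mem_weightIntegral a)
    (fun U V h b hb => secRes_mem_weightIntegral h hb)
    (fun U hU r b hb => exists_mem_weightIntegral_of_basicOpen hU r hb)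
  refine ⟨Y', f', i, e, modelGrading e (fun U hU => (H U hU).1) (fun U hU => (H U hU).2)
    (fun U hU c hc hi => hf.exists_secPull_proj_eq E hU hc hi)
    (fun U hU => hf.secPull_proj_injective hU) ?_, hf', fun U hU => (H U hU).1,
    fun U χ a h => h⟩
  intro x χ
  -- Both `c ^ m` and its inverse come from `X`, so `c` and `c⁻¹` are integral and `c` is a unit of
  -- the model.
  obtain ⟨U, hU, hx, c, u, hc, hcu⟩ := hf.exists_root E hred hPic hm χ (hχ χ) x
  have hi : ∀ a, IsIntegralSec (f.left ≫ baseChangeProj K X) U (secPull _ le_rfl a) :=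
    fun a => isIntegralSec_secPull _ a
  have h1 : IsIntegralSec (f.left ≫ baseChangeProj K X) U c.val :=
    isIntegralElem_of_pow _ hm (hcu ▸ hi u.val)
  refine ⟨U, hU, hx, c, hc, h1, isIntegralElem_of_pow _ hm ?_⟩
  have h2 : (c⁻¹).val ^ m = secPull (f.left ≫ baseChangeProj K X) le_rfl (u⁻¹).val := by
    have h3 : c.val ^ m * (c⁻¹).val ^ m = 1 := by rw [← mul_pow, c.mul_inv, one_pow]
    have h4 : secPull (f.left ≫ baseChangeProj K X) le_rfl (u⁻¹).val * c.val ^ m = 1 := by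
      rw [hcu, ← map_mul, u.inv_mul, map_one]
    exact (left_inv_eq_right_inv h4 h3).symm
  rw [h2]
  exact hi _

end Model

/-! ### Isomorphisms of schemes affine over `X` -/

section IsoCriterion

lemma isIso_app_of_bijective_secPull {Y Z : Scheme.{u}} {r : Y ⟶ Z} {W : Z.Opens} {V : Y.Opens}
    (e : V = r ⁻¹ᵁ W) (H : ∀ h : V ≤ r ⁻¹ᵁ W, Function.Bijective (secPull r h)) :
    IsIso (r.app W) := by
  subst e
  rw [ConcreteCategory.isIso_iff_bijective, Scheme.Hom.app_eq_appLE]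
  exact H le_rfl

/-- Over an affine open of `X` source and target are affine, so sections decide. `V` is a separate
variable because the preimages met later agree only up to a proved equality. -/
lemma isIso_of_bijective_secPull {X Y Z : Scheme.{u}} (r : Y ⟶ Z) (g : Z ⟶ X) [IsAffineHom g]
    [IsAffineHom (r ≫ g)] (H : ∀ x : X, ∃ U, IsAffineOpen U ∧ x ∈ U ∧ ∃ V : Y.Opens,
      V = r ⁻¹ᵁ g ⁻¹ᵁ U ∧ ∀ h : V ≤ r ⁻¹ᵁ g ⁻¹ᵁ U, Function.Bijective (secPull r h)) : IsIso r := by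
  choose U hU hx V hV hb using H
  have hcov : ⨆ x, g ⁻¹ᵁ U x = ⊤ := by
    rw [eq_top_iff]
    intro z _
    exact TopologicalSpace.Opens.mem_iSup.mpr ⟨g z, hx (g z)⟩
  change (MorphismProperty.isomorphisms Scheme.{u}) r
  rw [IsZariskiLocalAtTarget.iff_of_iSup_eq_top (P := MorphismProperty.isomorphisms Scheme.{u})
    (fun x => g ⁻¹ᵁ U x) hcov]
  intro x
  have key : ∀ W, W = g ⁻¹ᵁ U x → IsIso (r.app W) := by
    rintro _ rfl
    exact isIso_app_of_bijective_secPull (hV x) (hb x)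
  have hk : IsIso (r.app ((g ⁻¹ᵁ U x).ι ''ᵁ ⊤)) := key _ (g ⁻¹ᵁ U x).ι_image_top
  have : IsIso (r ∣_ g ⁻¹ᵁ U x).appTop := by
    have hm : ∀ (A B : Y.Opens) (h : A = B), IsIso (Y.presheaf.map (eqToHom h).op) := by
      rintro _ _ rfl
      infer_instance
    rw [morphismRestrict_appTop]
    exact IsIso.comp_isIso' hk (hm _ _ _)
  have : IsAffine (g ⁻¹ᵁ U x) := (hU x).preimage g
  have : IsAffine (r ⁻¹ᵁ g ⁻¹ᵁ U x) := (hU x).preimage (r ≫ g)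
  have h2 := Scheme.isoSpec_hom_naturality (r ∣_ g ⁻¹ᵁ U x)
  change IsIso (r ∣_ g ⁻¹ᵁ U x)
  have h3 : (r ∣_ g ⁻¹ᵁ U x) = (r ⁻¹ᵁ g ⁻¹ᵁ U x).toScheme.isoSpec.hom ≫
      Spec.map (r ∣_ g ⁻¹ᵁ U x).appTop ≫ (g ⁻¹ᵁ U x).toScheme.isoSpec.inv := by
    rw [← Category.assoc, h2, Category.assoc, Iso.hom_inv_id, Category.comp_id]
  rw [h3]
  infer_instance

end IsoCriterion

/-! ### Points of a base change -/

section BaseChangePoints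

variable {R K : Type u} [CommRing R] [CommRing K] [Algebra R K]

/-- A scheme over `Spec K` as a scheme over `Spec R`. -/
abbrev restrictBase (R : Type u) [CommRing R] [Algebra R K] (T : Over (Spec (.of K))) :
    Over (Spec (.of R)) := Over.mk (T.hom ≫ specMap R K)

variable {T : Over (Spec (.of K))} {M N L : Over (Spec (.of R))}

/-- A point of a base change as a point of the original scheme. -/
def adj (a : T ⟶ (baseChange R K).obj M) : restrictBase R T ⟶ M :=
  Over.homMk (a.left ≫ baseChangeProj K M) (by
    have h1 : baseChangeProj K M ≫ M.hom = ((baseChange R K).obj M).hom ≫ specMap R K :=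
      pullback.condition
    refine (Category.assoc _ _ _).trans ((congrArg (a.left ≫ ·) h1).trans ?_)
    exact (Category.assoc _ _ _).symm.trans (congrArg (· ≫ specMap R K) (Over.w a)))

/-- Points of the base change over `K` are points of the original scheme; identities over `K` are
checked through `adj`. -/
lemma adj_injective {a b : T ⟶ (baseChange R K).obj M} (h : adj a = adj b) : a = b :=
  Over.OverMorphism.ext (pullback.hom_ext (congrArg (fun k => k.left) h)
    ((Over.w a).trans (Over.w b).symm))

lemma adj_comp_map (a : T ⟶ (baseChange R K).obj M) (φ : M ⟶ N) :
    adj (a ≫ (baseChange R K).map φ) = adj a ≫ φ := by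
  refine Over.OverMorphism.ext ?_
  have h1 : ((baseChange R K).map φ).left ≫ baseChangeProj K N = baseChangeProj K M ≫ φ.left :=
    pullback.lift_fst _ _ _
  exact (Category.assoc _ _ _).trans ((congrArg (a.left ≫ ·) h1).trans (Category.assoc _ _ _).symm)

lemma adj_lift_μ (a : T ⟶ (baseChange R K).obj M) (b : T ⟶ (baseChange R K).obj N) :
    adj (lift a b ≫ Functor.LaxMonoidal.μ (baseChange R K) M N) = lift (adj a) (adj b) := by
  have h1 := Over.μ_pullback_left_fst_fst (f := specMap R K) M N
  have h2 := Over.μ_pullback_left_fst_snd (f := specMap R K) M N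
  have ea : (lift a b).left ≫ pullback.fst _ _ = a.left :=
    congrArg (fun k => k.left) (lift_fst a b)
  have eb : (lift a b).left ≫ pullback.snd _ _ = b.left :=
    congrArg (fun k => k.left) (lift_snd a b)
  refine CartesianMonoidalCategory.hom_ext _ _ ?_ ?_
  · rw [lift_fst]
    refine Over.OverMorphism.ext ?_
    have := congrArg ((lift a b).left ≫ ·) h1
    refine Eq.trans ?_ (this.trans ?_)
    · exact (congrArg (· ≫ _) (Category.assoc _ _ _)).trans
        ((Category.assoc _ _ _).trans (congrArg _ (Category.assoc _ _ _)))
    · exact (Category.assoc _ _ _).symm.trans (congrArg (· ≫ _) ea)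
  · rw [lift_snd]
    refine Over.OverMorphism.ext ?_
    have := congrArg ((lift a b).left ≫ ·) h2
    refine Eq.trans ?_ (this.trans ?_)
    · exact (congrArg (· ≫ _) (Category.assoc _ _ _)).trans
        ((Category.assoc _ _ _).trans (congrArg _ (Category.assoc _ _ _)))
    · exact (Category.assoc _ _ _).symm.trans (congrArg (· ≫ _) eb)

lemma adj_lift_μ_map (a : T ⟶ (baseChange R K).obj M) (b : T ⟶ (baseChange R K).obj N)
    (φ : M ⊗ N ⟶ L) :
    adj (lift a b ≫ Functor.LaxMonoidal.μ (baseChange R K) M N ≫ (baseChange R K).map φ) =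
      lift (adj a) (adj b) ≫ φ := by
  rw [← Category.assoc, adj_comp_map, adj_lift_μ]

end BaseChangePoints

lemma isAffineHom_pullback_fst {X S T : Scheme.{u}} (f : X ⟶ S) (g : T ⟶ S) [h : IsAffineHom g] :
    IsAffineHom (pullback.fst f g) :=
  isAffineHom_isStableUnderBaseChange.of_isPullback (IsPullback.of_hasPullback f g).flip h

lemma isAffineHom_baseChangeProj {R : Type u} (K : Type u) [CommRing R] [CommRing K] [Algebra R K]
    (X : Over (Spec (.of R))) : IsAffineHom (baseChangeProj K X) :=
  isAffineHom_pullback_fst X.hom (specMap R K)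

/-! ### The generic fibre of the model is `Y` -/

section GenericFibre

variable {R K : Type u} [CommRing R] [IsDomain R] [Field K]
  [Algebra R K] [IsFractionRing R K] {X : Over (Spec (.of R))}
  {G D : Type u} [CommGroup G] [Fintype G] [CommGroup D] [Fintype D]
  (E : CharAction G D K) {Y : Over (Spec (.of K))} [ModObj (constGrp G K) Y]
  {f : Y ⟶ (baseChange R K).obj X} (hf : IsTorsor (constGrp G K) f)
  {Y' : Scheme.{u}} {f' : Y' ⟶ X.left} {i : Y.left ⟶ Y'}
  (e : i ≫ f' = f.left ≫ baseChangeProj K X)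

/-- The map from `Y` to the generic fibre of a model of `Y`. -/
def toGenericFibre : Y ⟶ (baseChange R K).obj (Over.mk (f' ≫ X.hom)) :=
  Over.homMk (pullback.lift i Y.hom (by
    rw [← hom_comp_specMap f, ← e, Category.assoc]
    rfl)) (pullback.lift_snd _ _ _)

omit [IsDomain R] [IsFractionRing R K] in
lemma toGenericFibre_proj :
    (toGenericFibre e).left ≫ baseChangeProj K (Over.mk (f' ≫ X.hom)) = i :=
  pullback.lift_fst _ _ _

omit [IsDomain R] [IsFractionRing R K] in
lemma toGenericFibre_map : toGenericFibre e ≫ (baseChange R K).map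
    (Over.homMk f' : Over.mk (f' ≫ X.hom) ⟶ X) = f := by
  refine adj_injective ((adj_comp_map _ _).trans (Over.OverMorphism.ext ?_))
  refine Eq.trans ?_ e
  exact congrArg (· ≫ f') (toGenericFibre_proj e)

-- Dividing `b` by the unit `c` leaves a function of trivial weight; it descends to the generic
-- fibre of `U`, where its denominators are cleared.
include hf in
lemma IsTorsor.exists_mul_eq_secPull_of_isWt {A : Grading f' D}
    (hA : ∀ U χ a, A.wt U χ a → (secChar E hf.trans_proj U).IsWt χ
        (secPull i (le_preimage_of_comp_eq e U) a)) {U : X.left.Opens} (hU : IsAffineOpen U)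
    {χ : D} {c : Γ(Y', f' ⁻¹ᵁ U)} (hc : A.wt U χ c) (hcu : IsUnit c)
    {b : Γ(Y.left, (f.left ≫ baseChangeProj K X) ⁻¹ᵁ U)}
    (hb : (secChar E hf.trans_proj U).IsWt χ b) :
    ∃ s : R, s ≠ 0 ∧ ∃ a, secPull i (le_preimage_of_comp_eq e U) a =
      evalSec Y.hom _ (algebraMap R K s) * b := by
  obtain ⟨v, hv⟩ := hcu.exists_right_inv
  have hv' : secPull i (le_preimage_of_comp_eq e U) c *
      secPull i (le_preimage_of_comp_eq e U) v = 1 := by rw [← map_mul, hv, map_one]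
  have h1 := ((hA U χ c hc).inv_of_mul_eq_one hv').mul hb
  rw [inv_mul_cancel] at h1
  obtain ⟨r, hr⟩ := hf.exists_secPull_eq E (U := baseChangeProj K X ⁻¹ᵁ U) h1
  obtain ⟨s, hs, a, ha⟩ := exists_mul_eq_secPull X K hU r
  refine ⟨s, hs, c * secPull f' le_rfl a, ?_⟩
  let q := f.left ≫ baseChangeProj K X
  let I : Γ(Y', f' ⁻¹ᵁ U) →+* Γ(Y.left, q ⁻¹ᵁ U) := secPull i (le_preimage_of_comp_eq e U)
  let F : Γ(((baseChange R K).obj X).left, baseChangeProj K X ⁻¹ᵁ U) →+* Γ(Y.left, q ⁻¹ᵁ U) :=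
    secPull f.left le_rfl
  let P : Γ(X.left, U) →+* Γ(((baseChange R K).obj X).left, baseChangeProj K X ⁻¹ᵁ U) :=
    secPull (baseChangeProj K X) le_rfl
  let P' : Γ(X.left, U) →+* Γ(Y', f' ⁻¹ᵁ U) := secPull f' le_rfl
  have h2 : I (P' a) = F (P a) := (secPull_comp e le_rfl (le_preimage_of_comp_eq e U) le_rfl a).trans
    (congrArg (fun k => k a) (secPull_comp_secPull f.left (baseChangeProj K X) U)).symm
  have h3 : F (evalSec ((baseChange R K).obj X).hom _ (algebraMap R K s)) =
      evalSec Y.hom (q ⁻¹ᵁ U) (algebraMap R K s) := secPull_evalSec_comp (Over.w f) _ _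
  have h4 : F r = I v * b := hr
  have hv'' : I c * I v = 1 := hv'
  have h5 : P a = evalSec ((baseChange R K).obj X).hom _ (algebraMap R K s) * r := ha
  change I (c * P' a) = _
  rw [map_mul, h2, h5, map_mul, h3, h4, mul_left_comm, ← mul_assoc (I c), hv'', one_mul]

-- Over an affine `U` with unit generators, clearing denominators reduces injectivity to `hinj`, and
-- surjectivity is obtained one weight at a time.
include hf in
lemma IsTorsor.isIso_toGenericFibre [Flat X.hom] [IsAffineHom f'] {A : Grading f' D}
    (hinj : ∀ U, IsAffineOpen U → Function.Injective (secPull i (le_preimage_of_comp_eq e U)))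
    (hA : ∀ U χ a, A.wt U χ a → (secChar E hf.trans_proj U).IsWt χ
        (secPull i (le_preimage_of_comp_eq e U) a)) :
    IsIso (toGenericFibre e) := by
  let N : Over (Spec (.of R)) := Over.mk (f' ≫ X.hom)
  let ρ := (toGenericFibre e).left
  let pr : ((baseChange R K).obj N).left ⟶ Y' := baseChangeProj K N
  have hρ : ρ ≫ pr = i := toGenericFibre_proj e
  have hρf : ρ ≫ pr ≫ f' = f.left ≫ baseChangeProj K X := by
    rw [← Category.assoc, hρ, e]
  have : IsAffineHom pr := isAffineHom_baseChangeProj K N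
  have : IsAffineHom (baseChangeProj K X) := isAffineHom_baseChangeProj K X
  have : IsFinite f.left := hf.isFinite
  have : IsAffineHom (ρ ≫ pr ≫ f') := by
    rw [hρf]
    infer_instance
  have hiso : IsIso ρ := by
    refine isIso_of_bijective_secPull ρ (pr ≫ f') fun x => ?_
    obtain ⟨U, hU, hx, c, hc⟩ := A.exists_units x
    refine ⟨U, hU, hx, (f.left ≫ baseChangeProj K X) ⁻¹ᵁ U, by rw [← hρf]; rfl, fun h => ?_⟩
    have hW : IsAffineOpen (f' ⁻¹ᵁ U) := hU.preimage f'
    have hρe : ∀ k, secPull ρ h (evalSec ((baseChange R K).obj N).hom (pr ⁻¹ᵁ f' ⁻¹ᵁ U) k) =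
        evalSec Y.hom _ k := fun k => secPull_evalSec_comp (Over.w (toGenericFibre e)) h k
    have hρp : ∀ a, secPull ρ h (secPull pr (V := pr ⁻¹ᵁ f' ⁻¹ᵁ U) le_rfl a) =
        secPull i (le_preimage_of_comp_eq e U) a := fun a =>
      secPull_comp hρ le_rfl h (le_preimage_of_comp_eq e U) a
    have hs0 : ∀ s : R, s ≠ 0 → algebraMap R K s ≠ 0 := fun s hs => by simpa using hs
    constructor
    · refine (injective_iff_map_eq_zero _).mpr fun s hs => ?_
      obtain ⟨t, ht, a, ha⟩ := exists_mul_eq_secPull N K hW s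
      have ha' := congrArg (secPull ρ h) ha
      have h1 : secPull i (le_preimage_of_comp_eq e U) a = 0 := by
        refine (hρp a).symm.trans (ha'.trans ?_)
        exact (map_mul (secPull ρ h) _ _).trans ((congrArg (_ * ·) hs).trans (mul_zero _))
      have h2 : a = 0 := hinj U hU (h1.trans (map_zero _).symm)
      rw [h2, map_zero] at ha
      exact (isUnit_evalSec_baseChange N K ht).mul_right_eq_zero.mp ha.symm
    · intro b
      have h1 : ∀ χ, ∃ b', secPull ρ h b' = (secChar E hf.trans_proj U).proj χ b := fun χ => by
        obtain ⟨s, hs, a, ha⟩ := hf.exists_mul_eq_secPull_of_isWt E e hA hU (hc χ).1 (hc χ).2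
          ((secChar E hf.trans_proj U).isWt_proj χ b)
        refine ⟨evalSec ((baseChange R K).obj N).hom (pr ⁻¹ᵁ f' ⁻¹ᵁ U) (algebraMap R K s)⁻¹ *
          secPull pr le_rfl a, ?_⟩
        have h5 : evalSec Y.hom ((f.left ≫ baseChangeProj K X) ⁻¹ᵁ U) (algebraMap R K s)⁻¹ *
            evalSec Y.hom _ (algebraMap R K s) = 1 := by
          rw [← map_mul, inv_mul_cancel₀ (hs0 s hs), map_one]
        refine (map_mul (secPull ρ h) _ _).trans ?_
        rw [hρe, hρp, ha, ← mul_assoc, h5, one_mul]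
      choose b' hb' using h1
      refine ⟨∑ χ, b' χ, (map_sum (secPull ρ h) _ _).trans ?_⟩
      rw [← (secChar E hf.trans_proj U).sum_proj b]
      exact Finset.sum_congr rfl fun χ _ => hb' χ
  have : IsIso ((Over.forget _).map (toGenericFibre e)) := hiso
  exact isIso_of_reflects_iso (toGenericFibre e) (Over.forget _)

end GenericFibre

/-! ### Fourier analysis on `G` -/

section CharacterFunctions

variable {G D K : Type u} [CommGroup G] [Fintype G] [CommGroup D] [Fintype D] [Field K]
  (E : CharAction G D K)

lemma sum_smul_delta_charFun (χ : D) :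
    charFun E χ = ∑ g : G, E.ev χ g • (FunAlg.delta g : FunAlg G K) :=
  FunAlg.sum_smul_delta _

lemma isGroupLikeElem_charFun (χ : D) : IsGroupLikeElem K (charFun E χ) where
  counit_eq_one := by
    change E.ev χ 1 = 1
    rw [map_one]
  comul_eq_tmul_self := by
    change FunAlg.comulLin G K (charFun E χ) = _
    rw [FunAlg.comulLin_apply]
    conv_rhs => rw [sum_smul_delta_charFun, TensorProduct.sum_tmul]
    refine Finset.sum_congr rfl fun g _ => ?_
    rw [TensorProduct.tmul_sum]
    refine Finset.sum_congr rfl fun h _ => ?_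
    rw [eval_charFun, map_mul, TensorProduct.smul_tmul_smul]

/-- Fourier inversion. -/
lemma exists_eq_sum_smul_charFun (c : FunAlg G K) :
    ∃ k : D → K, c = ∑ χ, algebraMap K (FunAlg G K) (k χ) * charFun E χ := by
  refine ⟨fun χ => E.inv * ∑ g, E.ev χ g⁻¹ * FunAlg.eval G K g c, FunAlg.ext_eval fun x => ?_⟩
  have h1 : ∀ χ, FunAlg.eval G K x (algebraMap K (FunAlg G K)
      (E.inv * ∑ g, E.ev χ g⁻¹ * FunAlg.eval G K g c) * charFun E χ) =
      ∑ g, E.inv * (FunAlg.eval G K g c * E.ev χ (g⁻¹ * x)) := fun χ => by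
    rw [map_mul, AlgHom.commutes, eval_charFun, Algebra.algebraMap_self_apply, Finset.mul_sum,
      Finset.sum_mul]
    refine Finset.sum_congr rfl fun g _ => ?_
    rw [map_mul]
    ring
  rw [map_sum, Finset.sum_congr rfl fun χ _ => h1 χ, Finset.sum_comm, Finset.sum_eq_single x]
  · simp only [inv_mul_cancel, map_one, mul_one, Finset.sum_const, Finset.card_univ, E.card_eq,
      nsmul_eq_mul]
    rw [← mul_assoc, mul_comm _ E.inv, E.inv_mul_card, one_mul]
  · intro g _ hg
    rw [← Finset.mul_sum, ← Finset.mul_sum, E.sum_ev _ (by rwa [ne_eq, inv_mul_eq_one]), mul_zero,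
      mul_zero]
  · simp

/-- The functions attached to distinct characters are linearly independent. -/
lemma eq_zero_of_sum_ev_eq_zero {k : D → K} (h : ∀ g, ∑ χ, k χ * E.ev χ g = 0) (χ : D) :
    k χ = 0 := by
  have h1 : ∑ g, E.inv * (E.ev χ⁻¹ g * ∑ ψ, k ψ * E.ev ψ g) = k χ := by
    have h2 : ∀ g, E.inv * (E.ev χ⁻¹ g * ∑ ψ, k ψ * E.ev ψ g) =
        ∑ ψ, E.inv * (k ψ * E.ev (χ⁻¹ * ψ) g) := fun g => by
      rw [Finset.mul_sum, Finset.mul_sum]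
      refine Finset.sum_congr rfl fun ψ _ => ?_
      rw [map_mul, MonoidHom.mul_apply]
      ring
    rw [Finset.sum_congr rfl fun g _ => h2 g, Finset.sum_comm, Finset.sum_eq_single χ]
    · simp only [inv_mul_cancel, map_one, MonoidHom.one_apply, mul_one, Finset.sum_const,
        Finset.card_univ, nsmul_eq_mul]
      rw [← mul_assoc, mul_comm _ E.inv, E.inv_mul_card, one_mul]
    · intro ψ _ hψ
      rw [← Finset.mul_sum, ← Finset.mul_sum, E.sum_ev' _ (by
        rw [ne_eq, inv_mul_eq_one]; exact hψ.symm), mul_zero, mul_zero]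
    · simp
  rw [← h1]
  exact Finset.sum_eq_zero fun g _ => by rw [h g, mul_zero, mul_zero]

end CharacterFunctions

/-! ### The constant group as a diagonalizable group over `K` -/

section DualGroup

lemma evalSec_id_bijective (A : Type u) [CommRing A] :
    Function.Bijective (evalSec (𝟙 (Spec (.of A))) ⊤) := by
  have h1 : (evalSec (𝟙 (Spec (.of A))) ⊤ : A →+* _) = (Scheme.ΓSpecIso (.of A)).inv.hom :=
    RingHom.ext fun a => secPull_eq_secRes (f := 𝟙 (Spec (.of A))) rfl _ le_rfl _ |>.trans (secRes_self _ _)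
  rw [h1]
  exact ConcreteCategory.bijective_of_isIso (Scheme.ΓSpecIso (.of A)).inv

lemma evalSec_id_algebraMap (R A : Type u) [CommRing R] [CommRing A] [Algebra R A] (r : R) :
    evalSec (𝟙 (Spec (.of A))) ⊤ (algebraMap R A r) = evalSec (specMap R A) ⊤ r :=
  (evalSec_comp_specMap (𝟙 (Spec (.of A))) (algebraMap R A) ⊤ r).symm.trans
    (congrArg (fun k => evalSec k ⊤ r) (Category.id_comp _))

variable {R K : Type u} [CommRing R] [Field K] [Algebra R K]

lemma exists_adj_eq {T : Over (Spec (.of K))} {M : Over (Spec (.of R))}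
    (t : restrictBase R T ⟶ M) : ∃ a : T ⟶ (baseChange R K).obj M, adj a = t :=
  ⟨Over.homMk (pullback.lift t.left T.hom (Over.w t)) (pullback.lift_snd _ _ _),
    Over.OverMorphism.ext (pullback.lift_fst _ _ _)⟩

variable {G D : Type u} [CommGroup G] [Fintype G] [CommGroup D] [Fintype D]
  (E : CharAction G D K)

/-- `charFun E χ` is multiplicative in `χ`, so the characters form a point of the diagonalizable
group with values in `G_K`; `φ` is this point. -/
lemma exists_charHom : ∃ φ : constGrp G K ⟶ (baseChange R K).obj (diagGrp R D),
    ∀ {T : Over (Spec (.of K))} (a : T ⟶ constGrp G K) (V : T.left.Opens) (χ : D),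
      chr (adj (a ≫ φ)) V χ = evalSec a.left V (charFun E χ) := by
  let c : D →* FunAlg G K :=
    { toFun := charFun E
      map_one' := FunAlg.ext_eval fun g => by rw [eval_charFun, map_one, map_one]; rfl
      map_mul' := fun χ ψ => FunAlg.ext_eval fun g => by
        rw [eval_charFun, map_mul, map_mul]; rfl }
  let C : D →* Γ((constGrp G K).left, ⊤) :=
    (evalSec (T := (constGrp G K).left) (A := FunAlg G K) (𝟙 _) ⊤).toMonoidHom.comp c
  obtain ⟨t, ht⟩ := exists_diagGrp_hom (R := R) (T := restrictBase R (constGrp G K)) C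
  obtain ⟨φ, rfl⟩ := exists_adj_eq t
  refine ⟨φ, fun {T} a V χ => ?_⟩
  have h1 := (secPull_evalSec a.left (adj φ).left (V := ⊤) (W := V) le_top
    (MonoidAlgebra.of R D χ)).symm
  have h2 := (congrArg (secPull a.left (V := V) (U := ⊤) le_top) (ht χ)).trans
    (secPull_evalSec_comp (Category.comp_id a.left) le_top (charFun E χ))
  refine Eq.trans ?_ (h1.trans h2)
  exact congrArg (fun k => evalSec k V (MonoidAlgebra.of R D χ)) (Category.assoc _ _ _)

variable {E}

/-- `B` plays the part of `K[D]`, known through `hB` as fractions of `R[D]`. Linear independence of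
characters gives injectivity, Fourier inversion surjectivity. -/
lemma bijective_of_eq_charFun [IsDomain R] [IsFractionRing R K] {S B C : Type*} [CommRing S]
    [CommRing B] [CommRing C] {c : MonoidAlgebra R D →+* S} {P : S →+* B} {F : B →+* C}
    {c' : FunAlg G K →+* C} {k₁ : K →+* B} (hc : Function.Bijective c) (hc' : Function.Bijective c')
    (hF1 : ∀ χ, F (P (c (MonoidAlgebra.of R D χ))) = c' (charFun E χ))
    (hFk : ∀ k, F (k₁ k) = c' (algebraMap K (FunAlg G K) k))
    (hPr : ∀ r, P (c (algebraMap R (MonoidAlgebra R D) r)) = k₁ (algebraMap R K r))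
    (hB : ∀ z, ∃ s : R, s ≠ 0 ∧ ∃ a, P a = k₁ (algebraMap R K s) * z) :
    Function.Bijective F := by
  have hFP : ∀ x : MonoidAlgebra R D, F (P (c x)) = c' (∑ χ, algebraMap K (FunAlg G K)
      (algebraMap R K (x.coeff χ)) * charFun E χ) := fun x => by
    have hx : x = ∑ χ, algebraMap R (MonoidAlgebra R D) (x.coeff χ) * MonoidAlgebra.of R D χ := by
      conv_lhs => rw [← MonoidAlgebra.sum_coeff_single x, Finsupp.sum_fintype _ _ (by simp)]
      refine Finset.sum_congr rfl fun χ _ => ?_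
      simp
    conv_lhs => rw [hx]
    simp only [map_sum, map_mul, hPr, hFk, hF1]
  constructor
  · refine (injective_iff_map_eq_zero _).mpr fun z hz => ?_
    obtain ⟨s, hs, a, ha⟩ := hB z
    obtain ⟨x, rfl⟩ := hc.2 a
    have h1 : ∑ χ, algebraMap K (FunAlg G K) (algebraMap R K (x.coeff χ)) * charFun E χ = 0 := by
      refine hc'.1 ?_
      rw [← hFP, ha, map_mul, hz, mul_zero, map_zero]
    have h2 : x = 0 := by
      ext χ
      have := eq_zero_of_sum_ev_eq_zero E (k := fun χ => algebraMap R K (x.coeff χ)) (fun g => by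
        have := congrArg (FunAlg.eval G K g) h1
        simpa [eval_charFun] using this) χ
      simpa using this
    rw [h2, map_zero, map_zero] at ha
    have hu : IsUnit (k₁ (algebraMap R K s)) :=
      (IsUnit.mk0 _ (by rwa [ne_eq, IsFractionRing.to_map_eq_zero_iff])).map _
    exact hu.mul_right_eq_zero.mp ha.symm
  · intro b
    obtain ⟨y, rfl⟩ := hc'.2 b
    obtain ⟨k, rfl⟩ := exists_eq_sum_smul_charFun E y
    refine ⟨∑ χ, k₁ (k χ) * P (c (MonoidAlgebra.of R D χ)), ?_⟩
    simp only [map_sum, map_mul, hFk, hF1]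

lemma secPull_secPull_evalSec_id {A : Type u} [CommRing A] {T T' : Scheme.{u}} (g : T' ⟶ T)
    (h : T ⟶ Spec (.of A)) (a : A) : secPull g (U := ⊤) (V := ⊤) le_top (secPull h (U := ⊤) le_top
      (evalSec (𝟙 (Spec (.of A))) ⊤ a)) = evalSec (g ≫ h) ⊤ a :=
  (congrArg (secPull g le_top) (secPull_evalSec_comp (Category.comp_id h) le_top a)).trans
    (secPull_evalSec_comp rfl le_top a)

lemma secPull_evalSec_over {A : Type u} [CommRing A] {T T' : Over (Spec (.of A))} (f : T' ⟶ T)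
    (a : A) : secPull f.left (U := ⊤) (V := ⊤) le_top (evalSec T.hom ⊤ a) = evalSec T'.hom ⊤ a :=
  secPull_evalSec_comp (Over.w f) le_top a

/-- The coordinate map of a base change, in terms of the coordinate ring. -/
lemma secPull_evalSec_id_algebraMap (R K A : Type u) [CommRing R] [CommRing K] [Algebra R K]
    [CommRing A] [Algebra R A] (r : R) :
    secPull (baseChangeProj K ((Spec (.of A)).asOver (Spec (.of R)))) (U := ⊤) (V := ⊤) le_top
      (evalSec (𝟙 (Spec (.of A))) ⊤ (algebraMap R A r)) =
    evalSec ((baseChange R K).obj ((Spec (.of A)).asOver (Spec (.of R)))).hom ⊤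
      (algebraMap R K r) :=
  (congrArg _ (evalSec_id_algebraMap R A r)).trans (secPull_evalSec_baseChange _ K le_top r)

lemma isIso_of_chr_eq [IsDomain R] [IsFractionRing R K]
    {φ : constGrp G K ⟶ (baseChange R K).obj (diagGrp R D)}
    (hφ : ∀ {T : Over (Spec (.of K))} (a : T ⟶ constGrp G K) (V : T.left.Opens) (χ : D),
      chr (adj (a ≫ φ)) V χ = evalSec a.left V (charFun E χ)) : IsIso φ := by
  have : IsAffineHom (baseChangeProj K (diagGrp R D)) := isAffineHom_baseChangeProj K _
  have : IsAffine (diagGrp R D).left := inferInstanceAs (IsAffine (Spec (.of (MonoidAlgebra R D))))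
  have : IsAffine (constGrp G K).left := inferInstanceAs (IsAffine (Spec (.of (FunAlg G K))))
  have : IsAffineHom (φ.left ≫ baseChangeProj K (diagGrp R D)) := inferInstance
  have hbij : Function.Bijective (secPull φ.left (U := ⊤) (V := ⊤) le_top) := by
    refine bijective_of_eq_charFun (E := E) (P := secPull (baseChangeProj K (diagGrp R D)) le_top)
      (k₁ := evalSec ((baseChange R K).obj (diagGrp R D)).hom ⊤)
      (evalSec_id_bijective (MonoidAlgebra R D)) (evalSec_id_bijective (FunAlg G K))
      (fun χ => ?_) (fun k => ?_) (secPull_evalSec_id_algebraMap R K _) (fun z => ?_)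
    · have h1 := hφ (𝟙 (constGrp G K)) ⊤ χ
      rw [Category.id_comp] at h1
      exact (secPull_secPull_evalSec_id φ.left (baseChangeProj K (diagGrp R D))
        (MonoidAlgebra.of R D χ)).trans h1
    · exact (secPull_evalSec_over φ k).trans (evalSec_id_algebraMap K (FunAlg G K) k).symm
    · exact exists_mul_eq_secPull (diagGrp R D) K (isAffineOpen_top (diagGrp R D).left) z
  have hiso : IsIso φ.left := isIso_of_bijective_secPull φ.left (baseChangeProj K (diagGrp R D)) fun x =>
    ⟨⊤, isAffineOpen_top (diagGrp R D).left, trivial, ⊤, rfl, fun _ => hbij⟩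
  have : IsIso ((Over.forget _).map φ) := hiso
  exact isIso_of_reflects_iso φ (Over.forget _)

lemma evalSec_one_charFun {T : Over (Spec (.of K))} (V : T.left.Opens) (χ : D) :
    evalSec (1 : T ⟶ constGrp G K).left V (charFun E χ) = 1 := by
  have h := evalSec_hom_mul (1 : T ⟶ constGrp G K) 1 (isGroupLikeElem_charFun E χ) V
  rw [mul_one] at h
  have hu : IsUnit (charFun E χ) := IsUnit.of_mul_eq_one (charFun E χ⁻¹)
    (FunAlg.ext_eval fun g => by
      rw [map_mul, eval_charFun, eval_charFun, ← MonoidHom.mul_apply, ← map_mul, mul_inv_cancel,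
        map_one, map_one]
      rfl)
  exact (hu.map (evalSec (1 : T ⟶ constGrp G K).left V)).mul_eq_left.mp h.symm

-- Points of the diagonalizable group are determined by their characters, and these correspond under
-- `φ` to the group-like functions `charFun E χ`.
open scoped Obj in
lemma isMonHom_of_chr_eq {φ : constGrp G K ⟶ (baseChange R K).obj (diagGrp R D)}
    (hφ : ∀ {T : Over (Spec (.of K))} (a : T ⟶ constGrp G K) (V : T.left.Opens) (χ : D),
      chr (adj (a ≫ φ)) V χ = evalSec a.left V (charFun E χ)) : IsMonHom φ where
  one_hom := by
    refine adj_injective (diagGrp_hom_ext fun χ => ?_)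
    have h1 : adj (η : 𝟙_ _ ⟶ (baseChange R K).obj (diagGrp R D)) = 1 := by
      rw [Functor.obj.η_def, adj_comp_map, Hom.one_def, toUnit_unique (adj _) (toUnit _)]
    have h2 : (η : 𝟙_ _ ⟶ constGrp G K) = 1 := by
      rw [Hom.one_def, toUnit_unique (toUnit _) (𝟙 _), Category.id_comp]
    rw [h1, chr_one, h2]
    exact (hφ _ ⊤ χ).trans (evalSec_one_charFun ⊤ χ)
  mul_hom := by
    refine adj_injective (diagGrp_hom_ext fun χ => ?_)
    have h1 : adj ((φ ⊗ₘ φ) ≫ (μ : (baseChange R K).obj (diagGrp R D) ⊗ _ ⟶ _)) =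
        adj (fst _ _ ≫ φ) * adj (snd _ _ ≫ φ) := by
      rw [Functor.obj.μ_def, Hom.mul_def, ← adj_lift_μ_map]
      congr 2
    have h2 : (μ : constGrp G K ⊗ constGrp G K ⟶ _) = fst _ _ * snd _ _ := by
      rw [Hom.mul_def, lift_fst_snd, Category.id_comp]
    rw [h1, h2]
    refine (hφ _ ⊤ χ).trans ((evalSec_hom_mul _ _ (isGroupLikeElem_charFun E χ) ⊤).trans ?_)
    exact (congrArg₂ (· * ·) (hφ _ ⊤ χ) (hφ _ ⊤ χ)).symm.trans (chr_mul _ _ ⊤ χ).symm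

end DualGroup

/-! ### Compatibility of the two actions -/

section Equivariance

variable {R K : Type u} [CommRing R] [Field K] [Algebra R K] {X : Over (Spec (.of R))}
  {G D : Type u} [CommGroup G] [Fintype G] [CommGroup D] [Fintype D]
  {E : CharAction G D K} {Y : Over (Spec (.of K))} [ModObj (constGrp G K) Y]
  {f : Y ⟶ (baseChange R K).obj X} (hf : IsTorsor (constGrp G K) f)
  {Y' : Over (Spec (.of R))} {f' : Y' ⟶ X} [IsAffineHom f'.left] (A : Grading f'.left D)
  {φ : constGrp G K ⟶ (baseChange R K).obj (diagGrp R D)}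
  {ρ : Y ⟶ (baseChange R K).obj Y'} (e : (adj ρ).left ≫ f'.left = f.left ≫ baseChangeProj K X)

-- Under the action of `G` a function of weight `χ` is multiplied by `charFun E χ`, which is the
-- value of the character `χ` along `φ`.
omit [IsAffineHom f'.left] in
include hf in
lemma IsTorsor.isAct_smul
    (hφ : ∀ {T : Over (Spec (.of K))} (a : T ⟶ constGrp G K) (V : T.left.Opens) (χ : D),
      chr (adj (a ≫ φ)) V χ = evalSec a.left V (charFun E χ))
    (hA : ∀ U χ a, A.wt U χ a → (secChar E hf.trans_proj U).IsWt χ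
      (secPull (adj ρ).left (le_preimage_of_comp_eq e U) a)) :
    A.IsAct (chr (adj (fst (constGrp G K) Y ≫ φ)) ⊤) (adj (snd (constGrp G K) Y ≫ ρ)).left
      (adj (smulHom (constGrp G K) Y ≫ ρ)).left := by
  intro U hU χ a ha W h1 h2
  have hs : (adj (smulHom (constGrp G K) Y ≫ ρ)).left =
      (smulHom (constGrp G K) Y).left ≫ (adj ρ).left := Category.assoc _ _ _
  have ht : (adj (snd (constGrp G K) Y ≫ ρ)).left =
      (snd (constGrp G K) Y).left ≫ (adj ρ).left := Category.assoc _ _ _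
  have hle : ∀ {t : (constGrp G K ⊗ Y).left ⟶ Y.left} {k : (constGrp G K ⊗ Y).left ⟶ Y'.left},
      k = t ≫ (adj ρ).left → W ≤ k ⁻¹ᵁ f'.left ⁻¹ᵁ U →
        W ≤ t ⁻¹ᵁ (f.left ≫ baseChangeProj K X) ⁻¹ᵁ U := fun hk h => by
    rw [← e]
    subst hk
    exact h
  have h3 := secPull_smul_of_isWt (hA U χ a ha) (hle hs h1) (hle ht h2)
  have h4 := (secRes_chr (adj (fst (constGrp G K) Y ≫ φ)) (le_top : W ≤ ⊤) χ).trans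
    (hφ (fst (constGrp G K) Y) W χ)
  refine (secPull_comp hs.symm (le_preimage_of_comp_eq e U) (hle hs h1) h1 a).symm.trans
    (h3.trans ?_)
  exact congrArg₂ (· * ·) h4.symm
    (secPull_comp ht.symm (le_preimage_of_comp_eq e U) (hle ht h2) h2 a)

-- Both sides are the action of the same character on the same point of `Y'`, and such an action has
-- only one result.
include hf in
lemma IsTorsor.smul_comp_eq (he : ρ ≫ (baseChange R K).map f' = f)
    (hφ : ∀ {T : Over (Spec (.of K))} (a : T ⟶ constGrp G K) (V : T.left.Opens) (χ : D),
      chr (adj (a ≫ φ)) V χ = evalSec a.left V (charFun E χ))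
    (hA : ∀ U χ a, A.wt U χ a → (secChar E hf.trans_proj U).IsWt χ
      (secPull (adj ρ).left (le_preimage_of_comp_eq e U) a)) :
    smulHom (constGrp G K) Y ≫ ρ = (φ ⊗ₘ ρ) ≫ Functor.LaxMonoidal.μ (baseChange R K) _ Y' ≫
      (baseChange R K).map A.action := by
  have h1 : φ ⊗ₘ ρ = lift (fst (constGrp G K) Y ≫ φ) (snd (constGrp G K) Y ≫ ρ) := by
    ext <;> simp
  refine adj_injective ?_
  rw [h1, adj_lift_μ_map]
  refine A.hom_ext ?_ (A.lift_action_comp _ _) (hf.isAct_smul A e hφ hA) (A.isAct_lift _ _)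
  rw [← adj_comp_map, ← adj_comp_map, Category.assoc, Category.assoc, he, hf.isPullback.w]

end Equivariance

/-! ### Characters with values in `K`, and the group scheme `Spec R[D]` -/

section Characters

variable {G K : Type u} [CommGroup G] [Fintype G] [Field K]

/-- The group of characters of a finite group with values in a field of characteristic zero that
contains enough roots of unity. -/
def characters [CharZero K] [HasEnoughRootsOfUnity K (Monoid.exponent G)] [Fintype (G →* Kˣ)] :
    CharAction G (G →* Kˣ) K where
  act := 1
  ev :=
    { toFun := fun χ => (Units.coeHom K).comp χ
      map_one' := rfl
      map_mul' := fun _ _ => rfl }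
  act_ev _ _ _ := rfl
  inv := (Fintype.card G : K)⁻¹
  inv_mul_card := inv_mul_cancel₀ (Nat.cast_ne_zero.mpr Fintype.card_ne_zero)
  sum_ev g hg := by
    obtain ⟨χ, hχ⟩ := CommGroup.exists_apply_ne_one_of_hasEnoughRootsOfUnity G K hg
    let e : (G →* Kˣ) →* K :=
      { toFun := fun χ => (χ g : K)
        map_one' := rfl
        map_mul' := fun _ _ => rfl }
    exact sum_hom_units_eq_zero e fun h => hχ (Units.ext (DFunLike.congr_fun h χ))
  sum_ev' χ hχ := sum_hom_units_eq_zero ((Units.coeHom K).comp χ) fun h =>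
    hχ (MonoidHom.ext fun g => Units.ext (DFunLike.congr_fun h g))
  card_eq := by
    rw [← Nat.card_eq_fintype_card, ← Nat.card_eq_fintype_card,
      CommGroup.card_monoidHom_of_hasEnoughRootsOfUnity G K]

lemma hasEnoughRootsOfUnity_of_isPrimitiveRoot {m : ℕ} [NeZero m] {ζ : K} (h : IsPrimitiveRoot ζ m) :
    HasEnoughRootsOfUnity K m where
  prim := ⟨ζ, h⟩
  cyc := inferInstance

end Characters

section Diagonalizable

variable (R D : Type u) [CommRing R] [CommGroup D] [Fintype D]

lemma isFinite_diagGrp_hom : IsFinite (diagGrp R D).hom := by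
  change IsFinite (Spec.map (CommRingCat.ofHom (algebraMap R (MonoidAlgebra R D))))
  rw [IsFinite.SpecMap_iff]
  exact RingHom.finite_algebraMap.mpr (Module.Finite.of_basis (MonoidAlgebra.basis D R))

omit [Fintype D] in
lemma flat_diagGrp_hom : Flat (diagGrp R D).hom := by
  change Flat (Spec.map (CommRingCat.ofHom (algebraMap R (MonoidAlgebra R D))))
  rw [Flat.SpecMap_iff]
  have := Module.Free.of_basis (MonoidAlgebra.basis D R)
  exact RingHom.flat_algebraMap_iff.mpr inferInstance

end Diagonalizable

/-! ### Assembly of the extension -/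

section Extension

variable {R K : Type u} [CommRing R] [IsDomain R] [IsDiscreteValuationRing R] [Field K]
  [Algebra R K] [IsFractionRing R K] {X : Over (Spec (.of R))}
  {G D : Type u} [CommGroup G] [Fintype G] [CommGroup D] [Fintype D]
  (E : CharAction G D K) {Y : Over (Spec (.of K))} [ModObj (constGrp G K) Y]
  {f : Y ⟶ (baseChange R K).obj X} (hf : IsTorsor (constGrp G K) f)

include E hf in
theorem IsTorsor.exists_extension [Flat X.hom] [IsNormalScheme X.left]
    [IsIntegral ((baseChange R K).obj X).left]
    [IsIntegral ((baseChange R (IsLocalRing.ResidueField R)).obj X).left] [IsNoetherian Y.left]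
    (hred : IsReduced
      ((baseChange R (IsLocalRing.ResidueField R)).obj (normalizationIn f)).left) {m : ℕ}
    (hPic : Set.SurjOn (Pic.map (baseChangeProj K X))
      (torsionPic m X.left) (torsionPic m ((baseChange R K).obj X).left))
    (hm : 0 < m) (hχ : ∀ χ : D, χ ^ m = 1) :
    ∃ (Y' : Over (Spec (.of R))) (_ : ModObj (diagGrp R D) Y') (f' : Y' ⟶ X),
      IsTorsor (diagGrp R D) f' ∧ TorsorExtends (diagGrp R D) f' (constGrp G K) f := by
  obtain ⟨Y', f', i, e, A, hf', hinj, hA⟩ := hf.exists_model E hred hPic hm hχ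
  obtain ⟨φ, hφ⟩ := exists_charHom (R := R) E
  have hφi : IsIso φ := isIso_of_chr_eq hφ
  have hρ : IsIso (toGenericFibre e) := hf.isIso_toGenericFibre E e hinj hA
  let f'' : Over.mk (f' ≫ X.hom) ⟶ X := Over.homMk f'
  let A' : Grading f''.left D := A
  have hf'' : IsAffineHom f''.left := hf'
  have e' : (adj (toGenericFibre e)).left ≫ f''.left = f.left ≫ baseChangeProj K X :=
    (congrArg (· ≫ f') (toGenericFibre_proj e)).trans e
  have hA' : ∀ U χ a, A'.wt U χ a → (secChar E hf.trans_proj U).IsWt χ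
      (secPull (adj (toGenericFibre e)).left (le_preimage_of_comp_eq e' U) a) := fun U χ a ha => by
    rw [secPull_congr (show (adj (toGenericFibre e)).left = i from toGenericFibre_proj e)]
    exact hA U χ a ha
  exact ⟨_, A'.modObj, f'', A'.isTorsor, asIso φ, asIso (toGenericFibre e),
    isMonHom_of_chr_eq hφ, toGenericFibre_map e,
    hf.smul_comp_eq A' e' (toGenericFibre_map e) hφ hA'⟩

end Extension

end

end WeakExtension

theorem mainTheorem4
    (R K : Type u) [CommRing R] [IsDomain R] [IsDiscreteValuationRing R]
    [Field K] [Algebra R K] [IsFractionRing R K] [CharZero K]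
    (p : ℕ) [Fact p.Prime] [CharP (IsLocalRing.ResidueField R) p]
    (G : Type u) [CommGroup G] [Fintype G] (m : ℕ) (hm : Fintype.card G = m)
    (hζ : ∃ ζ : R, IsPrimitiveRoot ζ m)
    (X : Over (Spec (.of R))) [IsNoetherian X.left] [IsNormalScheme X.left]
    [Flat X.hom] [Surjective X.hom]
    [IsIntegral ((baseChange R K).obj X).left]
    [IsIntegral ((baseChange R (IsLocalRing.ResidueField R)).obj X).left]
    (hPic : Set.BijOn (Pic.map (baseChangeProj K X))
      (torsionPic m X.left) (torsionPic m ((baseChange R K).obj X).left))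
    (YK : Over (Spec (.of K))) [IsNoetherian YK.left] [ConnectedSpace YK.left]
    [ModObj (constGrp G K) YK] (fK : YK ⟶ (baseChange R K).obj X)
    (hfK : IsTorsor (constGrp G K) fK)
    (hred : IsReduced
      ((baseChange R (IsLocalRing.ResidueField R)).obj (normalizationIn fK)).left) :
    ∃ (G' : Over (Spec (.of R))) (_ : GrpObj G') (Y' : Over (Spec (.of R)))
      (_ : ModObj G' Y') (f' : Y' ⟶ X),
      IsCommMonObj G' ∧ IsFinite G'.hom ∧ Flat G'.hom ∧
      IsTorsor G' f' ∧ TorsorExtends G' f' (constGrp G K) fK := by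
  have hm0 : 0 < m := hm ▸ Fintype.card_pos
  have : NeZero m := ⟨hm0.ne'⟩
  obtain ⟨ζ, hζ⟩ := hζ
  -- `R` embeds in `K`, so `ζ` stays primitive there; the exponent of `G` divides `m`.
  have hK : HasEnoughRootsOfUnity K m := hasEnoughRootsOfUnity_of_isPrimitiveRoot
    (hζ.map_of_injective (IsFractionRing.injective R K))
  have hG : HasEnoughRootsOfUnity K (Monoid.exponent G) :=
    HasEnoughRootsOfUnity.of_dvd K (hm ▸ Group.exponent_dvd_card)
  -- `Nat.card` is 0 on infinite types, so a nonzero count proves finiteness.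
  have hfin : Finite (G →* Kˣ) := Nat.finite_of_card_ne_zero (by
    rw [CommGroup.card_monoidHom_of_hasEnoughRootsOfUnity G K]
    exact Nat.card_pos.ne')
  let : Fintype (G →* Kˣ) := Fintype.ofFinite _
  have hχ : ∀ χ : G →* Kˣ, χ ^ m = 1 := fun χ => MonoidHom.ext fun g => by
    rw [MonoidHom.pow_apply, ← map_pow, ← hm, pow_card_eq_one, map_one, MonoidHom.one_apply]
  obtain ⟨Y', hY', f', h1, h2⟩ := hfK.exists_extension characters hred hPic.surjOn hm0 hχ
  exact ⟨diagGrp R (G →* Kˣ), inferInstance, Y', hY', f', inferInstance,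
    isFinite_diagGrp_hom R _, flat_diagGrp_hom R _, h1, h2⟩
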